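/- Let $S^2\subset\mathbb R^3$ be the unit sphere and let $C$ be an oriented simple closed piecewise smooth curve on $S^2$, i.e. $C$ is given by a closed, otherwise injective path $\mathbf c:[a,b]\to S^2$ and a partition $a=t_0<t_1<\dots<t_n=b$ ($n\ge 1$) such that $\mathbf c$ is $C^\infty$ with nowhere vanishing velocity on each $[t_{i-1},t_i]$ (one-sided derivatives at the end points). Let $\sigma$ be the region enclosed by $C$ with respect to which $C$ is positively oriented, i.e. the connected component of $S^2\setminus C$ lying immediately to the left of $C$ as seen from outside the sphere. A family of tangent vectors $\mathbf w(t)\perp\mathbf c(t)$, $t\in[a,b]$, continuous and differentiable on each $[t_{i-1},t_i]$, is parallel along $C$ if $d\mathbf w/dt$ has no component tangent to the sphere. For a parallel family of unit vectors, the total rotation of $\mathbf w$ relative to $C$ is the (real, not reduced mod $2\pi$) change of the continuously determined angle from the positive direction of $C$ to $\mathbf w$, summed over the smooth pieces, minus the sum over all vertices $\mathbf c(t_1),\dots,\mathbf c(t_n)$ (including the one where the curve closes up) of the signed angle in $(-\pi,\pi)$ from the positive direction of $C$ before the vertex to the one after it (at a cusp, where the two directions are opposite, this angle is taken to be $-\pi$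 if the points just ahead of the arriving curve belong to $\sigma$, and $\pi$ otherwise). The deficit angle $\Omega$ of $C$ is $2\pi$ plus the total rotation, relative to $C$, of a parallel family of unit vectors. Then: 1. For every such $C$ the deficit angle exists, does not depend on the choice of the parallel family, and equals the area of the enclosed region, $$\Omega=\iint_\sigma dA .$$ Moreover, every parallel family $\mathbf w$ along $C$ returns rotated by this angle: $\mathbf w(b)=\cos\Omega\,\mathbf w(a)+\sin\Omega\;\mathbf c(a)\times\mathbf w(a)$. 2. For $-\pi/2<\varphi<\pi/2$, the circle of latitude $\varphi$, $\mathbf c(t)=(\cos 2\pi t\cos\varphi,\ \sin 2\pi t\cos\varphi,\ \sin\varphi)$, $t\in[0,1]$, has deficit angle $$\Omega=2\pi(1-\sin\varphi),$$ and this is also the area of the region it encloses. -/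

import Mathlib

open Real Set Filter Topology MeasureTheory
open scoped ContDiff

/-- Euclidean three-space. -/
abbrev E3 : Type := EuclideanSpace ℝ (Fin 3)

/-- The (right-handed) vector product on `E3`. -/
noncomputable def cross (u v : E3) : E3 :=
  WithLp.toLp 2 (crossProduct (WithLp.ofLp u) (WithLp.ofLp v))

/-- Orthogonal projection of `v` to the tangent plane of the unit sphere at `p`. -/
noncomputable def tangentialPart (p v : E3) : E3 := v - inner ℝ p v • p

/-- For a unit vector `p` and `u` orthogonal to `p`: the vector `u` rotated about `p` by the angle
`θ`, counterclockwise as seen from outside the sphere. -/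
noncomputable def rotateAbout (p : E3) (θ : ℝ) (u : E3) : E3 :=
  Real.cos θ • u + Real.sin θ • cross p u

/-- An oriented simple closed piecewise smooth curve on the unit sphere, given by a regular
parametrization: on each of the `n ≥ 1` intervals `[knot i, knot (i+1)]` the map is smooth up to the
end points, with nowhere vanishing velocity. -/
structure SimpleClosedSphereCurve where
  n : ℕ
  n_pos : 0 < n
  knot : Fin (n + 1) → ℝ
  knot_strictMono : StrictMono knot
  toFun : ℝ → E3
  norm_eq_one : ∀ s ∈ Icc (knot 0) (knot (Fin.last n)), ‖toFun s‖ = 1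
  smooth : ∀ i : Fin n, ContDiffOn ℝ ∞ toFun (Icc (knot i.castSucc) (knot i.succ))
  regular : ∀ i : Fin n, ∀ s ∈ Icc (knot i.castSucc) (knot i.succ),
    derivWithin toFun (Icc (knot i.castSucc) (knot i.succ)) s ≠ 0
  closed : toFun (knot 0) = toFun (knot (Fin.last n))
  simple : InjOn toFun (Ico (knot 0) (knot (Fin.last n)))

namespace SimpleClosedSphereCurve

/-- The first parameter value. -/
def start (C : SimpleClosedSphereCurve) : ℝ := C.knot 0

/-- The last parameter value. -/
def finish (C : SimpleClosedSphereCurve) : ℝ := C.knot (Fin.last C.n)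

/-- The parameter interval of the `i`-th smooth piece. -/
def piece (C : SimpleClosedSphereCurve) (i : Fin C.n) : Set ℝ :=
  Icc (C.knot i.castSucc) (C.knot i.succ)

/-- The set of points of the curve. -/
def trace (C : SimpleClosedSphereCurve) : Set E3 := C.toFun '' Icc C.start C.finish

/-- The velocity along the `i`-th piece (one-sided at its end points). -/
noncomputable def velocity (C : SimpleClosedSphereCurve) (i : Fin C.n) (s : ℝ) : E3 :=
  derivWithin C.toFun (C.piece i) s

/-- The unit tangent vector (positive direction) along the `i`-th piece. -/
noncomputable def direction (C : SimpleClosedSphereCurve) (i : Fin C.n) (s : ℝ) : E3 :=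
  ‖C.velocity i s‖⁻¹ • C.velocity i s

/-- The region enclosed by the (positively oriented) curve: the part of the sphere to its left. It
consists of the points `x` of the sphere off the curve whose connected component in the complement
of the curve contains the points immediately to the left of the curve, at some interior point of
one of its smooth pieces. -/
def enclosedRegion (C : SimpleClosedSphereCurve) : Set E3 :=
  {x | ∃ i : Fin C.n, ∃ s ∈ Ioo (C.knot i.castSucc) (C.knot i.succ),
    ∀ᶠ ε : ℝ in 𝓝[>] 0,
      Real.cos ε • C.toFun s + Real.sin ε • cross (C.toFun s) (C.direction i s) ∈
        connectedComponentIn (Metric.sphere (0 : E3) 1 \ C.trace) x}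

/-- The area (surface measure of the unit sphere, of total mass `4π`) of the enclosed region. -/
noncomputable def enclosedArea (C : SimpleClosedSphereCurve) : ℝ :=
  ((volume : Measure E3).toSphere).real
    {x : Metric.sphere (0 : E3) 1 | (x : E3) ∈ C.enclosedRegion}

/-- The direction in which the curve arrives at the end point of its `i`-th piece. -/
noncomputable def directionBefore (C : SimpleClosedSphereCurve) (i : Fin C.n) : E3 :=
  C.direction i (C.knot i.succ)

/-- The direction in which the curve leaves the end point of its `i`-th piece, along the next piece
(the first piece, if `i` is the last one). -/
noncomputable def directionAfter (C : SimpleClosedSphereCurve) (i : Fin C.n) : E3 :=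
  C.direction (finRotate C.n i) (C.knot (finRotate C.n i).castSucc)

open Classical in
/-- The signed angle from the positive direction of the curve before the end point of the `i`-th
piece to the positive direction after it. It lies strictly between `-π` and `π`, except at a cusp
(opposite directions). There it is `-π` if the points just ahead of the arriving curve belong to the
enclosed region (interior angle `2π`), and `π` otherwise (interior angle `0`). -/
noncomputable def turningAngle (C : SimpleClosedSphereCurve) (i : Fin C.n) : ℝ :=
  if C.directionAfter i = -C.directionBefore i then
    if ∀ᶠ ε : ℝ in 𝓝[>] 0,
        Real.cos ε • C.toFun (C.knot i.succ) + Real.sin ε • C.directionBefore i ∈ C.enclosedRegion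
      then -π else π
  else
    Complex.arg ⟨inner ℝ (C.directionBefore i) (C.directionAfter i),
      inner ℝ (cross (C.toFun (C.knot i.succ)) (C.directionBefore i)) (C.directionAfter i)⟩

/-- `w` is a parallel family of tangent vectors of the sphere along the curve: its rate of change
has no tangential component. (It passes continuously through the vertices.) -/
structure IsParallel (C : SimpleClosedSphereCurve) (w : ℝ → E3) : Prop where
  tangent : ∀ s ∈ Icc C.start C.finish, inner ℝ (C.toFun s) (w s) = 0
  differentiableOn : ∀ i : Fin C.n, DifferentiableOn ℝ w (C.piece i)
  parallel : ∀ i : Fin C.n, ∀ s ∈ C.piece i,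
    tangentialPart (C.toFun s) (derivWithin w (C.piece i) s) = 0

/-- On each smooth piece, `α i` is a continuous determination of the angle from the positive
direction of the curve to the unit tangent vector `w`. -/
def IsRelativeAngle (C : SimpleClosedSphereCurve) (w : ℝ → E3) (α : Fin C.n → ℝ → ℝ) : Prop :=
  ∀ i : Fin C.n, ContinuousOn (α i) (C.piece i) ∧
    ∀ s ∈ C.piece i, w s = rotateAbout (C.toFun s) (α i s) (C.direction i s)

/-- The total angle of rotation relative to the curve: the change of the relative angle along the
smooth pieces, and at each vertex a jump by minus the turning angle of the curve. -/
noncomputable def relativeRotation (C : SimpleClosedSphereCurve) (α : Fin C.n → ℝ → ℝ) : ℝ :=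
  (∑ i : Fin C.n, (α i (C.knot i.succ) - α i (C.knot i.castSucc))) -
    ∑ i : Fin C.n, C.turningAngle i

/-- `Ω` is the deficit angle along the curve: `2π` plus the total rotation, relative to the curve,
of a unit tangent vector that is transported parallel to itself once around the curve
(equivalently, `2π` minus the total rotation of the direction of the curve relative to that
vector). -/
def HasDeficitAngle (C : SimpleClosedSphereCurve) (Ω : ℝ) : Prop :=
  ∃ (w : ℝ → E3) (α : Fin C.n → ℝ → ℝ), C.IsParallel w ∧
    (∀ s ∈ Icc C.start C.finish, ‖w s‖ = 1) ∧ C.IsRelativeAngle w α ∧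
    Ω = 2 * π + C.relativeRotation α

end SimpleClosedSphereCurve

/-- The parallel at geographic latitude `φ`, run through once counterclockwise for `t ∈ [0, 1]`. -/
noncomputable def latitudePath (φ t : ℝ) : E3 :=
  !₂[Real.cos (2 * π * t) * Real.cos φ, Real.sin (2 * π * t) * Real.cos φ, Real.sin φ]

theorem latitudePath_hasDerivAt (φ t : ℝ) : HasDerivAt (latitudePath φ)
    (!₂[-Real.sin (2 * π * t) * (2 * π) * Real.cos φ,
      Real.cos (2 * π * t) * (2 * π) * Real.cos φ, 0] : E3) t := by
  rw [← hasDerivWithinAt_univ, hasDerivWithinAt_iff_hasFDerivWithinAt,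
    hasFDerivWithinAt_euclidean]
  have h : HasDerivAt (fun t : ℝ => 2 * π * t) (2 * π) t := by
    simpa using (hasDerivAt_id t).const_mul (2 * π)
  intro i
  rw [hasFDerivWithinAt_univ, hasFDerivAt_iff_hasDerivAt]
  fin_cases i
  · simpa [latitudePath] using (h.cos.mul_const (Real.cos φ))
  · simpa [latitudePath] using (h.sin.mul_const (Real.cos φ))
  · simpa [latitudePath] using hasDerivAt_const t (Real.sin φ)

/-- The geographic parallel at latitude `φ`, `-π/2 < φ < π/2`, with counterclockwise orientation, as
a simple closed curve consisting of one smooth piece. -/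
noncomputable def latitudeCircle (φ : ℝ) (hφ : φ ∈ Ioo (-(π / 2)) (π / 2)) :
    SimpleClosedSphereCurve where
  n := 1
  n_pos := Nat.one_pos
  knot := fun i => ((i : ℕ) : ℝ)
  knot_strictMono := fun i j h => Nat.cast_lt.2 h
  toFun := latitudePath φ
  norm_eq_one := by
    intro s _
    rw [EuclideanSpace.norm_eq, Real.sqrt_eq_one]
    simp only [latitudePath, Fin.sum_univ_three, Real.norm_eq_abs, sq_abs]
    simp
    nlinarith [Real.sin_sq_add_cos_sq (2 * π * s), Real.sin_sq_add_cos_sq φ]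
  smooth := by
    intro i
    refine ContDiff.contDiffOn ?_
    rw [contDiff_euclidean]
    intro j
    fin_cases j
    · simp only [latitudePath]
      simp
      fun_prop
    · simp only [latitudePath]
      simp
      fun_prop
    · simp only [latitudePath]
      simp
      fun_prop
  regular := by
    intro i s hs h0
    have hc : 0 < Real.cos φ := Real.cos_pos_of_mem_Ioo hφ
    have hlt : ((i.castSucc : ℕ) : ℝ) < ((i.succ : ℕ) : ℝ) := by
      exact_mod_cast i.castSucc_lt_succ
    rw [(latitudePath_hasDerivAt φ s).hasDerivWithinAt.derivWithin
      (uniqueDiffOn_Icc hlt s hs)] at h0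
    have h1 := congrArg (fun v : E3 => v 0) h0
    have h2 := congrArg (fun v : E3 => v 1) h0
    simp [hc.ne', Real.pi_ne_zero] at h1 h2
    have := Real.sin_sq_add_cos_sq (2 * π * s)
    rw [h1, h2] at this
    norm_num at this
  closed := by
    simp [latitudePath]
  simple := by
    intro s hs t ht hst
    have hc : 0 < Real.cos φ := Real.cos_pos_of_mem_Ioo hφ
    have h1 := congrArg (fun v : E3 => v 0) hst
    have h2 := congrArg (fun v : E3 => v 1) hst
    simp [latitudePath, hc.ne'] at h1 h2 hs ht
    have h3 : Real.cos (2 * π * (s - t)) = 1 := by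
      rw [mul_sub, Real.cos_sub, h1, h2]
      nlinarith [Real.sin_sq_add_cos_sq (2 * π * t)]
    have hpi := Real.pi_pos
    have h4 := (Real.cos_eq_one_iff_of_lt_of_lt (by nlinarith) (by nlinarith)).1 h3
    have h5 : s - t = 0 := by
      rcases mul_eq_zero.1 h4 with h | h
      · nlinarith
      · exact h
    linarith

/-!
The area of the region on the left of a simple closed curve on the sphere is computed in a
stereographic chart, where it becomes a statement about winding numbers of a plane curve.

*Choice of the chart.* The sphere is projected from a point lying just to the right of the curve.
The chart preserves angles and orientation, and the winding number of the plane curve (put equal to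
`0` at the centre of projection) is a locally constant function on the complement of the curve.

*The rotation of the tangent.* Hopf's argument for the Umlaufsatz (`exists_rotation_data`) uses a
continuous angle of the secants `γ t - γ s`, `s < t`. It yields angles of the velocity along the
pieces and a jump at each vertex with total `2κ`, and at the same time it determines the winding
number about every point near the curve in terms of `κ` and the jump, as the two arcs issuing from a
point of the curve can be seen from a nearby point under an explicitly known angle
(`eventually_exists_angle_arc`). At smooth points the winding numbers to the left and to the right
are `(κ + π) / 2π` and `(κ - π) / 2π`. As the centre of projection lies to the right, `κ = π`, so
they are `1` and `0`. Every point off the curve can be joined to one side of a smooth point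
(`exists_eventually_mem_connectedComponentIn`), hence the enclosed region is the set of points with
winding number `1`, all other winding numbers are `0` (`exists_adapted_basis`), and the Jordan curve
theorem is not needed. At a vertex, the fact that `0` and `1` are the only possible values forces
the jump to be the turning angle, and at a cusp the value at the points ahead decides between `-π`
and `π` (`turningAngle_eq`).

*The area.* With the density `4 / (1 + |z|²)²` of the area of the sphere, Fubini's theorem and the
integral of the Cauchy kernel against this density turn the integral of the winding number into
`∫ 2 Im (conj γ · γ') / (1 + |γ|²)` along the curve (`PlaneCurve.integral_density_mul_wind`).

*Parallel transport.* The same function `2 Im (conj γ · γ') / (1 + |γ|²)` is the angular velocity of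
parallel vectors in the conformal frame of the chart (`hasDerivWithinAt_tcoord`). So parallel
vectors return rotated by the area. Relative to the curve they rotate by the area minus the rotation
of the tangent in the chart, which together with the turning angles is `2π`.

For a circle of latitude, an explicit parallel field gives the deficit angle, and the general result
then gives the area.
-/

/-! ### Continuous angles -/

/-- `β` is a continuous determination on `S` of the argument of the nowhere vanishing function
`f`. -/
structure IsAngleOn {X : Type*} [TopologicalSpace X] (β : X → ℝ) (f : X → ℂ) (S : Set X) :
    Prop where
  continuousOn : ContinuousOn β S
  ne_zero : ∀ x ∈ S, f x ≠ 0
  polar : ∀ x ∈ S, f x = ‖f x‖ * Complex.exp (β x * Complex.I)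

/-- A continuous function with values in a coset of `2πℤ` is constant on preconnected sets. -/
theorem IsPreconnected.eq_of_exp_mul_I_eq {X : Type*} [TopologicalSpace X] {S : Set X}
    (hS : IsPreconnected S) {h : X → ℝ} (hc : ContinuousOn h S) {u : ℂ}
    (he : ∀ x ∈ S, Complex.exp (h x * Complex.I) = u) {x y : X} (hx : x ∈ S) (hy : y ∈ S) :
    h x = h y := by
  have hmaps : MapsTo (fun z => (h z - h x) / (2 * π)) S (range ((↑) : ℤ → ℝ)) := by
    intro z hz
    have h1 : Complex.exp (h z * Complex.I) = Complex.exp (h x * Complex.I) := by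
      rw [he z hz, he x hx]
    obtain ⟨n, hn⟩ := Complex.exp_eq_exp_iff_exists_int.1 h1
    refine ⟨n, ?_⟩
    have h2 := congrArg Complex.im hn
    simp at h2
    have := Real.pi_pos
    simp only [h2]
    field_simp
    ring
  have hpc : IsPreconnected ((fun z => (h z - h x) / (2 * π)) '' S) :=
    hS.image _ ((hc.sub continuousOn_const).div_const _)
  have hsub : ((fun z => (h z - h x) / (2 * π)) '' S).Subsingleton := by
    have hd : IsTotallyDisconnected (range ((↑) : ℤ → ℝ)) :=
      (countable_range _).isTotallyDisconnected
    exact hd _ (image_subset_iff.2 hmaps) hpc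
  have := hsub (mem_image_of_mem _ hx) (mem_image_of_mem _ hy)
  have hpi := Real.pi_pos
  simp only [sub_self, zero_div] at this
  have h3 := (div_eq_zero_iff.1 this.symm).resolve_right (by positivity)
  linarith

namespace IsAngleOn

variable {X : Type*} [TopologicalSpace X] {β β' : X → ℝ} {f g : X → ℂ} {S T : Set X}

theorem mono (h : IsAngleOn β f S) (hT : T ⊆ S) : IsAngleOn β f T :=
  ⟨h.continuousOn.mono hT, fun x hx => h.ne_zero x (hT hx), fun x hx => h.polar x (hT hx)⟩

theorem exp_eq (h : IsAngleOn β f S) {x : X} (hx : x ∈ S) :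
    Complex.exp (β x * Complex.I) = f x / ‖f x‖ := by
  have h0 : (‖f x‖ : ℂ) ≠ 0 := by simpa using h.ne_zero x hx
  rw [eq_div_iff h0, mul_comm, ← h.polar x hx]

/-- Positive factors do not change the argument. -/
theorem of_pos_mul (h : IsAngleOn β f S) (r : X → ℝ) (hr : ∀ x ∈ S, 0 < r x)
    (hg : ∀ x ∈ S, g x = r x * f x) : IsAngleOn β g S := by
  refine ⟨h.continuousOn, fun x hx => ?_, fun x hx => ?_⟩
  · rw [hg x hx]
    exact mul_ne_zero (by exact_mod_cast (hr x hx).ne') (h.ne_zero x hx)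
  · rw [hg x hx, norm_mul, Complex.norm_real, Real.norm_of_nonneg (hr x hx).le]
    conv_lhs => rw [h.polar x hx]
    push_cast
    ring

theorem congr (h : IsAngleOn β f S) (hg : ∀ x ∈ S, g x = f x) : IsAngleOn β g S :=
  h.of_pos_mul (fun _ => 1) (fun _ _ => one_pos) (fun x hx => by simp [hg x hx])

theorem congr_angle (h : IsAngleOn β f S) (hg : ∀ x ∈ S, β' x = β x) : IsAngleOn β' f S :=
  ⟨h.continuousOn.congr hg, h.ne_zero, fun x hx => by rw [hg x hx]; exact h.polar x hx⟩

theorem mul (h : IsAngleOn β f S) (h' : IsAngleOn β' g S) :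
    IsAngleOn (fun x => β x + β' x) (fun x => f x * g x) S := by
  refine ⟨h.continuousOn.add h'.continuousOn,
    fun x hx => mul_ne_zero (h.ne_zero x hx) (h'.ne_zero x hx), fun x hx => ?_⟩
  rw [norm_mul]
  push_cast
  rw [add_mul, Complex.exp_add, mul_mul_mul_comm, ← h.polar x hx, ← h'.polar x hx]

theorem arg_comp (hg : ContinuousOn g S) (hs : ∀ x ∈ S, g x ∈ Complex.slitPlane) :
    IsAngleOn (fun x => Complex.arg (g x)) g S := by
  refine ⟨fun x hx => (Complex.continuousAt_arg (hs x hx)).comp_continuousWithinAt (hg x hx),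
    fun x hx => Complex.slitPlane_ne_zero (hs x hx), fun x hx => ?_⟩
  exact (Complex.norm_mul_exp_arg_mul_I _).symm

theorem add_const (h : IsAngleOn β f S) (c : ℝ) :
    IsAngleOn (fun x => β x + c) (fun x => f x * Complex.exp (c * Complex.I)) S := by
  refine ⟨h.continuousOn.add continuousOn_const,
    fun x hx => mul_ne_zero (h.ne_zero x hx) (Complex.exp_ne_zero _), fun x hx => ?_⟩
  rw [norm_mul, Complex.norm_exp_ofReal_mul_I, mul_one]
  push_cast
  rw [add_mul, Complex.exp_add, ← mul_assoc, ← h.polar x hx]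

theorem neg (h : IsAngleOn β f S) : IsAngleOn (fun x => β x + π) (fun x => - f x) S := by
  have := h.add_const π
  simpa [Complex.exp_pi_mul_I] using this

theorem comp {Y : Type*} [TopologicalSpace Y] (h : IsAngleOn β f S) {φ : Y → X} {U : Set Y}
    (hφ : ContinuousOn φ U) (hm : MapsTo φ U S) :
    IsAngleOn (fun y => β (φ y)) (fun y => f (φ y)) U :=
  ⟨h.continuousOn.comp hφ hm, fun _ hy => h.ne_zero _ (hm hy), fun _ hy => h.polar _ (hm hy)⟩

/-- Two continuous determinations of the argument differ by a constant on preconnected sets. -/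
theorem sub_eq_sub (h : IsAngleOn β f S) (h' : IsAngleOn β' f S) (hS : IsPreconnected S)
    {x y : X} (hx : x ∈ S) (hy : y ∈ S) : β y - β x = β' y - β' x := by
  have := hS.eq_of_exp_mul_I_eq (h := fun z => β z - β' z) (u := 1)
    (h.continuousOn.sub h'.continuousOn) (fun z hz => by
      have h0 : (‖f z‖ : ℂ) ≠ 0 := by simpa using h.ne_zero z hz
      push_cast
      rw [sub_mul, Complex.exp_sub, h.exp_eq hz, h'.exp_eq hz, div_self]
      exact div_ne_zero (h.ne_zero z hz) h0) hx hy
  linarith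

end IsAngleOn

/-- A continuous nowhere vanishing function on a convex set has a continuous argument. -/
theorem exists_isAngleOn {E : Type*} [NormedAddCommGroup E] [NormedSpace ℝ E] {K : Set E}
    (hK : Convex ℝ K) {f : E → ℂ} (hf : ContinuousOn f K) (h0 : ∀ x ∈ K, f x ≠ 0) :
    ∃ β : E → ℝ, IsAngleOn β f K := by
  classical
  rcases K.eq_empty_or_nonempty with rfl | hne
  · exact ⟨fun _ => 0, by simp, by simp, by simp⟩
  have := hK.contractibleSpace hne
  have := hK.locallyPathConnectedSpace
  have : SimplyConnectedSpace K := SimplyConnectedSpace.ofContractible K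
  obtain ⟨x₀, hx₀⟩ := hne
  obtain ⟨F, ⟨-, hF⟩, -⟩ := Complex.isCoveringMapOn_exp.existsUnique_continuousMap_lifts
    (⟨K.domRestrict f, continuousOn_iff_continuous_domRestrict.mp hf⟩ : C(K, ℂ))
    (a₀ := ⟨x₀, hx₀⟩) (Complex.exp_log (h0 x₀ hx₀)) (fun x => h0 x x.2)
  have hF' : ∀ x (hx : x ∈ K), Complex.exp (F ⟨x, hx⟩) = f x := fun x hx =>
    congrFun hF ⟨x, hx⟩
  refine ⟨fun x => if hx : x ∈ K then (F ⟨x, hx⟩).im else 0, ?_, h0, ?_⟩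
  · rw [continuousOn_iff_continuous_domRestrict]
    convert! Complex.continuous_im.comp (map_continuous F) using 1
    ext x
    simp [Set.domRestrict]
  · intro x hx
    simp only [hx, dite_true]
    rw [← hF' x hx, Complex.norm_exp]
    push_cast
    rw [← Complex.exp_add, Complex.re_add_im]

/-- The derivative of a continuous argument is the imaginary part of the logarithmic derivative. -/
theorem IsAngleOn.hasDerivWithinAt {β : ℝ → ℝ} {f : ℝ → ℂ} {S : Set ℝ} (h : IsAngleOn β f S)
    {t : ℝ} (ht : t ∈ S) {f' : ℂ} (hf : HasDerivWithinAt f f' S t) :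
    HasDerivWithinAt β (f' / f t).im S t := by
  have h0 := h.ne_zero t ht
  have hd : HasDerivWithinAt (fun s => Complex.log (f s / f t)) (f' / f t) S t := by
    have h1 : HasDerivWithinAt (fun s => f s / f t) (f' / f t) S t := hf.div_const _
    have h2 := h1.clog_real (by simp [div_self h0])
    simpa [h0] using h2
  have him : HasDerivWithinAt (fun s => β t + (Complex.log (f s / f t)).im) (f' / f t).im S t := by
    have := (Complex.imCLM.hasFDerivAt.comp_hasDerivWithinAt t hd)
    simpa using this.const_add (β t)
  refine him.congr_of_eventuallyEq ?_ (by simp [h0])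
  have hc : ∀ᶠ s in 𝓝[S] t, |β s - β t| < π := by
    have := (h.continuousOn t ht).sub_const (β t)
    have h2 : Tendsto (fun s => |β s - β t|) (𝓝[S] t) (𝓝 0) := by
      have := this.abs
      simpa [ContinuousWithinAt] using this
    exact h2.eventually (gt_mem_nhds Real.pi_pos)
  filter_upwards [hc, self_mem_nhdsWithin] with s hs hsS
  have h1 : f s / f t = ((‖f s‖ / ‖f t‖ : ℝ) : ℂ) * Complex.exp ((β s - β t : ℝ) * Complex.I) := by
    conv_lhs => rw [h.polar s hsS, h.polar t ht]
    push_cast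
    rw [sub_mul, Complex.exp_sub]
    have : (‖f t‖ : ℂ) ≠ 0 := by simpa using h0
    field_simp
  rw [Complex.log_im, h1, Complex.arg_real_mul _ (div_pos (norm_pos_iff.2 (h.ne_zero s hsS))
    (norm_pos_iff.2 h0)), Complex.arg_exp_mul_I, toIocMod_eq_self _ |>.2]
  · ring
  · rw [abs_lt] at hs
    constructor <;> linarith

theorem IsAngleOn.integral_eq {β : ℝ → ℝ} {f f' : ℝ → ℂ} {a b : ℝ} (hab : a ≤ b)
    (h : IsAngleOn β f (Icc a b)) (hf : ∀ t ∈ Icc a b, HasDerivWithinAt f (f' t) (Icc a b) t)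
    (hf' : ContinuousOn f' (Icc a b)) :
    ∫ t in a..b, (f' t / f t).im = β b - β a := by
  have hfc : ContinuousOn f (Icc a b) := fun t ht => (hf t ht).continuousWithinAt
  refine intervalIntegral.integral_eq_sub_of_hasDerivAt_of_le hab h.continuousOn
    (fun t ht => ?_) ?_
  · exact (h.hasDerivWithinAt (Ioo_subset_Icc_self ht) (hf t (Ioo_subset_Icc_self ht))).hasDerivAt
      (Icc_mem_nhds ht.1 ht.2)
  · refine ContinuousOn.intervalIntegrable ?_
    rw [uIcc_of_le hab]
    exact Complex.continuous_im.comp_continuousOn (hf'.div hfc h.ne_zero)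

/-! ### Subdivided intervals -/

theorem Fin.sum_succ_sub_castSucc {n : ℕ} (f : Fin (n + 1) → ℝ) :
    ∑ i : Fin n, (f i.succ - f i.castSucc) = f (Fin.last n) - f 0 := by
  induction n with
  | zero => simp
  | succ n ih =>
    rw [Fin.sum_univ_castSucc]
    have := ih (fun i => f i.castSucc)
    simp only [Fin.succ_castSucc, Fin.succ_last, Fin.castSucc_zero] at this ⊢
    linarith

/-- The `i`-th knot interval containing a given parameter. -/
theorem exists_mem_Ico_knot {n : ℕ} (k : Fin (n + 1) → ℝ) {s : ℝ}
    (hs : s ∈ Ico (k 0) (k (Fin.last n))) : ∃ i : Fin n, s ∈ Ico (k i.castSucc) (k i.succ) := by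
  induction n with
  | zero => exact absurd (hs.1.trans_lt hs.2) (lt_irrefl _)
  | succ n ih =>
    by_cases h : s < k (Fin.last n).castSucc
    · obtain ⟨i, hi⟩ := ih (fun i => k i.castSucc) ⟨hs.1, h⟩
      exact ⟨i.castSucc, hi⟩
    · exact ⟨Fin.last n, not_lt.1 h, hs.2⟩

theorem exists_mem_Icc_knot {n : ℕ} (k : Fin (n + 1) → ℝ) (hk : StrictMono k) (hn : 0 < n) {s : ℝ}
    (hs : s ∈ Icc (k 0) (k (Fin.last n))) : ∃ i : Fin n, s ∈ Icc (k i.castSucc) (k i.succ) := by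
  rcases hs.2.lt_or_eq with h | h
  · obtain ⟨i, hi⟩ := exists_mem_Ico_knot k ⟨hs.1, h⟩
    exact ⟨i, hi.1, hi.2.le⟩
  · obtain ⟨m, rfl⟩ := Nat.exists_eq_succ_of_ne_zero hn.ne'
    exact ⟨Fin.last m, by rw [h]; exact hk.monotone (Fin.le_last _), h.le⟩

theorem Icc_knot_subset {n : ℕ} {k : Fin (n + 1) → ℝ} (hk : StrictMono k) (i : Fin n) :
    Icc (k i.castSucc) (k i.succ) ⊆ Icc (k 0) (k (Fin.last n)) :=
  Icc_subset_Icc (hk.monotone (Fin.zero_le _)) (hk.monotone (Fin.le_last _))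

/-- A function which is continuous on each closed knot interval is continuous on their union. -/
theorem continuousOn_Icc_of_knot {Y : Type*} [TopologicalSpace Y] {n : ℕ} {k : Fin (n + 1) → ℝ}
    (hk : StrictMono k) (hn : 0 < n) {f : ℝ → Y}
    (hf : ∀ i : Fin n, ContinuousOn f (Icc (k i.castSucc) (k i.succ))) :
    ContinuousOn f (Icc (k 0) (k (Fin.last n))) := by
  have : Icc (k 0) (k (Fin.last n)) = ⋃ i : Fin n, Icc (k i.castSucc) (k i.succ) := by
    apply Subset.antisymm
    · intro s hs
      exact mem_iUnion.2 (exists_mem_Icc_knot k hk hn hs)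
    · exact iUnion_subset fun i => Icc_knot_subset hk i
  rw [this]
  exact (locallyFinite_of_finite _).continuousOn_iUnion (fun i => isClosed_Icc) hf

/-! ### Plane curves -/

/-- A simple closed piecewise `C¹` curve in the complex plane. The velocity `vel i` along the
`i`-th piece is extended to a continuous nowhere vanishing function of all parameters. -/
structure PlaneCurve where
  n : ℕ
  n_pos : 0 < n
  knot : Fin (n + 1) → ℝ
  knot_strictMono : StrictMono knot
  toFun : ℝ → ℂ
  vel : Fin n → ℝ → ℂ
  vel_continuous : ∀ i, Continuous (vel i)
  vel_ne_zero : ∀ i s, vel i s ≠ 0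
  hasDeriv : ∀ i, ∀ s ∈ Icc (knot i.castSucc) (knot i.succ),
    HasDerivWithinAt toFun (vel i s) (Icc (knot i.castSucc) (knot i.succ)) s
  closed : toFun (knot 0) = toFun (knot (Fin.last n))
  simple : InjOn toFun (Ico (knot 0) (knot (Fin.last n)))

namespace PlaneCurve

variable (Γ : PlaneCurve)

/-- The first parameter value. -/
def start : ℝ := Γ.knot 0

/-- The last parameter value. -/
def finish : ℝ := Γ.knot (Fin.last Γ.n)

/-- The parameter interval of the `i`-th piece. -/
def piece (i : Fin Γ.n) : Set ℝ := Icc (Γ.knot i.castSucc) (Γ.knot i.succ)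

/-- The set of points of the curve. -/
def trace : Set ℂ := Γ.toFun '' Icc Γ.start Γ.finish

theorem knot_lt (i : Fin Γ.n) : Γ.knot i.castSucc < Γ.knot i.succ :=
  Γ.knot_strictMono i.castSucc_lt_succ

theorem start_lt_finish : Γ.start < Γ.finish := by
  apply Γ.knot_strictMono
  rw [Fin.lt_def]
  simpa using Γ.n_pos

theorem piece_subset (i : Fin Γ.n) : Γ.piece i ⊆ Icc Γ.start Γ.finish :=
  Icc_knot_subset Γ.knot_strictMono i

theorem continuousOn : ContinuousOn Γ.toFun (Icc Γ.start Γ.finish) :=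
  continuousOn_Icc_of_knot Γ.knot_strictMono Γ.n_pos
    fun i s hs => (Γ.hasDeriv i s hs).continuousWithinAt

theorem isCompact_trace : IsCompact Γ.trace := isCompact_Icc.image_of_continuousOn Γ.continuousOn

theorem isClosed_trace : IsClosed Γ.trace := Γ.isCompact_trace.isClosed

theorem ne_of_lt {s t : ℝ} (hs : Γ.start ≤ s) (hst : s < t) (ht : t ≤ Γ.finish)
    (h : ¬ (s = Γ.start ∧ t = Γ.finish)) : Γ.toFun s ≠ Γ.toFun t := by
  intro he
  rcases ht.lt_or_eq with h1 | h1
  · exact hst.ne (Γ.simple ⟨hs, hst.trans h1⟩ ⟨hs.trans hst.le, h1⟩ he)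
  · have h2 : Γ.toFun s = Γ.toFun Γ.start := by
      rw [he, h1]
      exact Γ.closed.symm
    have h3 := Γ.simple ⟨hs, by rw [h1] at hst; exact hst⟩
      ⟨le_rfl, Γ.start_lt_finish⟩ h2
    exact h ⟨h3, h1⟩

theorem sub_ne_zero_of_notMem {x : ℂ} (hx : x ∉ Γ.trace) {t : ℝ} (ht : t ∈ Icc Γ.start Γ.finish) :
    Γ.toFun t - x ≠ 0 := fun h => hx ⟨t, ht, sub_eq_zero.1 h⟩

/-! ### Winding numbers -/

/-- The winding number of the curve about `x`, for points `x` off the curve. -/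
noncomputable def wind (x : ℂ) : ℝ :=
  (2 * π)⁻¹ * ∑ i : Fin Γ.n, ∫ t in (Γ.knot i.castSucc)..(Γ.knot i.succ),
    (Γ.vel i t / (Γ.toFun t - x)).im

theorem exists_angle {x : ℂ} (hx : x ∉ Γ.trace) :
    ∃ β : ℝ → ℝ, IsAngleOn β (fun t => Γ.toFun t - x) (Icc Γ.start Γ.finish) :=
  exists_isAngleOn (convex_Icc _ _) (Γ.continuousOn.sub continuousOn_const)
    fun _ ht => Γ.sub_ne_zero_of_notMem hx ht

/-- The winding number is the change of a continuous angle under which the curve is seen. -/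
theorem two_pi_mul_wind {x : ℂ} {β : ℝ → ℝ}
    (hβ : IsAngleOn β (fun t => Γ.toFun t - x) (Icc Γ.start Γ.finish)) :
    2 * π * Γ.wind x = β Γ.finish - β Γ.start := by
  have h1 : ∀ i : Fin Γ.n, ∫ t in (Γ.knot i.castSucc)..(Γ.knot i.succ),
      (Γ.vel i t / (Γ.toFun t - x)).im = β (Γ.knot i.succ) - β (Γ.knot i.castSucc) := fun i =>
    (hβ.mono (Γ.piece_subset i)).integral_eq (Γ.knot_lt i).le
      (fun t ht => (Γ.hasDeriv i t ht).sub_const x) (Γ.vel_continuous i).continuousOn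
  rw [wind, ← mul_assoc, mul_inv_cancel₀ (by positivity), one_mul, Finset.sum_congr rfl
    (fun i _ => h1 i), Fin.sum_succ_sub_castSucc (fun i => β (Γ.knot i))]
  rfl

/-- The winding number can be computed from separate determinations of the angle on two arcs. -/
theorem two_pi_mul_wind_split {x : ℂ} {s : ℝ} (hs : s ∈ Icc Γ.start Γ.finish) {β₁ β₂ : ℝ → ℝ}
    (h₁ : IsAngleOn β₁ (fun t => Γ.toFun t - x) (Icc Γ.start s))
    (h₂ : IsAngleOn β₂ (fun t => Γ.toFun t - x) (Icc s Γ.finish)) :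
    x ∉ Γ.trace ∧
      2 * π * Γ.wind x = (β₁ s - β₁ Γ.start) + (β₂ Γ.finish - β₂ s) := by
  have hx : x ∉ Γ.trace := by
    rintro ⟨t, ht, rfl⟩
    rcases le_total t s with h | h
    · exact h₁.ne_zero t ⟨ht.1, h⟩ (sub_self _)
    · exact h₂.ne_zero t ⟨h, ht.2⟩ (sub_self _)
  refine ⟨hx, ?_⟩
  obtain ⟨β, hβ⟩ := Γ.exists_angle hx
  rw [Γ.two_pi_mul_wind hβ,
    h₁.sub_eq_sub (hβ.mono (Icc_subset_Icc_right hs.2)) isPreconnected_Icc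
      (left_mem_Icc.2 hs.1) (right_mem_Icc.2 hs.1),
    h₂.sub_eq_sub (hβ.mono (Icc_subset_Icc_left hs.1)) isPreconnected_Icc
      (left_mem_Icc.2 hs.2) (right_mem_Icc.2 hs.2)]
  ring

theorem exists_int_wind {x : ℂ} (hx : x ∉ Γ.trace) : ∃ k : ℤ, Γ.wind x = k := by
  obtain ⟨β, hβ⟩ := Γ.exists_angle hx
  have h := Γ.two_pi_mul_wind hβ
  have ha := hβ.exp_eq (left_mem_Icc.2 Γ.start_lt_finish.le)
  have hb := hβ.exp_eq (right_mem_Icc.2 Γ.start_lt_finish.le)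
  have hc : Γ.toFun Γ.start = Γ.toFun Γ.finish := Γ.closed
  rw [hc, ← hb] at ha
  obtain ⟨k, hk⟩ := Complex.exp_eq_exp_iff_exists_int.1 ha
  have h2 := congrArg Complex.im hk
  simp at h2
  refine ⟨-k, ?_⟩
  have hpi := Real.pi_pos
  rw [h2] at h
  push_cast
  have : 2 * π * (Γ.wind x + k) = 0 := by linarith
  have := (mul_eq_zero.1 this).resolve_left (by positivity)
  linarith

/-- If `y` and `x` are never seen from the curve in opposite directions, the winding numbers about
them agree. -/
theorem wind_eq_of_slitPlane {x y : ℂ} (hx : x ∉ Γ.trace) (hy : ∀ t ∈ Icc Γ.start Γ.finish,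
    (Γ.toFun t - y) / (Γ.toFun t - x) ∈ Complex.slitPlane) : Γ.wind y = Γ.wind x := by
  obtain ⟨β, hβ⟩ := Γ.exists_angle hx
  have h1 := hβ.mul (IsAngleOn.arg_comp (g := fun t => (Γ.toFun t - y) / (Γ.toFun t - x))
    ((Γ.continuousOn.sub continuousOn_const).div (Γ.continuousOn.sub continuousOn_const)
      hβ.ne_zero) hy)
  have h2 := h1.congr (g := fun t => Γ.toFun t - y) (fun t ht => by
    have := hβ.ne_zero t ht
    field_simp)
  have hc : Γ.toFun Γ.start = Γ.toFun Γ.finish := Γ.closed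
  have h3 := Γ.two_pi_mul_wind h2
  have h4 := Γ.two_pi_mul_wind hβ
  simp only [hc] at h3
  have : 2 * π * Γ.wind y = 2 * π * Γ.wind x := by linarith
  exact mul_left_cancel₀ (by positivity) this

theorem eventually_wind_eq {x : ℂ} (hx : x ∉ Γ.trace) : ∀ᶠ y in 𝓝 x, Γ.wind y = Γ.wind x := by
  obtain ⟨r, hr, hball⟩ := Metric.isOpen_iff.1 Γ.isClosed_trace.isOpen_compl x hx
  filter_upwards [Metric.ball_mem_nhds x hr] with y hy
  refine Γ.wind_eq_of_slitPlane hx fun t ht => ?_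
  have h0 := Γ.sub_ne_zero_of_notMem hx ht
  have h1 : r ≤ ‖Γ.toFun t - x‖ := by
    by_contra hlt
    exact hball (show Γ.toFun t ∈ Metric.ball x r by
      rw [Metric.mem_ball, dist_eq_norm]; exact not_le.1 hlt) ⟨t, ht, rfl⟩
  have h2 : (Γ.toFun t - y) / (Γ.toFun t - x) = 1 + (x - y) / (Γ.toFun t - x) := by
    field_simp
    ring
  rw [h2]
  apply Complex.mem_slitPlane_of_norm_lt_one
  rw [norm_div, div_lt_one (norm_pos_iff.2 h0)]
  rw [Metric.mem_ball, dist_comm, dist_eq_norm] at hy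
  exact hy.trans_le h1

/-- The winding number vanishes outside a large disc. -/
theorem exists_wind_eq_zero : ∃ R : ℝ, ∀ x : ℂ, R < ‖x‖ → x ∉ Γ.trace ∧ Γ.wind x = 0 := by
  obtain ⟨R, hR⟩ := Γ.isCompact_trace.isBounded.exists_norm_le
  refine ⟨max R 0, fun x hx => ?_⟩
  have hx0 : 0 < ‖x‖ := (le_max_right _ _).trans_lt hx
  have hxne : x ≠ 0 := norm_pos_iff.1 hx0
  have hxR : R < ‖x‖ := (le_max_left _ _).trans_lt hx
  refine ⟨fun hmem => (hR x hmem).not_gt hxR, ?_⟩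
  have hs : ∀ t ∈ Icc Γ.start Γ.finish, 1 + (-(Γ.toFun t / x)) ∈ Complex.slitPlane := by
    intro t ht
    apply Complex.mem_slitPlane_of_norm_lt_one
    rw [norm_neg, norm_div, div_lt_one hx0]
    exact (hR _ ⟨t, ht, rfl⟩).trans_lt hxR
  have h1 := (IsAngleOn.arg_comp (g := fun t => 1 + (-(Γ.toFun t / x)))
    (continuousOn_const.add (Γ.continuousOn.div_const _).neg) hs).add_const (Complex.arg (-x))
  have h2 := h1.of_pos_mul (g := fun t => Γ.toFun t - x) (fun _ => ‖x‖) (fun _ _ => hx0)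
    (fun t _ => by
      have h3 := Complex.norm_mul_exp_arg_mul_I (-x)
      rw [norm_neg] at h3
      rw [mul_left_comm, h3]
      field_simp
      ring)
  have hc : Γ.toFun Γ.start = Γ.toFun Γ.finish := Γ.closed
  have h4 := Γ.two_pi_mul_wind h2
  simp only [hc, sub_self] at h4
  exact (mul_eq_zero.1 h4).resolve_left (by positivity)

end PlaneCurve

/-! ### Angles seen from a point near the curve -/

theorem Complex.ofReal_add_mem_slitPlane {z : ℂ} (hz : z ∈ Complex.slitPlane) {r : ℝ}
    (hr : 0 ≤ r) : (r : ℂ) + z ∈ Complex.slitPlane := by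
  rw [Complex.mem_slitPlane_iff] at hz ⊢
  simp
  rcases hz with h | h
  · left; linarith
  · right; exact h

theorem Complex.ofReal_mul_mem_slitPlane {z : ℂ} (hz : z ∈ Complex.slitPlane) {r : ℝ}
    (hr : 0 < r) : (r : ℂ) * z ∈ Complex.slitPlane := by
  rw [Complex.mem_slitPlane_iff] at hz ⊢
  simp
  rcases hz with h | h
  · left; positivity
  · right; exact ⟨hr.ne', h⟩

/-- An arc `τ ↦ τ h(τ)` leaving the origin in the direction `h 0` is seen from a point `ε E` close
to the origin. If the point does not lie in the direction of the arc, the angle of the arc as seen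
from the point can be expressed by an angle of `h`, since
`τ h(τ) - ε E = h(τ) (τ - ε E / h(τ))` and the second factor stays in the slit plane. -/
theorem eventually_exists_angle_arc {ℓ : ℝ} (hℓ : 0 < ℓ) {h : ℝ → ℂ}
    (hc : ContinuousOn h (Icc 0 ℓ)) {θ : ℝ → ℝ} (hθ : IsAngleOn θ h (Icc 0 ℓ)) {E : ℝ → ℂ}
    {E₀ : ℂ} (hE : Tendsto E (𝓝[>] 0) (𝓝 E₀)) (hs : -E₀ / h 0 ∈ Complex.slitPlane) :
    ∀ᶠ ε in 𝓝[>] (0 : ℝ), ∃ β : ℝ → ℝ, IsAngleOn β (fun τ => τ * h τ - ε * E ε) (Icc 0 ℓ) ∧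
      β 0 = θ 0 + Complex.arg (-E ε / h 0) ∧
      β ℓ = θ ℓ + Complex.arg (1 - ε * E ε / (ℓ * h ℓ)) := by
  have h0mem : (0 : ℝ) ∈ Icc 0 ℓ := left_mem_Icc.2 hℓ.le
  -- a positive lower bound for `‖h‖`
  obtain ⟨τ₀, hτ₀, hmin⟩ := isCompact_Icc.exists_isMinOn (nonempty_Icc.2 hℓ.le) hc.norm
  set m := ‖h τ₀‖ with hm
  have hmpos : 0 < m := norm_pos_iff.2 (hθ.ne_zero _ hτ₀)
  have hlow : ∀ τ ∈ Icc 0 ℓ, m ≤ ‖h τ‖ := fun τ hτ => hmin hτ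
  have hprod : Tendsto (fun p : ℝ × ℝ => -E p.1 / h p.2) (𝓝[>] 0 ×ˢ 𝓝[Icc 0 ℓ] 0)
      (𝓝 (-E₀ / h 0)) :=
    ((hE.comp tendsto_fst).neg).div ((hc 0 h0mem).tendsto.comp tendsto_snd) (hθ.ne_zero _ h0mem)
  obtain ⟨pa, hpa, pb, hpb, hab⟩ := eventually_prod_iff.1
    (hprod.eventually (Complex.isOpen_slitPlane.mem_nhds hs))
  obtain ⟨δ, hδ, hball⟩ := Metric.mem_nhdsWithin_iff.1 hpb
  have hsmall : Tendsto (fun ε : ℝ => ‖(ε : ℂ) * E ε‖) (𝓝[>] 0) (𝓝 0) := by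
    have h1 : Tendsto (fun ε : ℝ => (ε : ℂ)) (𝓝[>] 0) (𝓝 0) := by
      have := (Complex.continuous_ofReal.tendsto 0).mono_left
        (nhdsWithin_le_nhds (s := Ioi (0 : ℝ)))
      simpa using this
    simpa using (h1.mul hE).norm
  filter_upwards [hpa, hsmall.eventually (gt_mem_nhds (mul_pos hδ hmpos)), self_mem_nhdsWithin]
    with ε h1 h2 hε
  have hε : 0 < ε := hε
  have hQ : ∀ τ ∈ Icc 0 ℓ, (τ : ℂ) - ε * E ε / h τ ∈ Complex.slitPlane := by
    intro τ hτ
    have hre : (τ : ℂ) - ε * E ε / h τ = τ + ε * (-E ε / h τ) := by ring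
    rcases lt_or_ge τ δ with h3 | h3
    · have h4 : -E ε / h τ ∈ Complex.slitPlane := hab h1 (hball ⟨by
        rw [Metric.mem_ball, Real.dist_eq, sub_zero, abs_of_nonneg hτ.1]; exact h3, hτ⟩)
      rw [hre]
      exact Complex.ofReal_add_mem_slitPlane (Complex.ofReal_mul_mem_slitPlane h4 hε) hτ.1
    · rw [Complex.mem_slitPlane_iff]
      left
      have h5 : ‖(ε : ℂ) * E ε / h τ‖ < δ := by
        rw [norm_div, div_lt_iff₀ (hmpos.trans_le (hlow τ hτ))]
        exact h2.trans_le (mul_le_mul_of_nonneg_left (hlow τ hτ) hδ.le)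
      have h6 := (Complex.re_le_norm ((ε : ℂ) * E ε / h τ)).trans_lt h5
      rw [Complex.sub_re, Complex.ofReal_re]
      linarith
  have hQc : ContinuousOn (fun τ : ℝ => (τ : ℂ) - ε * E ε / h τ) (Icc 0 ℓ) :=
    Complex.continuous_ofReal.continuousOn.sub (continuousOn_const.div hc hθ.ne_zero)
  have h7 := hθ.mul (IsAngleOn.arg_comp hQc hQ)
  refine ⟨fun τ => θ τ + Complex.arg ((τ : ℂ) - ε * E ε / h τ),
    h7.congr (fun τ hτ => ?_), ?_, ?_⟩
  · have := hθ.ne_zero τ hτ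
    field_simp
  · have : ((0 : ℝ) : ℂ) - ε * E ε / h 0 = ε * (-E ε / h 0) := by push_cast; ring
    simp only [this, Complex.arg_real_mul _ hε]
  · have hne := hθ.ne_zero ℓ (right_mem_Icc.2 hℓ.le)
    have hℓ' : (ℓ : ℂ) ≠ 0 := by exact_mod_cast hℓ.ne'
    have : (ℓ : ℂ) - ε * E ε / h ℓ = ℓ * (1 - ε * E ε / (ℓ * h ℓ)) := by
      field_simp
    simp only [this, Complex.arg_real_mul _ hℓ]

/-! ### The rotation of the tangent by way of secants -/

/-- The next piece begins where the present one ends, or at the first knot after the last piece. -/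
theorem castSucc_finRotate {n : ℕ} (i : Fin n) :
    (finRotate n i).castSucc = i.succ ∨
      (i.succ = Fin.last n ∧ (finRotate n i).castSucc = 0) := by
  obtain ⟨m, rfl⟩ : ∃ m, n = m + 1 := ⟨n - 1, by have := i.2; omega⟩
  rcases eq_or_ne i (Fin.last m) with rfl | h
  · right
    simp
  · left
    have h1 : (i : ℕ) < m := by
      have := i.2
      have h2 : (i : ℕ) ≠ m := fun h3 => h (Fin.ext h3)
      omega
    ext
    rw [Fin.val_castSucc, coe_finRotate_of_ne_last h, Fin.val_succ]

/-- The difference quotient from an end point, extended by the derivative, is continuous. -/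
theorem continuousOn_slope_of_hasDerivWithinAt {f : ℝ → ℂ} {d : ℂ} {δ ℓ : ℝ} (hδ : 0 < δ)
    (hf : ContinuousOn f (Icc 0 ℓ)) (hd : HasDerivWithinAt f d (Icc 0 δ) 0) :
    ContinuousOn (fun τ : ℝ => if τ = 0 then d else (f τ - f 0) / τ) (Icc 0 ℓ) := by
  intro τ hτ
  by_cases h : τ = 0
  · subst h
    have h1 : ContinuousWithinAt (Function.update (fun τ : ℝ => (f τ - f 0) / τ) 0 d)
        (Icc 0 ℓ) 0 := by
      rw [continuousWithinAt_update_same]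
      rw [hasDerivWithinAt_iff_tendsto_slope] at hd
      refine (hd.mono_left ?_).congr fun τ => ?_
      · refine nhdsWithin_le_iff.2 ?_
        filter_upwards [self_mem_nhdsWithin, mem_nhdsWithin_of_mem_nhds (Iio_mem_nhds hδ)]
          with y hy hy'
        exact ⟨⟨hy.1.1, le_of_lt hy'⟩, hy.2⟩
      · rw [slope_def_module, sub_zero, Complex.real_smul]
        push_cast
        ring
    refine h1.congr (fun y _ => ?_) ?_
    · simp [Function.update_apply]
    · simp
  · have h1 : ContinuousWithinAt (fun τ : ℝ => (f τ - f 0) / τ) (Icc 0 ℓ) τ :=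
      ((hf τ hτ).sub continuousWithinAt_const).div
        Complex.continuous_ofReal.continuousWithinAt (by exact_mod_cast h)
    refine h1.congr_of_eventuallyEq ?_ (by simp [h])
    filter_upwards [mem_nhdsWithin_of_mem_nhds (isOpen_ne.mem_nhds h)] with y hy
    simp [show y ≠ 0 from hy]

theorem IsAngleOn.glue {β : ℝ → ℝ} {f : ℝ → ℂ} {δ ℓ : ℝ} (hδ : 0 < δ)
    (h₁ : IsAngleOn β f (Icc 0 δ)) (h₂ : IsAngleOn β f (Ioc 0 ℓ)) : IsAngleOn β f (Icc 0 ℓ) := by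
  have hcase : ∀ x ∈ Icc 0 ℓ, x ∈ Icc 0 δ ∨ x ∈ Ioc 0 ℓ := fun x hx => by
    rcases hx.1.lt_or_eq with h | h
    · exact Or.inr ⟨h, hx.2⟩
    · exact Or.inl ⟨hx.1, by rw [← h]; exact hδ.le⟩
  refine ⟨fun x hx => ?_, fun x hx => (hcase x hx).elim (h₁.ne_zero x) (h₂.ne_zero x),
    fun x hx => (hcase x hx).elim (h₁.polar x) (h₂.polar x)⟩
  rcases hx.1.lt_or_eq with h | h
  · refine (h₂.continuousOn x ⟨h, hx.2⟩).mono_of_mem_nhdsWithin ?_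
    filter_upwards [self_mem_nhdsWithin, mem_nhdsWithin_of_mem_nhds (Ioi_mem_nhds h)] with y hy hy'
    exact ⟨hy', hy.2⟩
  · subst h
    refine (h₁.continuousOn 0 ⟨le_rfl, hδ.le⟩).mono_of_mem_nhdsWithin ?_
    filter_upwards [self_mem_nhdsWithin, mem_nhdsWithin_of_mem_nhds (Iio_mem_nhds hδ)] with y hy hy'
    exact ⟨hy.1, le_of_lt hy'⟩

namespace PlaneCurve

variable (Γ : PlaneCurve)

/-- Pairs of parameters `s < t`, except for the pair of the two end points. -/
def secantDomain : Set (ℝ × ℝ) :=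
  {p | Γ.start ≤ p.1 ∧ p.1 < p.2 ∧ p.2 ≤ Γ.finish ∧ p.2 - p.1 < Γ.finish - Γ.start}

/-- Pairs of parameters `s ≤ t` in the `i`-th piece, except for the pair of the two end points of
the whole curve. -/
def pieceDomain (i : Fin Γ.n) : Set (ℝ × ℝ) :=
  {p | Γ.knot i.castSucc ≤ p.1 ∧ p.1 ≤ p.2 ∧ p.2 ≤ Γ.knot i.succ ∧
    p.2 - p.1 < Γ.finish - Γ.start}

/-- The difference quotient of the curve between two parameters of the `i`-th piece, extended by
the velocity to the diagonal. -/
noncomputable def slopeFun (i : Fin Γ.n) (p : ℝ × ℝ) : ℂ :=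
  ∫ r in (0 : ℝ)..1, Γ.vel i (p.1 + r * (p.2 - p.1))

theorem convex_secantDomain : Convex ℝ Γ.secantDomain := by
  rintro ⟨x₁, x₂⟩ ⟨h1, h2, h3, h4⟩ ⟨y₁, y₂⟩ ⟨k1, k2, k3, k4⟩ a b ha hb hab
  obtain rfl : a = 1 - b := by linarith
  simp only [secantDomain, mem_ofPred_eq, Prod.smul_mk, Prod.mk_add_mk, smul_eq_mul] at *
  rcases hb.lt_or_eq with hb' | rfl
  · refine ⟨by nlinarith, by nlinarith, by nlinarith, by nlinarith⟩
  · refine ⟨by linarith, by linarith, by linarith, by linarith⟩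

theorem convex_pieceDomain (i : Fin Γ.n) : Convex ℝ (Γ.pieceDomain i) := by
  rintro ⟨x₁, x₂⟩ ⟨h1, h2, h3, h4⟩ ⟨y₁, y₂⟩ ⟨k1, k2, k3, k4⟩ a b ha hb hab
  obtain rfl : a = 1 - b := by linarith
  simp only [pieceDomain, mem_ofPred_eq, Prod.smul_mk, Prod.mk_add_mk, smul_eq_mul] at *
  rcases hb.lt_or_eq with hb' | rfl
  · refine ⟨by nlinarith, by nlinarith, by nlinarith, by nlinarith⟩
  · refine ⟨by linarith, by linarith, by linarith, by linarith⟩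

theorem continuous_slopeFun (i : Fin Γ.n) : Continuous (Γ.slopeFun i) := by
  refine intervalIntegral.continuous_parametric_intervalIntegral_of_continuous'
    (f := fun (p : ℝ × ℝ) (r : ℝ) => Γ.vel i (p.1 + r * (p.2 - p.1))) ?_ 0 1
  exact (Γ.vel_continuous i).comp (by fun_prop)

@[simp] theorem slopeFun_diag (i : Fin Γ.n) (s : ℝ) : Γ.slopeFun i (s, s) = Γ.vel i s := by
  simp [slopeFun]

theorem sub_eq_mul_slopeFun (i : Fin Γ.n) {p : ℝ × ℝ} (hp : p ∈ Γ.pieceDomain i) :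
    Γ.toFun p.2 - Γ.toFun p.1 = ((p.2 - p.1 : ℝ) : ℂ) * Γ.slopeFun i p := by
  obtain ⟨h1, h2, h3, -⟩ := hp
  have hsub : Icc p.1 p.2 ⊆ Icc (Γ.knot i.castSucc) (Γ.knot i.succ) := Icc_subset_Icc h1 h3
  have hd : ∀ t ∈ Icc p.1 p.2, HasDerivWithinAt Γ.toFun (Γ.vel i t) (Icc p.1 p.2) t :=
    fun t ht => (Γ.hasDeriv i t (hsub ht)).mono hsub
  have hint := intervalIntegral.integral_eq_sub_of_hasDerivAt_of_le h2
    (fun t ht => (hd t ht).continuousWithinAt)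
    (fun t ht => (hd t (Ioo_subset_Icc_self ht)).hasDerivAt (Icc_mem_nhds ht.1 ht.2))
    ((Γ.vel_continuous i).intervalIntegrable _ _)
  rw [← hint, slopeFun]
  have := intervalIntegral.smul_integral_comp_add_mul (a := 0) (b := 1) (Γ.vel i) (p.2 - p.1) p.1
  simp only [mul_zero, add_zero, mul_one, add_sub_cancel] at this
  rw [← this, Complex.real_smul]
  simp only [mul_comm]

theorem pieceDomain_subset (i : Fin Γ.n) {p : ℝ × ℝ} (hp : p ∈ Γ.pieceDomain i)
    (hlt : p.1 < p.2) : p ∈ Γ.secantDomain := by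
  obtain ⟨h1, h2, h3, h4⟩ := hp
  have h5 := Γ.piece_subset i ⟨h1, h2.trans h3⟩
  have h6 := Γ.piece_subset i ⟨h1.trans h2, h3⟩
  exact ⟨h5.1, hlt, h6.2, h4⟩

theorem sub_ne_zero_of_mem_secantDomain {p : ℝ × ℝ} (hp : p ∈ Γ.secantDomain) :
    Γ.toFun p.2 - Γ.toFun p.1 ≠ 0 := by
  obtain ⟨h1, h2, h3, h4⟩ := hp
  rw [sub_ne_zero]
  refine (Γ.ne_of_lt h1 h2 h3 ?_).symm
  rintro ⟨h5, h6⟩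
  rw [h5, h6] at h4
  exact lt_irrefl _ h4

theorem slopeFun_ne_zero (i : Fin Γ.n) {p : ℝ × ℝ} (hp : p ∈ Γ.pieceDomain i) :
    Γ.slopeFun i p ≠ 0 := by
  rcases hp.2.1.lt_or_eq with h | h
  · intro h0
    apply Γ.sub_ne_zero_of_mem_secantDomain (Γ.pieceDomain_subset i hp h)
    rw [Γ.sub_eq_mul_slopeFun i hp, h0, mul_zero]
  · obtain ⟨s, t⟩ := p
    simp only at h
    rw [← h, slopeFun_diag]
    exact Γ.vel_ne_zero i s

/-- The secants of a simple closed curve have a continuous angle, since their parameters form a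
convex set. -/
theorem exists_secant_angle :
    ∃ Θ : ℝ × ℝ → ℝ, IsAngleOn Θ (fun p => Γ.toFun p.2 - Γ.toFun p.1) Γ.secantDomain := by
  refine exists_isAngleOn Γ.convex_secantDomain ?_
    fun p hp => Γ.sub_ne_zero_of_mem_secantDomain hp
  refine ContinuousOn.sub (Γ.continuousOn.comp continuousOn_snd fun p hp => ?_)
    (Γ.continuousOn.comp continuousOn_fst fun p hp => ?_)
  · exact ⟨hp.1.trans hp.2.1.le, hp.2.2.1⟩
  · exact ⟨hp.1, hp.2.1.le.trans hp.2.2.1⟩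

/-- The angle of the secants extends continuously to the diagonal, piece by piece. -/
theorem exists_slope_angle {Θ : ℝ × ℝ → ℝ}
    (hΘ : IsAngleOn Θ (fun p => Γ.toFun p.2 - Γ.toFun p.1) Γ.secantDomain) (i : Fin Γ.n) :
    ∃ Ψ : ℝ × ℝ → ℝ, IsAngleOn Ψ (Γ.slopeFun i) (Γ.pieceDomain i) ∧
      ∀ p ∈ Γ.pieceDomain i, p.1 < p.2 → Ψ p = Θ p := by
  obtain ⟨Ψ, hΨ⟩ := exists_isAngleOn (Γ.convex_pieceDomain i)
    (Γ.continuous_slopeFun i).continuousOn fun p hp => Γ.slopeFun_ne_zero i hp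
  -- the part of the domain off the diagonal is convex, hence connected
  set U : Set (ℝ × ℝ) := Γ.pieceDomain i ∩ {p | p.1 < p.2} with hU
  have hUc : IsPreconnected U := by
    refine ((Γ.convex_pieceDomain i).inter ?_).isPreconnected
    have := convex_halfSpace_lt (𝕜 := ℝ) (f := fun p : ℝ × ℝ => p.1 - p.2)
      (IsLinearMap.mk (fun x y => by simp; ring) (fun c x => by simp; ring)) 0
    simpa [sub_neg] using this
  have hUΘ : IsAngleOn Θ (fun p => Γ.toFun p.2 - Γ.toFun p.1) U :=
    hΘ.mono fun p hp => Γ.pieceDomain_subset i hp.1 hp.2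
  have hUΨ : IsAngleOn Ψ (fun p => Γ.toFun p.2 - Γ.toFun p.1) U :=
    (hΨ.mono inter_subset_left).of_pos_mul (fun p => p.2 - p.1) (fun p hp => sub_pos.2 hp.2)
      fun p hp => Γ.sub_eq_mul_slopeFun i hp.1
  obtain ⟨p₀, hp₀⟩ : U.Nonempty := by
    have h1 := Γ.knot_lt i
    have h2 := Γ.start_lt_finish
    obtain ⟨t, ht1, ht2⟩ := exists_between (lt_min h1
      (lt_add_of_pos_right (Γ.knot i.castSucc) (sub_pos.2 h2)))
    rw [lt_min_iff] at ht2
    refine ⟨(Γ.knot i.castSucc, t), ⟨le_rfl, ht1.le, ht2.1.le, ?_⟩, ht1⟩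
    simp only
    linarith [ht2.2]
  have hang : Complex.exp (((Θ p₀ - Ψ p₀ : ℝ) : ℂ) * Complex.I) = 1 := by
    push_cast
    rw [sub_mul, Complex.exp_sub, hUΘ.exp_eq hp₀, hUΨ.exp_eq hp₀, div_self]
    exact div_ne_zero (hUΘ.ne_zero _ hp₀) (by simpa using hUΘ.ne_zero _ hp₀)
  refine ⟨fun p => Ψ p + (Θ p₀ - Ψ p₀), (hΨ.add_const _).congr fun p hp => by
    rw [hang, mul_one], fun p hp hlt => ?_⟩
  have := hUΘ.sub_eq_sub hUΨ hUc hp₀ (y := p) ⟨hp, hlt⟩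
  linarith

variable {Γ} {Θ : ℝ × ℝ → ℝ}

/-- The angle of the secants from `γ s` to later points, starting with the tangent at `s`. -/
theorem isAngleOn_right (hΘ : IsAngleOn Θ (fun p => Γ.toFun p.2 - Γ.toFun p.1) Γ.secantDomain)
    {i : Fin Γ.n} {Ψ : ℝ × ℝ → ℝ} (hΨ : IsAngleOn Ψ (Γ.slopeFun i) (Γ.pieceDomain i))
    (hΨΘ : ∀ p ∈ Γ.pieceDomain i, p.1 < p.2 → Ψ p = Θ p) {s t : ℝ}
    (hs : s ∈ Ico (Γ.knot i.castSucc) (Γ.knot i.succ)) (ht : t ≤ Γ.finish)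
    (hst : t - s < Γ.finish - Γ.start) :
    IsAngleOn (fun τ => if τ = 0 then Ψ (s, s) else Θ (s, s + τ))
      (fun τ : ℝ => if τ = 0 then Γ.vel i s else (Γ.toFun (s + τ) - Γ.toFun s) / τ)
      (Icc 0 (t - s)) := by
  have hL := Γ.start_lt_finish
  obtain ⟨δ, hδ0, hδ⟩ := exists_between (lt_min (sub_pos.2 hs.2) (sub_pos.2 hL))
  rw [lt_min_iff] at hδ
  have hdom : ∀ τ ∈ Icc 0 δ, (s, s + τ) ∈ Γ.pieceDomain i := fun τ hτ =>
    ⟨hs.1, by simpa using hτ.1, by simp only; linarith [hτ.2], by simp only; linarith [hτ.2]⟩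
  have hdom' : ∀ τ ∈ Ioc 0 (t - s), (s, s + τ) ∈ Γ.secantDomain := fun τ hτ =>
    ⟨(Γ.piece_subset i ⟨hs.1, hs.2.le⟩).1, by simpa using hτ.1,
      by simp only; linarith [hτ.2], by simp only; linarith [hτ.2]⟩
  refine IsAngleOn.glue hδ0 ?_ ?_
  · have h1 := hΨ.comp (φ := fun τ : ℝ => (s, s + τ)) (U := Icc 0 δ) (by fun_prop) hdom
    refine (h1.congr_angle fun τ hτ => ?_).congr fun τ hτ => ?_
    · split_ifs with h
      · simp [h]
      · exact (hΨΘ _ (hdom τ hτ) (by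
          simpa using lt_of_le_of_ne hτ.1 (Ne.symm h))).symm
    · split_ifs with h
      · simp [h]
      · have h2 := Γ.sub_eq_mul_slopeFun i (hdom τ hτ)
        simp only [add_sub_cancel_left] at h2
        rw [h2, mul_div_cancel_left₀ _ (by exact_mod_cast h)]
  · have h1 := hΘ.comp (φ := fun τ : ℝ => (s, s + τ)) (U := Ioc 0 (t - s)) (by fun_prop) hdom'
    refine (h1.congr_angle fun τ hτ => ?_).of_pos_mul (fun τ => τ⁻¹)
      (fun τ hτ => inv_pos.2 hτ.1) fun τ hτ => ?_
    · simp [hτ.1.ne']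
    · simp [hτ.1.ne']
      ring

/-- The angle of the reversed secants from `γ s` to earlier points, starting with the reversed
tangent at `s`. -/
theorem isAngleOn_left (hΘ : IsAngleOn Θ (fun p => Γ.toFun p.2 - Γ.toFun p.1) Γ.secantDomain)
    {i : Fin Γ.n} {Ψ : ℝ × ℝ → ℝ} (hΨ : IsAngleOn Ψ (Γ.slopeFun i) (Γ.pieceDomain i))
    (hΨΘ : ∀ p ∈ Γ.pieceDomain i, p.1 < p.2 → Ψ p = Θ p) {s t : ℝ}
    (hs : s ∈ Ioc (Γ.knot i.castSucc) (Γ.knot i.succ)) (ht : Γ.start ≤ t)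
    (hst : s - t < Γ.finish - Γ.start) :
    IsAngleOn (fun τ => (if τ = 0 then Ψ (s, s) else Θ (s - τ, s)) + π)
      (fun τ : ℝ => if τ = 0 then -Γ.vel i s else (Γ.toFun (s - τ) - Γ.toFun s) / τ)
      (Icc 0 (s - t)) := by
  have hL := Γ.start_lt_finish
  obtain ⟨δ, hδ0, hδ⟩ := exists_between (lt_min (sub_pos.2 hs.1) (sub_pos.2 hL))
  rw [lt_min_iff] at hδ
  have hdom : ∀ τ ∈ Icc 0 δ, (s - τ, s) ∈ Γ.pieceDomain i := fun τ hτ =>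
    ⟨by simp only; linarith [hτ.2], by simpa using hτ.1, hs.2, by simp only; linarith [hτ.2]⟩
  have hdom' : ∀ τ ∈ Ioc 0 (s - t), (s - τ, s) ∈ Γ.secantDomain := fun τ hτ =>
    ⟨by simp only; linarith [hτ.2], by simpa using hτ.1,
      (Γ.piece_subset i ⟨hs.1.le, hs.2⟩).2, by simp only; linarith [hτ.2]⟩
  refine IsAngleOn.glue hδ0 ?_ ?_
  · have h1 := (hΨ.comp (φ := fun τ : ℝ => (s - τ, s)) (U := Icc 0 δ) (by fun_prop) hdom).neg
    refine (h1.congr_angle fun τ hτ => ?_).congr fun τ hτ => ?_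
    · split_ifs with h
      · simp [h]
      · rw [hΨΘ _ (hdom τ hτ) (by simpa using lt_of_le_of_ne hτ.1 (Ne.symm h))]
    · split_ifs with h
      · simp [h]
      · have h2 := Γ.sub_eq_mul_slopeFun i (hdom τ hτ)
        simp only [sub_sub_cancel] at h2
        rw [← neg_sub, h2, neg_div, mul_div_cancel_left₀ _ (by exact_mod_cast h)]
  · have h1 := (hΘ.comp (φ := fun τ : ℝ => (s - τ, s)) (U := Ioc 0 (s - t)) (by fun_prop)
      hdom').neg
    refine (h1.congr_angle fun τ hτ => ?_).of_pos_mul (fun τ => τ⁻¹)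
      (fun τ hτ => inv_pos.2 hτ.1) fun τ hτ => ?_
    · simp [hτ.1.ne']
    · simp [hτ.1.ne']
      ring

/-- The curve after `s`, seen from a point close to `γ s` in a direction different from that of the
departing tangent. -/
theorem eventually_angle_right
    (hΘ : IsAngleOn Θ (fun p => Γ.toFun p.2 - Γ.toFun p.1) Γ.secantDomain)
    {i : Fin Γ.n} {Ψ : ℝ × ℝ → ℝ} (hΨ : IsAngleOn Ψ (Γ.slopeFun i) (Γ.pieceDomain i))
    (hΨΘ : ∀ p ∈ Γ.pieceDomain i, p.1 < p.2 → Ψ p = Θ p) {s t : ℝ}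
    (hs : s ∈ Ico (Γ.knot i.castSucc) (Γ.knot i.succ)) (hlt : s < t) (ht : t ≤ Γ.finish)
    (hst : t - s < Γ.finish - Γ.start) {E : ℝ → ℂ} {E₀ : ℂ} (hE : Tendsto E (𝓝[>] 0) (𝓝 E₀))
    (hE₀ : -E₀ / Γ.vel i s ∈ Complex.slitPlane) :
    ∀ᶠ ε in 𝓝[>] (0 : ℝ), ∃ β : ℝ → ℝ,
      IsAngleOn β (fun u => Γ.toFun u - (Γ.toFun s + ε * E ε)) (Icc s t) ∧
      β t - β s = Θ (s, t) + Complex.arg (1 - ε * E ε / (Γ.toFun t - Γ.toFun s))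
        - Ψ (s, s) - Complex.arg (-E ε / Γ.vel i s) := by
  have hang := isAngleOn_right hΘ hΨ hΨΘ hs ht hst
  have hts : 0 < t - s := sub_pos.2 hlt
  have hts' : ((t - s : ℝ) : ℂ) ≠ 0 := by exact_mod_cast hts.ne'
  have hc : ContinuousOn (fun τ : ℝ => if τ = 0 then Γ.vel i s
      else (Γ.toFun (s + τ) - Γ.toFun s) / τ) (Icc 0 (t - s)) := by
    have hs0 := Γ.piece_subset i ⟨hs.1, hs.2.le⟩
    have h1 := continuousOn_slope_of_hasDerivWithinAt (f := fun τ => Γ.toFun (s + τ))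
      (d := Γ.vel i s) (ℓ := t - s) (sub_pos.2 hs.2) ?_ ?_
    · simpa using h1
    · refine Γ.continuousOn.comp (by fun_prop) fun τ hτ => ?_
      exact ⟨by linarith [hτ.1, hs0.1], by linarith [hτ.2]⟩
    · have h2 : HasDerivWithinAt Γ.toFun (Γ.vel i s) (Icc (Γ.knot i.castSucc) (Γ.knot i.succ))
          (s + 0) := by simpa using Γ.hasDeriv i s ⟨hs.1, hs.2.le⟩
      have h3 : HasDerivWithinAt (fun τ : ℝ => s + τ) 1 (Icc 0 (Γ.knot i.succ - s)) 0 := by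
        simpa using (hasDerivWithinAt_id (0 : ℝ) _).const_add s
      have h4 := HasDerivWithinAt.scomp (0 : ℝ) (h := fun τ : ℝ => s + τ) h2 h3
        (fun τ hτ => ⟨by linarith [hτ.1, hs.1], by linarith [hτ.2]⟩)
      simpa [Function.comp_def] using h4
  filter_upwards [eventually_exists_angle_arc hts hc hang hE (by simpa using hE₀)] with ε hε
  obtain ⟨β, hβ, h0, h1⟩ := hε
  refine ⟨fun u => β (u - s), (hβ.comp (φ := fun u => u - s) (by fun_prop) fun u hu =>
    ⟨by simpa using hu.1, by simpa using hu.2⟩).congr fun u hu => ?_, ?_⟩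
  · by_cases h : u - s = 0
    · obtain rfl : u = s := by linarith
      simp
    · have : ((u - s : ℝ) : ℂ) ≠ 0 := by exact_mod_cast h
      simp only [h, if_false, add_sub_cancel]
      rw [mul_div_cancel₀ _ this]
      ring
  · simp only [sub_self, h0, h1, if_true, hts.ne', if_false, add_sub_cancel]
    rw [mul_div_cancel₀ _ hts']
    ring

/-- The curve before `s`, seen from a point close to `γ s` in a direction different from that of
the reversed arriving tangent. -/
theorem eventually_angle_left
    (hΘ : IsAngleOn Θ (fun p => Γ.toFun p.2 - Γ.toFun p.1) Γ.secantDomain)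
    {i : Fin Γ.n} {Ψ : ℝ × ℝ → ℝ} (hΨ : IsAngleOn Ψ (Γ.slopeFun i) (Γ.pieceDomain i))
    (hΨΘ : ∀ p ∈ Γ.pieceDomain i, p.1 < p.2 → Ψ p = Θ p) {s t : ℝ}
    (hs : s ∈ Ioc (Γ.knot i.castSucc) (Γ.knot i.succ)) (hlt : t < s) (ht : Γ.start ≤ t)
    (hst : s - t < Γ.finish - Γ.start) {E : ℝ → ℂ} {E₀ : ℂ} (hE : Tendsto E (𝓝[>] 0) (𝓝 E₀))
    (hE₀ : E₀ / Γ.vel i s ∈ Complex.slitPlane) :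
    ∀ᶠ ε in 𝓝[>] (0 : ℝ), ∃ β : ℝ → ℝ,
      IsAngleOn β (fun u => Γ.toFun u - (Γ.toFun s + ε * E ε)) (Icc t s) ∧
      β s - β t = Ψ (s, s) + Complex.arg (E ε / Γ.vel i s)
        - Θ (t, s) - Complex.arg (1 - ε * E ε / (Γ.toFun t - Γ.toFun s)) := by
  have hang := isAngleOn_left hΘ hΨ hΨΘ hs ht hst
  have hts : 0 < s - t := sub_pos.2 hlt
  have hts' : ((s - t : ℝ) : ℂ) ≠ 0 := by exact_mod_cast hts.ne'
  have hc : ContinuousOn (fun τ : ℝ => if τ = 0 then -Γ.vel i s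
      else (Γ.toFun (s - τ) - Γ.toFun s) / τ) (Icc 0 (s - t)) := by
    have hs0 := Γ.piece_subset i ⟨hs.1.le, hs.2⟩
    have h1 := continuousOn_slope_of_hasDerivWithinAt (f := fun τ => Γ.toFun (s - τ))
      (d := -Γ.vel i s) (ℓ := s - t) (sub_pos.2 hs.1) ?_ ?_
    · simpa using h1
    · refine Γ.continuousOn.comp (by fun_prop) fun τ hτ => ?_
      exact ⟨by linarith [hτ.2], by linarith [hτ.1, hs0.2]⟩
    · have h2 : HasDerivWithinAt Γ.toFun (Γ.vel i s) (Icc (Γ.knot i.castSucc) (Γ.knot i.succ))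
          (s - 0) := by simpa using Γ.hasDeriv i s ⟨hs.1.le, hs.2⟩
      have h3 : HasDerivWithinAt (fun τ : ℝ => s - τ) (-1) (Icc 0 (s - Γ.knot i.castSucc)) 0 := by
        simpa using (hasDerivWithinAt_id (0 : ℝ) _).const_sub s
      have h4 := HasDerivWithinAt.scomp (0 : ℝ) (h := fun τ : ℝ => s - τ) h2 h3
        (fun τ hτ => ⟨by linarith [hτ.2], by linarith [hτ.1, hs.2]⟩)
      simpa [Function.comp_def] using h4
  filter_upwards [eventually_exists_angle_arc hts hc hang hE (by simpa using hE₀)] with ε hε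
  obtain ⟨β, hβ, h0, h1⟩ := hε
  refine ⟨fun u => β (s - u), (hβ.comp (φ := fun u => s - u) (by fun_prop) fun u hu =>
    ⟨by linarith [hu.2], by linarith [hu.1]⟩).congr fun u hu => ?_, ?_⟩
  · by_cases h : s - u = 0
    · obtain rfl : u = s := by linarith
      simp
    · have : ((s - u : ℝ) : ℂ) ≠ 0 := by exact_mod_cast h
      simp only [h, if_false, sub_sub_cancel]
      rw [mul_div_cancel₀ _ this]
      ring
  · simp only [sub_self, h0, h1, if_true, hts.ne', if_false, sub_sub_cancel]
    rw [mul_div_cancel₀ _ hts', neg_div_neg_eq]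
    ring

variable (Γ)

/-- The Umlaufsatz in terms of winding numbers. There are continuous angles `ψ i` of the velocity
along the pieces and jumps `J i` at the vertices which sum up to `2κ`, and all of them determine
the winding numbers about points close to the curve. The number `κ` is the change of the angle of
the secant `γ t - γ s` when `(s, t)` is replaced by `(t, s + L)`, where `L` is the period. -/
theorem exists_rotation_data : ∃ (κ : ℝ) (ψ : Fin Γ.n → ℝ → ℝ) (J : Fin Γ.n → ℝ),
    (∀ i, IsAngleOn (ψ i) (Γ.vel i) (Γ.piece i)) ∧
    (∑ i, (ψ i (Γ.knot i.succ) - ψ i (Γ.knot i.castSucc)) + ∑ i, J i = 2 * κ) ∧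
    (∀ i, ∀ s ∈ Ioo (Γ.knot i.castSucc) (Γ.knot i.succ), ∀ (E : ℝ → ℂ) (E₀ : ℂ),
      Tendsto E (𝓝[>] 0) (𝓝 E₀) → E₀ / Γ.vel i s ∈ Complex.slitPlane →
      -E₀ / Γ.vel i s ∈ Complex.slitPlane →
      ∀ᶠ ε in 𝓝[>] (0 : ℝ), Γ.toFun s + ε * E ε ∉ Γ.trace ∧
        2 * π * Γ.wind (Γ.toFun s + ε * E ε) =
          κ + Complex.arg (E ε / Γ.vel i s) - Complex.arg (-E ε / Γ.vel i s)) ∧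
    (∀ i (E : ℝ → ℂ) (E₀ : ℂ), Tendsto E (𝓝[>] 0) (𝓝 E₀) →
      E₀ / Γ.vel i (Γ.knot i.succ) ∈ Complex.slitPlane →
      -E₀ / Γ.vel (finRotate Γ.n i) (Γ.knot (finRotate Γ.n i).castSucc) ∈ Complex.slitPlane →
      ∀ᶠ ε in 𝓝[>] (0 : ℝ), Γ.toFun (Γ.knot i.succ) + ε * E ε ∉ Γ.trace ∧
        2 * π * Γ.wind (Γ.toFun (Γ.knot i.succ) + ε * E ε) =
          κ - J i + Complex.arg (E ε / Γ.vel i (Γ.knot i.succ)) -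
          Complex.arg (-E ε / Γ.vel (finRotate Γ.n i) (Γ.knot (finRotate Γ.n i).castSucc))) := by
  obtain ⟨Θ, hΘ⟩ := Γ.exists_secant_angle
  choose Ψ hΨ hΨΘ using Γ.exists_slope_angle hΘ
  have hL := Γ.start_lt_finish
  have hclosed : Γ.toFun Γ.start = Γ.toFun Γ.finish := Γ.closed
  -- the angle from `γ t` to the base point, compared to the angle from the base point to `γ t`
  have hκ : ∃ κ : ℝ, ∀ t ∈ Ioo Γ.start Γ.finish, Θ (t, Γ.finish) - Θ (Γ.start, t) = κ := by
    refine ⟨Θ ((Γ.start + Γ.finish) / 2, Γ.finish) - Θ (Γ.start, (Γ.start + Γ.finish) / 2),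
      fun t ht => ?_⟩
    have hm1 : ∀ t ∈ Ioo Γ.start Γ.finish, (t, Γ.finish) ∈ Γ.secantDomain := fun t ht =>
      ⟨ht.1.le, ht.2, le_rfl, by simp only; linarith [ht.1]⟩
    have hm2 : ∀ t ∈ Ioo Γ.start Γ.finish, (Γ.start, t) ∈ Γ.secantDomain := fun t ht =>
      ⟨le_rfl, ht.1, ht.2.le, by simp only; linarith [ht.2]⟩
    have k1 := hΘ.comp (φ := fun t => (t, Γ.finish)) (U := Ioo Γ.start Γ.finish) (by fun_prop) hm1
    have k2 := (hΘ.comp (φ := fun t => (Γ.start, t)) (U := Ioo Γ.start Γ.finish)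
      (by fun_prop) hm2).neg.congr (g := fun t => Γ.toFun Γ.finish - Γ.toFun t)
      (fun t _ => by simp only [hclosed]; ring)
    have := k1.sub_eq_sub k2 isPreconnected_Ioo (x := (Γ.start + Γ.finish) / 2) (y := t)
      ⟨by linarith, by linarith⟩ ht
    linarith
  obtain ⟨κ, hκ⟩ := hκ
  -- interior points of the parameter interval
  have hint : ∀ s ∈ Ioo Γ.start Γ.finish, ∀ i j : Fin Γ.n,
      s ∈ Ioc (Γ.knot i.castSucc) (Γ.knot i.succ) →
      s ∈ Ico (Γ.knot j.castSucc) (Γ.knot j.succ) → ∀ (E : ℝ → ℂ) (E₀ : ℂ),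
      Tendsto E (𝓝[>] 0) (𝓝 E₀) → E₀ / Γ.vel i s ∈ Complex.slitPlane →
      -E₀ / Γ.vel j s ∈ Complex.slitPlane →
      ∀ᶠ ε in 𝓝[>] (0 : ℝ), Γ.toFun s + ε * E ε ∉ Γ.trace ∧
        2 * π * Γ.wind (Γ.toFun s + ε * E ε) = κ - (Ψ j (s, s) - Ψ i (s, s)) +
          Complex.arg (E ε / Γ.vel i s) - Complex.arg (-E ε / Γ.vel j s) := by
    intro s hs i j hi hj E E₀ hE h1 h2
    filter_upwards [eventually_angle_left hΘ (hΨ i) (hΨΘ i) hi hs.1 le_rfl (by linarith [hs.2])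
      hE h1, eventually_angle_right hΘ (hΨ j) (hΨΘ j) hj hs.2 le_rfl (by linarith [hs.1]) hE h2]
      with ε ⟨β₁, hβ₁, h3⟩ ⟨β₂, hβ₂, h4⟩
    obtain ⟨h5, h6⟩ := Γ.two_pi_mul_wind_split ⟨hs.1.le, hs.2.le⟩ hβ₁ hβ₂
    refine ⟨h5, ?_⟩
    rw [h6, h3, h4, ← hκ s hs, hclosed]
    ring
  refine ⟨κ, fun i t => Ψ i (t, t), fun i =>
    (Ψ (finRotate Γ.n i) (Γ.knot (finRotate Γ.n i).castSucc, Γ.knot (finRotate Γ.n i).castSucc) -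
      Ψ i (Γ.knot i.succ, Γ.knot i.succ)) + if i.succ = Fin.last Γ.n then 2 * κ else 0,
    fun i => ?_, ?_, fun i s hs E E₀ hE h1 h2 => ?_, fun i E E₀ hE h1 h2 => ?_⟩
  · refine ((hΨ i).comp (φ := fun t => (t, t)) (U := Γ.piece i) (by fun_prop) fun t ht =>
      ⟨ht.1, le_rfl, ht.2, by simp only; linarith⟩).congr fun t _ => by simp
  · rw [Finset.sum_add_distrib, Finset.sum_sub_distrib, Finset.sum_sub_distrib,
      Equiv.sum_comp (finRotate Γ.n)
        (fun i => Ψ i (Γ.knot i.castSucc, Γ.knot i.castSucc))]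
    have : ∑ i : Fin Γ.n, (if i.succ = Fin.last Γ.n then 2 * κ else 0) = 2 * κ := by
      obtain ⟨m, hm⟩ := Nat.exists_eq_succ_of_ne_zero Γ.n_pos.ne'
      have : ∀ i : Fin Γ.n, i.succ = Fin.last Γ.n ↔ i = ⟨m, by omega⟩ := by
        intro i
        rw [Fin.ext_iff, Fin.ext_iff]
        simp
        omega
      simp [this]
    rw [this]
    ring
  · have hs' : s ∈ Ioo Γ.start Γ.finish :=
      ⟨lt_of_le_of_lt (Γ.piece_subset i (left_mem_Icc.2 (Γ.knot_lt i).le)).1 hs.1,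
        lt_of_lt_of_le hs.2 (Γ.piece_subset i (right_mem_Icc.2 (Γ.knot_lt i).le)).2⟩
    have := hint s hs' i i ⟨hs.1, hs.2.le⟩ ⟨hs.1.le, hs.2⟩ E E₀ hE h1 h2
    simpa using this
  · set j := finRotate Γ.n i with hj
    have hjmem : ∀ u, Γ.knot j.castSucc = u → u ∈ Ico (Γ.knot j.castSucc) (Γ.knot j.succ) :=
      fun u hu => ⟨hu.le, hu ▸ Γ.knot_lt j⟩
    have himem : ∀ u, Γ.knot i.succ = u → u ∈ Ioc (Γ.knot i.castSucc) (Γ.knot i.succ) :=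
      fun u hu => ⟨hu ▸ Γ.knot_lt i, hu.ge⟩
    have hstart : Γ.start ≤ Γ.knot i.castSucc :=
      (Γ.piece_subset i (left_mem_Icc.2 (Γ.knot_lt i).le)).1
    have hfinish : Γ.knot j.succ ≤ Γ.finish :=
      (Γ.piece_subset j (right_mem_Icc.2 (Γ.knot_lt j).le)).2
    rcases castSucc_finRotate i with h | ⟨hlast, h⟩
    · rw [← hj] at h
      have hne : i.succ ≠ Fin.last Γ.n := by
        rw [← h]
        exact (Fin.castSucc_lt_last j).ne
      have hj' := hjmem (Γ.knot i.succ) (by rw [h])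
      rw [h] at h2
      have := hint (Γ.knot i.succ) ⟨hstart.trans_lt (himem _ rfl).1, hj'.2.trans_le hfinish⟩
        i j (himem _ rfl) hj' E E₀ hE h1 h2
      simpa only [← hj, h, hne, if_false, add_zero] using this
    · rw [← hj] at h
      have hks : Γ.knot j.castSucc = Γ.start := by rw [h]; rfl
      have hkf : Γ.knot i.succ = Γ.finish := by rw [hlast]; rfl
      have hj' := hjmem _ hks
      rw [hks] at h2
      have hi' := himem _ hkf
      rw [hkf] at h1
      -- the two arcs are compared at an intermediate parameter
      obtain ⟨m, hm⟩ := exists_between hL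
      simp only [← hj, hlast, if_true, hks, hlast ▸ hkf]
      filter_upwards [eventually_angle_left hΘ (hΨ i) (hΨΘ i) hi' hm.2 hm.1.le
        (by linarith [hm.1]) hE h1, eventually_angle_right hΘ (hΨ j) (hΨΘ j) hj' hm.1 hm.2.le
        (by linarith [hm.2]) hE h2] with ε ⟨β₂, hβ₂, h3⟩ ⟨β₁, hβ₁, h4⟩
      rw [hclosed] at hβ₁ h4
      obtain ⟨h5, h6⟩ := Γ.two_pi_mul_wind_split ⟨hm.1.le, hm.2.le⟩ hβ₁ hβ₂
      refine ⟨h5, ?_⟩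
      rw [h6, h3, h4]
      linarith [hκ m hm]

end PlaneCurve

/-! ### The area form in stereographic coordinates -/

/-- The density of the area of the unit sphere in a stereographic coordinate. -/
noncomputable def sphereDensity (z : ℂ) : ℝ := 4 / (1 + ‖z‖ ^ 2) ^ 2

theorem sphereDensity_nonneg (z : ℂ) : 0 ≤ sphereDensity z := by
  unfold sphereDensity
  positivity

theorem sphereDensity_le (z : ℂ) : sphereDensity z ≤ 4 := by
  unfold sphereDensity
  rw [div_le_iff₀ (by positivity)]
  nlinarith [sq_nonneg ‖z‖, sq_nonneg (‖z‖ ^ 2)]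

theorem continuous_sphereDensity : Continuous sphereDensity := by
  unfold sphereDensity
  refine continuous_const.div (by fun_prop) fun z => by positivity

theorem integrable_sphereDensity : Integrable sphereDensity := by
  have h := (integrable_rpow_neg_one_add_norm_sq (E := ℂ) (μ := volume) (r := 4)
    (by rw [Complex.finrank_real_complex]; norm_num)).const_mul 4
  refine h.congr (Eventually.of_forall fun z => ?_)
  simp only [sphereDensity]
  rw [show (-4 / 2 : ℝ) = -(2 : ℕ) by norm_num, Real.rpow_neg (by positivity), Real.rpow_natCast]
  rfl

/-- The Cauchy kernel weighted with the area of the sphere. -/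
noncomputable def sphereKernel (ζ z : ℂ) : ℂ := sphereDensity z / (ζ - z)

/-- The weighted Cauchy kernels are bounded in `L¹`: near `ζ` compare with `4 / |ζ - z|` on the unit
disc about `ζ`, elsewhere with the density itself. -/
theorem exists_integral_norm_sphereKernel_le :
    ∃ M : ℝ, ∀ ζ, Integrable (sphereKernel ζ) ∧ ∫ z, ‖sphereKernel ζ z‖ ≤ M := by
  set B : ℂ → ℝ := (Metric.ball (0 : ℂ) 1).indicator (fun w => 4 * ‖w‖⁻¹) with hB
  have hBi : Integrable B := by
    rw [hB, integrable_indicator_iff measurableSet_ball]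
    refine (integrableOn_fun_norm_addHaar (volume : Measure ℂ)
      (f := fun y : ℝ => 4 * y⁻¹) (r := 1)).2 ?_
    rw [Complex.finrank_real_complex]
    have : IntegrableOn (fun _ : ℝ => (4 : ℝ)) (Ioo 0 1) := by simp
    refine this.congr_fun (fun y hy => ?_) measurableSet_Ioo
    have := hy.1.ne'
    simp
    field_simp
  have hmeas : ∀ ζ, AEStronglyMeasurable (sphereKernel ζ) := fun ζ => by
    refine Measurable.aestronglyMeasurable ?_
    unfold sphereKernel
    have := continuous_sphereDensity.measurable
    fun_prop
  have hle : ∀ ζ z, ‖sphereKernel ζ z‖ ≤ B (ζ - z) + sphereDensity z := by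
    intro ζ z
    rw [sphereKernel, norm_div, Complex.norm_real, Real.norm_of_nonneg (sphereDensity_nonneg z)]
    by_cases h : ‖ζ - z‖ < 1
    · rw [hB, indicator_of_mem (by simpa using h), div_eq_mul_inv]
      have := sphereDensity_nonneg z
      have := mul_le_mul_of_nonneg_right (sphereDensity_le z) (inv_nonneg.2 (norm_nonneg (ζ - z)))
      linarith
    · rw [hB, indicator_of_notMem (by simpa using h), zero_add]
      exact div_le_self (sphereDensity_nonneg z) (not_lt.1 h)
  have hBi' : ∀ ζ, Integrable fun z => B (ζ - z) + sphereDensity z := fun ζ =>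
    (hBi.comp_sub_left ζ).add integrable_sphereDensity
  refine ⟨(∫ w, B w) + ∫ w, sphereDensity w, fun ζ => ⟨(hBi' ζ).mono' (hmeas ζ)
    (Eventually.of_forall (hle ζ)), ?_⟩⟩
  refine (integral_mono ((hBi' ζ).mono' (hmeas ζ) (Eventually.of_forall (hle ζ))).norm (hBi' ζ)
    (hle ζ)).trans ?_
  rw [integral_add (hBi.comp_sub_left ζ) integrable_sphereDensity, integral_sub_left_eq_self B]

theorem circleAverage_inv_sub_of_lt {ζ : ℂ} {r : ℝ} (hr : 0 < r) (h : r < ‖ζ‖) :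
    circleAverage (fun z => (ζ - z)⁻¹) 0 r = ζ⁻¹ := by
  have : DiffContOnCl ℂ (fun z => (ζ - z)⁻¹) (Metric.ball 0 |r|) := by
    rw [abs_of_pos hr]
    refine DifferentiableOn.diffContOnCl fun z hz => ?_
    rw [closure_ball _ hr.ne'] at hz
    have hz' : ‖z‖ ≤ r := by simpa using hz
    have : ζ - z ≠ 0 := fun h0 => by
      rw [sub_eq_zero.1 h0] at h
      linarith
    exact (((differentiableAt_const _).sub differentiableAt_id).inv this).differentiableWithinAt
  rw [this.circleAverage]
  simp

theorem circleAverage_inv_sub_of_gt {ζ : ℂ} {r : ℝ} (h : ‖ζ‖ < r) :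
    circleAverage (fun z => (ζ - z)⁻¹) 0 r = 0 := by
  have hr : 0 < r := (norm_nonneg _).trans_lt h
  rw [circleAverage_eq_circleIntegral hr.ne']
  have hz0 : ∀ z ∈ Metric.sphere (0 : ℂ) r, z ≠ 0 := fun z hz h0 => by
    rw [h0] at hz
    simp at hz
    exact hr.ne hz
  have hzζ : ∀ z ∈ Metric.sphere (0 : ℂ) r, z - ζ ≠ 0 := fun z hz h0 => by
    rw [sub_eq_zero.1 h0] at hz
    simp at hz
    exact h.ne hz
  by_cases hζ : ζ = 0
  · subst hζ
    have : (∮ z in C(0, r), (z - 0)⁻¹ • (0 - z)⁻¹) =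
        ∮ z in C(0, r), (-1) * ((z - 0) ^ (-2 : ℤ)) := by
      refine circleIntegral.integral_congr hr.le fun z hz => ?_
      have := hz0 z hz
      simp only [sub_zero, zero_sub, smul_eq_mul]
      rw [zpow_neg, zpow_ofNat]
      field_simp
    rw [this, circleIntegral.integral_const_mul,
      circleIntegral.integral_sub_zpow_of_ne (by norm_num)]
    simp
  · have : (∮ z in C(0, r), (z - 0)⁻¹ • (ζ - z)⁻¹) =
        ∮ z in C(0, r), ζ⁻¹ * ((z - 0)⁻¹ - (z - ζ)⁻¹) := by
      refine circleIntegral.integral_congr hr.le fun z hz => ?_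
      have h1 := hz0 z hz
      have h2 := hzζ z hz
      have h3 : ζ - z ≠ 0 := fun h0 => h2 (by rw [← neg_sub, h0, neg_zero])
      simp only [sub_zero, smul_eq_mul]
      field_simp
      ring
    rw [this, circleIntegral.integral_const_mul, circleIntegral.integral_sub,
      circleIntegral.integral_sub_inv_of_mem_ball (by simpa using hr),
      circleIntegral.integral_sub_inv_of_mem_ball (by simpa using h)]
    · simp
    · exact ContinuousOn.circleIntegrable hr.le ((continuousOn_id.sub continuousOn_const).inv₀
        fun z hz => by simpa using hz0 z hz)
    · exact ContinuousOn.circleIntegrable hr.le ((continuousOn_id.sub continuousOn_const).inv₀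
        fun z hz => hzζ z hz)

/-- The integral of the weighted Cauchy kernel. By the mean value property, only the circles inside
`|z| < |ζ|` contribute, each with its mass times `ζ⁻¹`. -/
theorem integral_sphereKernel (ζ : ℂ) :
    ∫ z, sphereKernel ζ z = 4 * π * (starRingEnd ℂ) ζ / (1 + ‖ζ‖ ^ 2) := by
  obtain ⟨M, hM⟩ := exists_integral_norm_sphereKernel_le
  have hint := (hM ζ).1
  have hmeas : Measurable (sphereKernel ζ) := by
    unfold sphereKernel
    have := continuous_sphereDensity.measurable
    fun_prop
  have hpm : Measurable Complex.polarCoord.symm := by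
    have : (Complex.polarCoord.symm : ℝ × ℝ → ℂ) =
        fun p => (p.1 : ℂ) * (Real.cos p.2 + Real.sin p.2 * Complex.I) := by
      ext p
      exact Complex.polarCoord_symm_apply p
    rw [this]
    fun_prop
  have htarget : polarCoord.target = Ioi (0 : ℝ) ×ˢ Ioo (-π) π := rfl
  have hpi : IntegrableOn (fun p : ℝ × ℝ => p.1 • sphereKernel ζ (Complex.polarCoord.symm p))
      (Ioi (0 : ℝ) ×ˢ Ioo (-π) π) (volume.prod volume) := by
    refine ⟨(measurable_fst.smul (hmeas.comp hpm)).aestronglyMeasurable, ?_⟩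
    have h1 := Complex.lintegral_comp_polarCoord_symm (fun z => ‖sphereKernel ζ z‖ₑ)
    have h2 := hint.2
    rw [HasFiniteIntegral, ← h1, htarget] at h2
    rw [HasFiniteIntegral]
    refine lt_of_le_of_lt (le_of_eq ?_) h2
    refine setLIntegral_congr_fun (measurableSet_Ioi.prod measurableSet_Ioo) fun p hp => ?_
    have hp1 : 0 < p.1 := hp.1
    simp only [enorm_smul, smul_eq_mul]
    rw [← Real.enorm_of_nonneg hp1.le]
  rw [← Complex.integral_comp_polarCoord_symm, htarget, Measure.volume_eq_prod,
    setIntegral_prod _ hpi]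
  -- the angular integral is a circle average of the Cauchy kernel
  have hinner : ∀ r ∈ Ioi (0 : ℝ), r ≠ ‖ζ‖ →
      ∫ θ in Ioo (-π) π, r • sphereKernel ζ (Complex.polarCoord.symm (r, θ)) =
        (Iio ‖ζ‖).indicator (fun r : ℝ => ((8 * π * r / (1 + r ^ 2) ^ 2 : ℝ) : ℂ) * ζ⁻¹) r := by
    intro r hr hne
    have hr : 0 < r := hr
    have h1 : ∀ θ, r • sphereKernel ζ (Complex.polarCoord.symm (r, θ)) =
        ((4 * r / (1 + r ^ 2) ^ 2 : ℝ) : ℂ) * (ζ - circleMap 0 r θ)⁻¹ := by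
      intro θ
      have h2 : Complex.polarCoord.symm (r, θ) = circleMap 0 r θ := by
        rw [Complex.polarCoord_symm_apply, circleMap_zero, Complex.exp_mul_I]
        push_cast
        rfl
      rw [h2, sphereKernel, sphereDensity, norm_circleMap_zero, Complex.real_smul, sq_abs]
      push_cast
      ring
    have h3 : ∫ θ in Ioo (-π) π, (ζ - circleMap 0 r θ)⁻¹ =
        2 * π * circleAverage (fun z => (ζ - z)⁻¹) 0 r := by
      rw [circleAverage_def, ← integral_Ioc_eq_integral_Ioo, ← intervalIntegral.integral_of_le
        (by linarith [Real.pi_pos])]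
      have hper : Function.Periodic (fun θ => (ζ - circleMap 0 r θ)⁻¹) (2 * π) := fun θ => by
        simp only [periodic_circleMap 0 r θ]
      have h4 := hper.intervalIntegral_add_eq (-π) 0
      rw [show -π + 2 * π = π by ring, zero_add] at h4
      rw [h4, Complex.real_smul]
      have : (π : ℂ) ≠ 0 := by exact_mod_cast Real.pi_ne_zero
      push_cast
      field_simp
    simp_rw [h1]
    rw [integral_const_mul, h3]
    rcases lt_or_gt_of_ne hne with h5 | h5
    · rw [circleAverage_inv_sub_of_lt hr h5, indicator_of_mem (by exact h5)]
      push_cast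
      ring
    · rw [circleAverage_inv_sub_of_gt h5, indicator_of_notMem (by simpa using h5.le)]
      ring
  have hae : ∀ᵐ r : ℝ ∂(volume.restrict (Ioi (0 : ℝ))),
      ∫ θ in Ioo (-π) π, r • sphereKernel ζ (Complex.polarCoord.symm (r, θ)) =
        (Iio ‖ζ‖).indicator (fun r : ℝ => ((8 * π * r / (1 + r ^ 2) ^ 2 : ℝ) : ℂ) * ζ⁻¹) r := by
    have h6 : ∀ᵐ r : ℝ ∂(volume.restrict (Ioi (0 : ℝ))), r ≠ ‖ζ‖ :=
      ae_restrict_of_ae (Measure.ae_ne volume _)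
    filter_upwards [h6, ae_restrict_mem measurableSet_Ioi] with r h7 h8
    exact hinner r h8 h7
  rw [integral_congr_ae hae, setIntegral_indicator measurableSet_Iio, Ioi_inter_Iio,
    ← integral_Ioc_eq_integral_Ioo, ← intervalIntegral.integral_of_le (norm_nonneg _),
    intervalIntegral.integral_mul_const, intervalIntegral.integral_ofReal]
  have hprim : ∫ r in (0 : ℝ)..‖ζ‖, 8 * π * r / (1 + r ^ 2) ^ 2 =
      4 * π * ‖ζ‖ ^ 2 / (1 + ‖ζ‖ ^ 2) := by
    have hd : ∀ r ∈ uIcc 0 ‖ζ‖, HasDerivAt (fun r : ℝ => -(4 * π) / (1 + r ^ 2))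
        (8 * π * r / (1 + r ^ 2) ^ 2) r := by
      intro r _
      have h0 : (1 + r ^ 2) ≠ 0 := by positivity
      have h1 : HasDerivAt (fun r : ℝ => 1 + r ^ 2) (2 * r) r := by
        simpa using (hasDerivAt_pow 2 r).const_add 1
      have h2 := (hasDerivAt_const r (-(4 * π))).div h1 h0
      convert! h2 using 1
      ring
    rw [intervalIntegral.integral_eq_sub_of_hasDerivAt hd]
    · have : (1 + ‖ζ‖ ^ 2) ≠ 0 := by positivity
      field_simp
      ring
    · refine Continuous.intervalIntegrable ?_ _ _
      refine Continuous.div (by fun_prop) (by fun_prop) fun r => by positivity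
  rw [hprim]
  rcases eq_or_ne ζ 0 with rfl | hζ
  · simp
  · have h9 : (‖ζ‖ : ℂ) ^ 2 = ζ * (starRingEnd ℂ) ζ := by
      rw [Complex.mul_conj, Complex.normSq_eq_norm_sq]
      push_cast
      rfl
    push_cast
    rw [h9]
    field_simp

/-- The contribution of one arc to the weighted area, by Fubini's theorem. -/
theorem integrable_and_integral_density_mul_arc {γ v : ℝ → ℂ} (hγ : Continuous γ)
    (hv : Continuous v) {a b : ℝ} (hab : a ≤ b) :
    Integrable (fun z => sphereDensity z * ∫ t in a..b, (v t / (γ t - z)).im) ∧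
    ∫ z, sphereDensity z * ∫ t in a..b, (v t / (γ t - z)).im =
      ∫ t in a..b, 4 * π * ((starRingEnd ℂ) (γ t) * v t).im / (1 + ‖γ t‖ ^ 2) := by
  obtain ⟨M, hM⟩ := exists_integral_norm_sphereKernel_le
  have hm : Measurable fun p : ℂ × ℝ => v p.2 * sphereKernel (γ p.2) p.1 := by
    unfold sphereKernel
    have := continuous_sphereDensity.measurable
    have := hγ.measurable
    have := hv.measurable
    fun_prop
  have hint : Integrable (fun p : ℂ × ℝ => v p.2 * sphereKernel (γ p.2) p.1)
      (volume.prod (volume.restrict (Ioc a b))) := by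
    rw [integrable_prod_iff' hm.aestronglyMeasurable]
    refine ⟨Eventually.of_forall fun t => ((hM (γ t)).1.const_mul (v t)), ?_⟩
    have h1 : IntegrableOn (fun t => ‖v t‖ * M) (Ioc a b) :=
      ((hv.norm.mul continuous_const).integrableOn_Icc (a := a) (b := b)).mono_set
        Ioc_subset_Icc_self
    refine h1.mono' ?_ (Eventually.of_forall fun t => ?_)
    · exact (hm.aestronglyMeasurable
        (μ := volume.prod (volume.restrict (Ioc a b)))).norm.prod_swap.integral_prod_right'
    · simp only [norm_mul]
      rw [integral_const_mul, norm_mul, norm_norm]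
      refine mul_le_mul_of_nonneg_left ?_ (norm_nonneg _)
      rw [Real.norm_of_nonneg (integral_nonneg fun _ => norm_nonneg _)]
      exact (hM (γ t)).2
  have him := hint.im
  have heq : ∀ z, sphereDensity z * ∫ t in a..b, (v t / (γ t - z)).im =
      ∫ t in Ioc a b, RCLike.im (v t * sphereKernel (γ t) z) := by
    intro z
    rw [intervalIntegral.integral_of_le hab, ← integral_const_mul]
    refine integral_congr_ae (Eventually.of_forall fun t => ?_)
    simp only [sphereKernel, RCLike.im_eq_complex_im]
    rw [← Complex.im_ofReal_mul]
    congr 1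
    ring
  simp_rw [heq]
  refine ⟨him.integral_prod_left, ?_⟩
  rw [integral_integral_swap (f := fun z t => RCLike.im (v t * sphereKernel (γ t) z)) him,
    intervalIntegral.integral_of_le hab]
  refine integral_congr_ae (Eventually.of_forall fun t => ?_)
  simp only
  rw [integral_im ((hM (γ t)).1.const_mul (v t)), integral_const_mul, integral_sphereKernel]
  have : v t * (4 * π * (starRingEnd ℂ) (γ t) / (1 + ‖γ t‖ ^ 2)) =
    ((4 * π / (1 + ‖γ t‖ ^ 2) : ℝ) : ℂ) * ((starRingEnd ℂ) (γ t) * v t) := by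
    push_cast
    ring
  rw [this, RCLike.im_eq_complex_im, Complex.im_ofReal_mul]
  ring

/-- Green's formula for the area form of the sphere: the area, weighted with winding numbers,
is the integral along the curve of a primitive of the area form. -/
theorem PlaneCurve.integral_density_mul_wind (Γ : PlaneCurve) :
    ∫ z, sphereDensity z * Γ.wind z =
      ∑ i, ∫ t in (Γ.knot i.castSucc)..(Γ.knot i.succ),
        2 * ((starRingEnd ℂ) (Γ.toFun t) * Γ.vel i t).im / (1 + ‖Γ.toFun t‖ ^ 2) := by
  -- the curve on the `i`-th piece, extended continuously
  set g : Fin Γ.n → ℝ → ℂ := fun i => IccExtend (Γ.knot_lt i).le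
    ((Icc (Γ.knot i.castSucc) (Γ.knot i.succ)).domRestrict Γ.toFun) with hg
  have hgc : ∀ i, Continuous (g i) := fun i => by
    refine Continuous.Icc_extend' ?_
    exact continuousOn_iff_continuous_domRestrict.1
      (fun s hs => (Γ.hasDeriv i s hs).continuousWithinAt)
  have hgeq : ∀ i, ∀ t ∈ uIcc (Γ.knot i.castSucc) (Γ.knot i.succ), g i t = Γ.toFun t := by
    intro i t ht
    rw [uIcc_of_le (Γ.knot_lt i).le] at ht
    simp only [hg]
    rw [IccExtend_of_mem _ _ ht]
    rfl
  have h1 := fun i => integrable_and_integral_density_mul_arc (hgc i) (Γ.vel_continuous i)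
    (Γ.knot_lt i).le
  have h2 : ∀ z, sphereDensity z * Γ.wind z = (2 * π)⁻¹ * ∑ i, sphereDensity z *
      ∫ t in (Γ.knot i.castSucc)..(Γ.knot i.succ), (Γ.vel i t / (g i t - z)).im := by
    intro z
    rw [wind, ← Finset.mul_sum, mul_left_comm]
    congr 2
    refine Finset.sum_congr rfl fun i _ => intervalIntegral.integral_congr fun t ht => ?_
    simp only [hgeq i t ht]
  simp_rw [h2]
  rw [integral_const_mul, integral_finsetSum _ fun i _ => (h1 i).1, Finset.mul_sum]
  refine Finset.sum_congr rfl fun i _ => ?_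
  rw [(h1 i).2, ← intervalIntegral.integral_const_mul]
  refine intervalIntegral.integral_congr fun t ht => ?_
  simp only [hgeq i t ht]
  have : (1 + ‖Γ.toFun t‖ ^ 2) ≠ 0 := by positivity
  field_simp
  ring

theorem PlaneCurve.volume_trace (Γ : PlaneCurve) : volume Γ.trace = 0 := by
  have h1 : Γ.trace ⊆ ⋃ i : Fin Γ.n, Γ.toFun '' (Γ.piece i) := by
    rintro _ ⟨t, ht, rfl⟩
    obtain ⟨i, hi⟩ := exists_mem_Icc_knot Γ.knot Γ.knot_strictMono Γ.n_pos ht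
    exact mem_iUnion.2 ⟨i, t, hi, rfl⟩
  refine measure_mono_null h1 (measure_iUnion_null fun i => ?_)
  -- the piece is the image of a segment of the plane under a differentiable map
  have h2 : Γ.toFun '' (Γ.piece i) =
      (fun z : ℂ => Γ.toFun z.re) '' ((fun t : ℝ => (t : ℂ)) '' (Γ.piece i)) := by
    rw [image_image]
    simp
  rw [h2]
  refine addHaar_image_eq_zero_of_differentiableOn_of_addHaar_eq_zero volume ?_ ?_
  · rintro _ ⟨t, ht, rfl⟩
    refine DifferentiableWithinAt.comp (t := Γ.piece i) _ ?_
      Complex.reCLM.differentiableAt.differentiableWithinAt ?_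
    · exact (Γ.hasDeriv i t ht).differentiableWithinAt
    · rintro _ ⟨s, hs, rfl⟩
      simpa using hs
  · have h3 : (fun t : ℝ => (t : ℂ)) '' (Γ.piece i) ⊆ {z : ℂ | z.im = 0} := by
      rintro _ ⟨s, hs, rfl⟩
      simp
    refine measure_mono_null h3 ?_
    have := Measure.addHaar_submodule (volume : Measure ℂ) (LinearMap.ker Complex.imLm) (by
      intro h
      have : Complex.I ∈ LinearMap.ker Complex.imLm := by rw [h]; trivial
      simp at this)
    rw [show {z : ℂ | z.im = 0} = (LinearMap.ker Complex.imLm : Set ℂ) by ext z; simp]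
    exact this

/-! ### The vector product -/

theorem cross_apply_zero (u v : E3) : cross u v 0 = u 1 * v 2 - u 2 * v 1 := by
  simp [cross, crossProduct]

theorem cross_apply_one (u v : E3) : cross u v 1 = u 2 * v 0 - u 0 * v 2 := by
  simp [cross, crossProduct]

theorem cross_apply_two (u v : E3) : cross u v 2 = u 0 * v 1 - u 1 * v 0 := by
  simp [cross, crossProduct]

theorem E3.ext {u v : E3} (h0 : u 0 = v 0) (h1 : u 1 = v 1) (h2 : u 2 = v 2) : u = v := by
  ext i
  fin_cases i
  · exact h0
  · exact h1
  · exact h2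

theorem E3.inner_eq (u v : E3) : inner ℝ u v = u 0 * v 0 + u 1 * v 1 + u 2 * v 2 := by
  simp [PiLp.inner_apply, Fin.sum_univ_three]
  ring

theorem inner_cross_self_left (u v : E3) : inner ℝ u (cross u v) = 0 := by
  rw [E3.inner_eq, cross_apply_zero, cross_apply_one, cross_apply_two]
  ring

theorem inner_cross_self_right (u v : E3) : inner ℝ v (cross u v) = 0 := by
  rw [E3.inner_eq, cross_apply_zero, cross_apply_one, cross_apply_two]
  ring

theorem inner_cross_cross (a b c d : E3) : inner ℝ (cross a b) (cross c d) =
    inner ℝ a c * inner ℝ b d - inner ℝ a d * inner ℝ b c := by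
  simp only [E3.inner_eq, cross_apply_zero, cross_apply_one, cross_apply_two]
  ring

theorem E3.cross_cross (a b c : E3) :
    cross a (cross b c) = inner ℝ a c • b - inner ℝ a b • c := by
  apply E3.ext <;>
  simp only [E3.inner_eq, cross_apply_zero, cross_apply_one, cross_apply_two, PiLp.sub_apply,
    PiLp.smul_apply, smul_eq_mul] <;> ring

theorem cross_anticomm_E3 (a b : E3) : cross a b = -cross b a := by
  apply E3.ext <;>
  simp only [cross_apply_zero, cross_apply_one, cross_apply_two, PiLp.neg_apply] <;> ring

theorem cross_smul_right (r : ℝ) (u v : E3) : cross u (r • v) = r • cross u v := by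
  simp [cross]

/-- Every unit vector is the last vector of a positively oriented orthonormal basis. -/
theorem exists_orthonormalBasis_cross {n : E3} (hn : ‖n‖ = 1) :
    ∃ b : OrthonormalBasis (Fin 3) ℝ E3, b 2 = n ∧ cross (b 0) (b 1) = b 2 := by
  have hnn : inner ℝ n n = 1 := by rw [real_inner_self_eq_norm_sq, hn, one_pow]
  obtain ⟨v, hv⟩ : ∃ v, cross n v ≠ 0 := by
    by_contra! h
    have h0 := h (EuclideanSpace.single 0 1)
    have h1 := h (EuclideanSpace.single 1 1)
    have k1 := congrArg (fun w : E3 => w 1) h0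
    have k2 := congrArg (fun w : E3 => w 2) h0
    have k3 := congrArg (fun w : E3 => w 2) h1
    simp only [cross_apply_one, cross_apply_two] at k1 k2 k3
    simp at k1 k2 k3
    rw [E3.inner_eq, k1, k2, k3] at hnn
    norm_num at hnn
  set u : E3 := ‖cross n v‖⁻¹ • cross n v with hu
  have hun : ‖u‖ = 1 := by
    rw [hu, norm_smul, norm_inv, norm_norm, inv_mul_cancel₀ (norm_ne_zero_iff.2 hv)]
  have huu : inner ℝ u u = 1 := by rw [real_inner_self_eq_norm_sq, hun, one_pow]
  have hnu : inner ℝ n u = 0 := by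
    rw [hu, inner_smul_right, inner_cross_self_left, mul_zero]
  have hww : inner ℝ (cross n u) (cross n u) = 1 := by
    rw [inner_cross_cross, hnn, huu, hnu]
    ring
  have hwn : ‖cross n u‖ = 1 := by
    rw [real_inner_self_eq_norm_sq] at hww
    nlinarith [norm_nonneg (cross n u)]
  have hon : Orthonormal ℝ ![u, cross n u, n] := by
    constructor
    · intro i
      fin_cases i
      · exact hun
      · exact hwn
      · exact hn
    · intro i j hij
      fin_cases i <;> fin_cases j <;> first | exact absurd rfl hij | skip
      · exact inner_cross_self_right n u
      · exact (real_inner_comm _ _).trans hnu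
      · exact (real_inner_comm _ _).trans (inner_cross_self_right n u)
      · exact (real_inner_comm _ _).trans (inner_cross_self_left n u)
      · exact hnu
      · exact inner_cross_self_left n u
  have hcard : Fintype.card (Fin 3) = Module.finrank ℝ E3 := by simp
  set b := OrthonormalBasis.mk hon
    (hon.linearIndependent.span_eq_top_of_card_eq_finrank' hcard).ge with hb
  refine ⟨b, by simp [hb], ?_⟩
  have h0 : b 0 = u := by simp [hb]
  have h1 : b 1 = cross n u := by simp [hb]
  have h2 : b 2 = n := by simp [hb]
  rw [h0, h1, h2, E3.cross_cross, huu, real_inner_comm, hnu]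
  simp

/-! ### Stereographic coordinates -/

/-- Stereographic projection of the unit sphere from the point `-b 2`. If `b` is positively
oriented, it preserves the orientation of the sphere as seen from outside. -/
noncomputable def stereo (b : OrthonormalBasis (Fin 3) ℝ E3) (p : E3) : ℂ :=
  (((inner ℝ (b 0) p : ℝ) : ℂ) + ((inner ℝ (b 1) p : ℝ) : ℂ) * Complex.I) /
    ((1 + inner ℝ (b 2) p : ℝ) : ℂ)

/-- Inverse stereographic projection. -/
noncomputable def unstereo (b : OrthonormalBasis (Fin 3) ℝ E3) (z : ℂ) : E3 :=
  (1 + ‖z‖ ^ 2)⁻¹ • ((2 * z.re) • b 0 + (2 * z.im) • b 1 + (1 - ‖z‖ ^ 2) • b 2)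

/-- The complex coordinate of the tangent vector `w` at the point `p` of the sphere in the
orthonormal frame of the tangent plane which is made up of the normalized coordinate vectors
of the stereographic coordinate. -/
noncomputable def tcoord (b : OrthonormalBasis (Fin 3) ℝ E3) (p w : E3) : ℂ :=
  ((inner ℝ (b 0) w : ℝ) : ℂ) + ((inner ℝ (b 1) w : ℝ) : ℂ) * Complex.I -
    stereo b p * ((inner ℝ (b 2) w : ℝ) : ℂ)

/-- The tangent vector at `p` with a given complex coordinate. -/
noncomputable def tvec (b : OrthonormalBasis (Fin 3) ℝ E3) (p : E3) (η : ℂ) : E3 :=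
  η.re • (b 0 - (stereo b p).re • (p + b 2)) + η.im • (b 1 - (stereo b p).im • (p + b 2))

section Stereo

variable {b : OrthonormalBasis (Fin 3) ℝ E3} {p : E3}

theorem stereo_re : (stereo b p).re = inner ℝ (b 0) p / (1 + inner ℝ (b 2) p) := by
  rw [stereo, Complex.div_ofReal_re]
  simp

theorem stereo_im : (stereo b p).im = inner ℝ (b 1) p / (1 + inner ℝ (b 2) p) := by
  rw [stereo, Complex.div_ofReal_im]
  simp

theorem tcoord_re (w : E3) :
    (tcoord b p w).re = inner ℝ (b 0) w - (stereo b p).re * inner ℝ (b 2) w := by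
  simp [tcoord]

theorem tcoord_im (w : E3) :
    (tcoord b p w).im = inner ℝ (b 1) w - (stereo b p).im * inner ℝ (b 2) w := by
  simp [tcoord]

theorem tcoord_add (v w : E3) : tcoord b p (v + w) = tcoord b p v + tcoord b p w := by
  simp only [tcoord, inner_add_right]
  push_cast
  ring

theorem tcoord_smul (r : ℝ) (w : E3) : tcoord b p (r • w) = r * tcoord b p w := by
  simp only [tcoord, inner_smul_right]
  push_cast
  ring

theorem tcoord_neg (w : E3) : tcoord b p (-w) = -tcoord b p w := by
  simp only [tcoord, inner_neg_right]
  push_cast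
  ring

theorem tcoord_sub (v w : E3) : tcoord b p (v - w) = tcoord b p v - tcoord b p w := by
  rw [sub_eq_add_neg, tcoord_add, tcoord_neg, ← sub_eq_add_neg]

theorem inner_eq_coords (b : OrthonormalBasis (Fin 3) ℝ E3) (u v : E3) :
    inner ℝ u v = inner ℝ (b 0) u * inner ℝ (b 0) v + inner ℝ (b 1) u * inner ℝ (b 1) v +
      inner ℝ (b 2) u * inner ℝ (b 2) v := by
  rw [← b.sum_inner_mul_inner, Fin.sum_univ_three]
  simp only [real_inner_comm]

theorem inner_basis (b : OrthonormalBasis (Fin 3) ℝ E3) (i j : Fin 3) :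
    inner ℝ (b i) (b j) = if i = j then 1 else 0 := by
  rw [orthonormal_iff_ite.1 b.orthonormal]

theorem eq_of_coords (b : OrthonormalBasis (Fin 3) ℝ E3) {u v : E3}
    (h0 : inner ℝ (b 0) u = inner ℝ (b 0) v) (h1 : inner ℝ (b 1) u = inner ℝ (b 1) v)
    (h2 : inner ℝ (b 2) u = inner ℝ (b 2) v) : u = v := by
  apply b.repr.injective
  ext i
  rw [b.repr_apply_apply, b.repr_apply_apply]
  fin_cases i
  · exact h0
  · exact h1
  · exact h2

theorem one_add_inner_pos (hp : ‖p‖ = 1) (hq : p ≠ -b 2) : 0 < 1 + inner ℝ (b 2) p := by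
  have h1 : ‖b 2‖ = 1 := b.orthonormal.1 2
  have h2 := neg_one_le_real_inner_of_norm_eq_one h1 hp
  rcases h2.lt_or_eq with h | h
  · linarith
  · exfalso
    apply hq
    have h3 := (inner_eq_neg_one_iff_of_norm_eq_one (𝕜 := ℝ) hp h1).1
      (by rw [real_inner_comm]; exact h.symm)
    exact h3

theorem mul_stereo_re (h : 0 < 1 + inner ℝ (b 2) p) :
    (1 + inner ℝ (b 2) p) * (stereo b p).re = inner ℝ (b 0) p := by
  rw [stereo_re]
  field_simp

theorem mul_stereo_im (h : 0 < 1 + inner ℝ (b 2) p) :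
    (1 + inner ℝ (b 2) p) * (stereo b p).im = inner ℝ (b 1) p := by
  rw [stereo_im]
  field_simp

theorem sq_stereo (hp : ‖p‖ = 1) (h : 0 < 1 + inner ℝ (b 2) p) :
    (1 + inner ℝ (b 2) p) * ((stereo b p).re ^ 2 + (stereo b p).im ^ 2) = 1 - inner ℝ (b 2) p := by
  have h1 : inner ℝ p p = 1 := by rw [real_inner_self_eq_norm_sq, hp, one_pow]
  rw [inner_eq_coords b] at h1
  rw [stereo_re, stereo_im]
  field_simp
  linarith

theorem norm_sq_eq_re_im (z : ℂ) : ‖z‖ ^ 2 = z.re ^ 2 + z.im ^ 2 := by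
  rw [← Complex.normSq_eq_norm_sq, Complex.normSq_apply]
  ring

theorem one_add_norm_sq_stereo (hp : ‖p‖ = 1) (h : 0 < 1 + inner ℝ (b 2) p) :
    1 + ‖stereo b p‖ ^ 2 = 2 / (1 + inner ℝ (b 2) p) := by
  rw [norm_sq_eq_re_im, eq_div_iff h.ne']
  linarith [sq_stereo hp h]

theorem inner_zero_unstereo (z : ℂ) :
    inner ℝ (b 0) (unstereo b z) = 2 * z.re / (1 + ‖z‖ ^ 2) := by
  simp only [unstereo, inner_smul_right, inner_add_right, inner_basis]
  simp
  ring

theorem inner_one_unstereo (z : ℂ) :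
    inner ℝ (b 1) (unstereo b z) = 2 * z.im / (1 + ‖z‖ ^ 2) := by
  simp only [unstereo, inner_smul_right, inner_add_right, inner_basis]
  simp
  ring

theorem inner_two_unstereo (z : ℂ) :
    inner ℝ (b 2) (unstereo b z) = (1 - ‖z‖ ^ 2) / (1 + ‖z‖ ^ 2) := by
  simp only [unstereo, inner_smul_right, inner_add_right, inner_basis]
  simp
  ring

theorem one_add_inner_two_unstereo (z : ℂ) :
    1 + inner ℝ (b 2) (unstereo b z) = 2 / (1 + ‖z‖ ^ 2) := by
  rw [inner_two_unstereo]
  have : 1 + ‖z‖ ^ 2 ≠ 0 := by positivity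
  field_simp
  ring

theorem norm_unstereo (z : ℂ) : ‖unstereo b z‖ = 1 := by
  have : inner ℝ (unstereo b z) (unstereo b z) = 1 := by
    rw [inner_eq_coords b, inner_zero_unstereo, inner_one_unstereo, inner_two_unstereo]
    have h1 : 1 + ‖z‖ ^ 2 ≠ 0 := by positivity
    have h2 := norm_sq_eq_re_im z
    field_simp
    rw [h2]
    ring
  rw [real_inner_self_eq_norm_sq] at this
  nlinarith [norm_nonneg (unstereo b z)]

theorem unstereo_ne (z : ℂ) : unstereo b z ≠ -b 2 := by
  intro h
  have h1 := one_add_inner_two_unstereo (b := b) z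
  rw [h, inner_neg_right, inner_basis] at h1
  simp at h1
  exact absurd h1 (by positivity)

theorem stereo_unstereo (z : ℂ) : stereo b (unstereo b z) = z := by
  have h1 : 1 + ‖z‖ ^ 2 ≠ 0 := by positivity
  apply Complex.ext
  · rw [stereo_re, inner_zero_unstereo, one_add_inner_two_unstereo]
    field_simp
  · rw [stereo_im, inner_one_unstereo, one_add_inner_two_unstereo]
    field_simp

theorem unstereo_stereo (hp : ‖p‖ = 1) (hq : p ≠ -b 2) : unstereo b (stereo b p) = p := by
  have h := one_add_inner_pos hp hq
  have h1 := one_add_norm_sq_stereo hp h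
  apply eq_of_coords b
  · rw [inner_zero_unstereo, h1, stereo_re]
    field_simp
  · rw [inner_one_unstereo, h1, stereo_im]
    field_simp
  · have h2 := one_add_inner_two_unstereo (b := b) (stereo b p)
    rw [h1] at h2
    field_simp at h2
    linarith

theorem continuous_unstereo : Continuous (unstereo b) := by
  unfold unstereo
  have h1 : Continuous fun z : ℂ => (1 + ‖z‖ ^ 2)⁻¹ :=
    Continuous.inv₀ (by fun_prop) fun z => by positivity
  fun_prop

theorem continuousAt_stereo (h : 0 < 1 + inner ℝ (b 2) p) : ContinuousAt (stereo b) p := by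
  unfold stereo
  refine ContinuousAt.div (by fun_prop) (by fun_prop) ?_
  exact_mod_cast h.ne'

theorem inner_two_eq (hp : ‖p‖ = 1) (h : 0 < 1 + inner ℝ (b 2) p)
    {w : E3} (hw : inner ℝ p w = 0) : inner ℝ (b 2) w =
    -(1 + inner ℝ (b 2) p) * ((starRingEnd ℂ) (stereo b p) * tcoord b p w).re := by
  have h1 := sq_stereo hp h
  rw [inner_eq_coords b, ← mul_stereo_re h, ← mul_stereo_im h] at hw
  rw [Complex.mul_re, Complex.conj_re, Complex.conj_im, tcoord_re, tcoord_im]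
  linear_combination hw - inner ℝ (b 2) w * h1

/-- The coordinate of tangent vectors is isometric. -/
theorem re_conj_tcoord_mul (hp : ‖p‖ = 1) (h : 0 < 1 + inner ℝ (b 2) p)
    {v w : E3} (hv : inner ℝ p v = 0) (hw : inner ℝ p w = 0) :
    ((starRingEnd ℂ) (tcoord b p v) * tcoord b p w).re = inner ℝ v w := by
  have h1 := sq_stereo hp h
  rw [inner_eq_coords b, ← mul_stereo_re h, ← mul_stereo_im h] at hv hw
  rw [inner_eq_coords b v w, Complex.mul_re, Complex.conj_re, Complex.conj_im, tcoord_re,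
    tcoord_im, tcoord_re, tcoord_im]
  apply mul_left_cancel₀ h.ne'
  linear_combination -inner ℝ (b 2) w * hv - inner ℝ (b 2) v * hw +
    inner ℝ (b 2) v * inner ℝ (b 2) w * h1

theorem norm_tcoord (hp : ‖p‖ = 1) (h : 0 < 1 + inner ℝ (b 2) p)
    {w : E3} (hw : inner ℝ p w = 0) : ‖tcoord b p w‖ = ‖w‖ := by
  have h1 := re_conj_tcoord_mul hp h hw hw
  rw [mul_comm, Complex.mul_conj, Complex.ofReal_re, Complex.normSq_eq_norm_sq,
    real_inner_self_eq_norm_sq] at h1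
  exact (sq_eq_sq₀ (norm_nonneg _) (norm_nonneg _)).1 h1

theorem eq_of_tcoord_eq (hp : ‖p‖ = 1) (h : 0 < 1 + inner ℝ (b 2) p)
    {v w : E3} (hv : inner ℝ p v = 0) (hw : inner ℝ p w = 0)
    (he : tcoord b p v = tcoord b p w) : v = w := by
  have h1 := norm_tcoord hp h (w := v - w) (by rw [inner_sub_right, hv, hw, sub_zero])
  rw [tcoord_sub, he, sub_self, norm_zero] at h1
  exact sub_eq_zero.1 (norm_eq_zero.1 h1.symm)

theorem inner_tvec (hp : ‖p‖ = 1) (h : 0 < 1 + inner ℝ (b 2) p)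
    (η : ℂ) : inner ℝ p (tvec b p η) = 0 := by
  have h1 := sq_stereo hp h
  have h2 : inner ℝ p p = 1 := by rw [real_inner_self_eq_norm_sq, hp, one_pow]
  simp only [tvec, inner_add_right, inner_smul_right, inner_sub_right, h2]
  rw [real_inner_comm (b 0) p, real_inner_comm (b 1) p, real_inner_comm (b 2) p,
    ← mul_stereo_re h, ← mul_stereo_im h]
  ring

theorem tcoord_tvec (hp : ‖p‖ = 1) (h : 0 < 1 + inner ℝ (b 2) p)
    (η : ℂ) : tcoord b p (tvec b p η) = η := by
  have h1 := sq_stereo hp h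
  apply Complex.ext
  · rw [tcoord_re]
    simp only [tvec, inner_add_right, inner_smul_right, inner_sub_right, inner_basis,
      ← mul_stereo_re h]
    simp
    ring
  · rw [tcoord_im]
    simp only [tvec, inner_add_right, inner_smul_right, inner_sub_right, inner_basis,
      ← mul_stereo_im h]
    simp
    ring

/-- Rotation by a right angle in the tangent plane is multiplication by `i`. -/
theorem tcoord_cross (hb : cross (b 0) (b 1) = b 2) (hp : ‖p‖ = 1) (h : 0 < 1 + inner ℝ (b 2) p)
    {w : E3} (hw : inner ℝ p w = 0) : tcoord b p (cross p w) = Complex.I * tcoord b p w := by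
  have h1 := sq_stereo hp h
  have hb0 : cross (b 1) (b 2) = b 0 := by
    rw [← hb, E3.cross_cross, inner_basis, inner_basis]
    simp
  have hb1 : cross (b 2) (b 0) = b 1 := by
    rw [cross_anticomm_E3, ← hb, E3.cross_cross, inner_basis, inner_basis]
    simp
  have k0 : inner ℝ (b 0) (cross p w) = inner ℝ (b 1) p * inner ℝ (b 2) w -
      inner ℝ (b 1) w * inner ℝ (b 2) p := by
    rw [← hb0, inner_cross_cross]
  have k1 : inner ℝ (b 1) (cross p w) = inner ℝ (b 2) p * inner ℝ (b 0) w -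
      inner ℝ (b 2) w * inner ℝ (b 0) p := by
    rw [← hb1, inner_cross_cross]
  have k2 : inner ℝ (b 2) (cross p w) = inner ℝ (b 0) p * inner ℝ (b 1) w -
      inner ℝ (b 0) w * inner ℝ (b 1) p := by
    rw [← hb, inner_cross_cross]
  rw [inner_eq_coords b] at hw
  have m0 := mul_stereo_re h
  have m1 := mul_stereo_im h
  set x := (stereo b p).re
  set y := (stereo b p).im
  rw [← m0, ← m1] at hw
  apply Complex.ext
  · rw [tcoord_re, k0, k2, Complex.mul_re, Complex.I_re, Complex.I_im, tcoord_im, ← m0, ← m1]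
    linear_combination y * hw - inner ℝ (b 1) w * h1
  · rw [tcoord_im, k1, k2, Complex.mul_im, Complex.I_re, Complex.I_im, tcoord_re, ← m0, ← m1]
    linear_combination -x * hw + inner ℝ (b 0) w * h1

/-- The oriented inner product of tangent vectors in terms of their coordinates. -/
theorem conj_tcoord_mul (hb : cross (b 0) (b 1) = b 2) (hp : ‖p‖ = 1)
    (h : 0 < 1 + inner ℝ (b 2) p) {v w : E3} (hv : inner ℝ p v = 0) (hw : inner ℝ p w = 0) :
    (starRingEnd ℂ) (tcoord b p v) * tcoord b p w =
      ⟨inner ℝ v w, inner ℝ (cross p v) w⟩ := by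
  apply Complex.ext
  · exact re_conj_tcoord_mul hp h hv hw
  · have h1 := re_conj_tcoord_mul hp h (inner_cross_self_left p v) hw
    rw [tcoord_cross hb hp h hv] at h1
    simp only
    rw [← h1]
    simp
    ring

theorem inner_rotateAbout {w : E3} (hw : inner ℝ p w = 0) (θ : ℝ) :
    inner ℝ p (rotateAbout p θ w) = 0 := by
  rw [rotateAbout, inner_add_right, inner_smul_right, inner_smul_right, hw,
    inner_cross_self_left]
  simp

theorem tcoord_rotateAbout (hb : cross (b 0) (b 1) = b 2) (hp : ‖p‖ = 1)
    (h : 0 < 1 + inner ℝ (b 2) p) {w : E3} (hw : inner ℝ p w = 0) (θ : ℝ) :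
    tcoord b p (rotateAbout p θ w) = Complex.exp (θ * Complex.I) * tcoord b p w := by
  rw [rotateAbout, tcoord_add, tcoord_smul, tcoord_smul, tcoord_cross hb hp h hw,
    Complex.exp_mul_I]
  push_cast
  ring

/-- The differential of the stereographic coordinate. -/
theorem hasDerivWithinAt_stereo (h : 0 < 1 + inner ℝ (b 2) p) {c : ℝ → E3} {c' : E3} {S : Set ℝ}
    {t : ℝ} (hc : HasDerivWithinAt c c' S t) (hpt : c t = p) :
    HasDerivWithinAt (fun s => stereo b (c s))
      (tcoord b p c' / ((1 + inner ℝ (b 2) p : ℝ) : ℂ)) S t := by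
  have hi : ∀ i, HasDerivWithinAt (fun s => ((inner ℝ (b i) (c s) : ℝ) : ℂ))
      ((inner ℝ (b i) c' : ℝ) : ℂ) S t := fun i => by
    have := (innerSL ℝ (b i)).hasFDerivAt.comp_hasDerivWithinAt t hc
    exact HasDerivWithinAt.ofReal_comp this
  have hne : ((1 + inner ℝ (b 2) (c t) : ℝ) : ℂ) ≠ 0 := by rw [hpt]; exact_mod_cast h.ne'
  have h1 := ((hi 0).add ((hi 1).mul_const Complex.I)).div
    (d := fun s => ((1 + inner ℝ (b 2) (c s) : ℝ) : ℂ))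
    (by simpa using (hi 2).const_add 1) hne
  convert! h1 using 1
  simp only [Pi.add_apply, hpt, tcoord, stereo] at hne ⊢
  field_simp

end Stereo

/-! ### The area of the sphere in stereographic coordinates -/

/-- Polar coordinates of space, with the stereographic coordinate on the unit sphere, in terms of
cartesian coordinates. -/
noncomputable def stereoPolar (y : Fin 3 → ℝ) : Fin 3 → ℝ :=
  ![y 0 * (2 * y 1 / (1 + (y 1 ^ 2 + y 2 ^ 2))), y 0 * (2 * y 2 / (1 + (y 1 ^ 2 + y 2 ^ 2))),
    y 0 * ((1 - (y 1 ^ 2 + y 2 ^ 2)) / (1 + (y 1 ^ 2 + y 2 ^ 2)))]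

/-- The Jacobian matrix of `stereoPolar`. -/
noncomputable def stereoPolarJacobian (y : Fin 3 → ℝ) : Matrix (Fin 3) (Fin 3) ℝ :=
  let N := 1 + (y 1 ^ 2 + y 2 ^ 2)
  !![2 * y 1 / N, y 0 * (2 * N - 4 * y 1 ^ 2) / N ^ 2, -(4 * y 0 * y 1 * y 2) / N ^ 2;
    2 * y 2 / N, -(4 * y 0 * y 1 * y 2) / N ^ 2, y 0 * (2 * N - 4 * y 2 ^ 2) / N ^ 2;
    (2 - N) / N, -(4 * y 0 * y 1) / N ^ 2, -(4 * y 0 * y 2) / N ^ 2]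

theorem det_stereoPolarJacobian (y : Fin 3 → ℝ) : (stereoPolarJacobian y).det =
    y 0 ^ 2 * (4 / (1 + (y 1 ^ 2 + y 2 ^ 2)) ^ 2) := by
  have : 1 + (y 1 ^ 2 + y 2 ^ 2) ≠ 0 := by positivity
  rw [Matrix.det_fin_three]
  simp [stereoPolarJacobian]
  field_simp
  ring

theorem hasFDerivAt_stereoPolar (y : Fin 3 → ℝ) : HasFDerivAt stereoPolar
    (LinearMap.toContinuousLinearMap (Matrix.toLin' (stereoPolarJacobian y))) y := by
  have hN : 1 + (y 1 ^ 2 + y 2 ^ 2) ≠ 0 := by positivity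
  have h0 : HasFDerivAt (fun y : Fin 3 → ℝ => y 0) (ContinuousLinearMap.proj (R := ℝ) 0) y :=
    hasFDerivAt_apply 0 y
  have h1 : HasFDerivAt (fun y : Fin 3 → ℝ => y 1) (ContinuousLinearMap.proj (R := ℝ) 1) y :=
    hasFDerivAt_apply 1 y
  have h2 : HasFDerivAt (fun y : Fin 3 → ℝ => y 2) (ContinuousLinearMap.proj (R := ℝ) 2) y :=
    hasFDerivAt_apply 2 y
  have hs := (h1.pow 2).add (h2.pow 2)
  have hd : HasFDerivAt (fun y : Fin 3 → ℝ => (1 + (y 1 ^ 2 + y 2 ^ 2))⁻¹) _ y :=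
    (hasDerivAt_inv hN).comp_hasFDerivAt y (hs.const_add 1)
  rw [hasFDerivAt_pi']
  intro i
  fin_cases i
  · have h := h0.mul ((h1.const_mul 2).mul hd)
    convert! h using 1
    ext v
    simp [stereoPolarJacobian, Matrix.toLin'_apply, dotProduct, Fin.sum_univ_three]
    field_simp
    ring
  · have h := h0.mul ((h2.const_mul 2).mul hd)
    convert! h using 1
    ext v
    simp [stereoPolarJacobian, Matrix.toLin'_apply, dotProduct, Fin.sum_univ_three]
    field_simp
    ring
  · have h := h0.mul ((hs.const_sub 1).mul hd)
    convert! h using 1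
    ext v
    simp [stereoPolarJacobian, Matrix.toLin'_apply, dotProduct, Fin.sum_univ_three]
    field_simp
    ring

/-- The first coordinate, and the other two as a complex number. -/
noncomputable def realComplexCoord (y : Fin 3 → ℝ) : ℝ × ℂ := (y 0, (y 1 : ℂ) + y 2 * Complex.I)

theorem measurePreserving_realComplexCoord : MeasurePreserving realComplexCoord := by
  have h1 := volume_preserving_piFinSuccAbove (fun _ : Fin 3 => ℝ) 0
  have h2 : MeasurePreserving (Prod.map id Complex.measurableEquivPi.symm)
      ((volume : Measure ℝ).prod (volume : Measure (Fin 2 → ℝ))) (volume.prod volume) :=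
    (MeasurePreserving.id volume).prod Complex.volume_preserving_equiv_pi.symm
  exact h2.comp h1

theorem measurable_stereo (b : OrthonormalBasis (Fin 3) ℝ E3) : Measurable (stereo b) := by
  unfold stereo
  fun_prop

open scoped Pointwise in
/-- Stereographic projection transforms the surface measure of the sphere into the measure with the
density `sphereDensity`. The surface measure of a set is three times the volume of the cone over it,
which is computed in the coordinates `stereoPolar`. -/
theorem toSphere_stereo_preimage (b : OrthonormalBasis (Fin 3) ℝ E3) {A : Set ℂ}
    (hA : MeasurableSet A) :
    (volume : Measure E3).toSphere
      {x : Metric.sphere (0 : E3) 1 | (x : E3) ≠ -b 2 ∧ stereo b x ∈ A} =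
    ∫⁻ z in A, ENNReal.ofReal (sphereDensity z) := by
  have hs : MeasurableSet
      {x : Metric.sphere (0 : E3) 1 | (x : E3) ≠ -b 2 ∧ stereo b x ∈ A} :=
    ((measurableSet_singleton (-b 2)).compl.preimage measurable_subtype_coe).inter
      (((measurable_stereo b).comp measurable_subtype_coe) hA)
  rw [Measure.toSphere_apply' _ hs]
  set D : Set (Fin 3 → ℝ) := realComplexCoord ⁻¹' (Ioo (0 : ℝ) 1 ×ˢ A) with hD
  have hDm : MeasurableSet D :=
    measurePreserving_realComplexCoord.measurable (measurableSet_Ioo.prod hA)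
  set g : E3 ≃ᵐ (Fin 3 → ℝ) :=
    b.measurableEquiv.trans (MeasurableEquiv.toLp 2 (Fin 3 → ℝ)).symm with hg
  have hgp : MeasurePreserving g :=
    (PiLp.volume_preserving_ofLp (Fin 3)).comp b.measurePreserving_repr
  have hga : ∀ x i, g x i = inner ℝ (b i) x := fun x i => b.repr_apply_apply x i
  have hgP : ∀ y, g (y 0 • unstereo b (realComplexCoord y).2) = stereoPolar y := by
    intro y
    have hn : ‖(realComplexCoord y).2‖ ^ 2 = y 1 ^ 2 + y 2 ^ 2 := by
      rw [norm_sq_eq_re_im]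
      simp [realComplexCoord]
    have h1 : (realComplexCoord y).2.re = y 1 := by simp [realComplexCoord]
    have h2 : (realComplexCoord y).2.im = y 2 := by simp [realComplexCoord]
    ext i
    rw [hga, inner_smul_right]
    fin_cases i
    · simp only [Fin.zero_eta, inner_zero_unstereo, hn, h1]
      rfl
    · simp only [Fin.mk_one, inner_one_unstereo, hn, h2]
      rfl
    · simp only [Fin.reduceFinMk, inner_two_unstereo, hn]
      rfl
  have hcone : Ioo (0 : ℝ) 1 •
      (Subtype.val '' {x : Metric.sphere (0 : E3) 1 | (x : E3) ≠ -b 2 ∧ stereo b x ∈ A}) =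
      g ⁻¹' (stereoPolar '' D) := by
    ext x
    constructor
    · rintro ⟨r, hr, _, ⟨p, hp, rfl⟩, rfl⟩
      have hpn : ‖(p : E3)‖ = 1 := by simp
      refine ⟨![r, (stereo b p).re, (stereo b p).im], ⟨hr, ?_⟩, ?_⟩
      · simpa [realComplexCoord] using hp.2
      · rw [← hgP]
        simp [realComplexCoord, unstereo_stereo hpn hp.1]
    · rintro ⟨y, hy, hyx⟩
      rw [← hgP] at hyx
      have h1 := g.injective hyx
      refine ⟨y 0, hy.1, unstereo b (realComplexCoord y).2,
        ⟨⟨unstereo b (realComplexCoord y).2, by simp [norm_unstereo]⟩, ⟨unstereo_ne _, ?_⟩, rfl⟩,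
        h1⟩
      simp only [stereo_unstereo]
      exact hy.2
  have hinj : InjOn stereoPolar D := by
    intro y hy y' hy' he
    rw [← hgP, ← hgP] at he
    have h1 := g.injective he
    have h2 := congrArg norm h1
    have hy0 : 0 < y 0 := hy.1.1
    have hy0' : 0 < y' 0 := hy'.1.1
    rw [norm_smul, norm_smul, norm_unstereo, norm_unstereo, mul_one, mul_one,
      Real.norm_of_nonneg hy0.le, Real.norm_of_nonneg hy0'.le] at h2
    rw [h2] at h1
    have h3 := congrArg (stereo b) (smul_right_injective E3 hy0'.ne' h1)
    rw [stereo_unstereo, stereo_unstereo] at h3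
    have h4 := congrArg Complex.re h3
    have h5 := congrArg Complex.im h3
    simp [realComplexCoord] at h4 h5
    ext i
    fin_cases i
    · exact h2
    · exact h4
    · exact h5
  rw [hcone, hgp.measure_preimage_equiv, ← lintegral_abs_det_fderiv_eq_addHaar_image volume hDm
    (fun y _ => (hasFDerivAt_stereoPolar y).hasFDerivWithinAt) hinj]
  have hdet : ∀ y ∈ D, ENNReal.ofReal |(LinearMap.toContinuousLinearMap
      (Matrix.toLin' (stereoPolarJacobian y))).det| =
      (fun q : ℝ × ℂ => ENNReal.ofReal (q.1 ^ 2) * ENNReal.ofReal (sphereDensity q.2))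
        (realComplexCoord y) := by
    intro y _
    have h1 : (LinearMap.toContinuousLinearMap
        (Matrix.toLin' (stereoPolarJacobian y))).det = (stereoPolarJacobian y).det := by
      rw [ContinuousLinearMap.det, LinearMap.coe_toContinuousLinearMap, LinearMap.det_toLin']
    have hn : ‖(realComplexCoord y).2‖ ^ 2 = y 1 ^ 2 + y 2 ^ 2 := by
      rw [norm_sq_eq_re_im]
      simp [realComplexCoord]
    rw [h1, det_stereoPolarJacobian, abs_of_nonneg (by positivity),
      ENNReal.ofReal_mul (by positivity)]
    simp only [sphereDensity, hn]
    rfl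
  have hmd : Measurable fun z => ENNReal.ofReal (sphereDensity z) :=
    continuous_sphereDensity.measurable.ennreal_ofReal
  have hm1 : Measurable fun r : ℝ => ENNReal.ofReal (r ^ 2) := by fun_prop
  rw [setLIntegral_congr_fun hDm hdet, hD,
    measurePreserving_realComplexCoord.setLIntegral_comp_preimage (measurableSet_Ioo.prod hA)
      (f := fun q : ℝ × ℂ => ENNReal.ofReal (q.1 ^ 2) * ENNReal.ofReal (sphereDensity q.2))
      ((hm1.comp measurable_fst).mul (hmd.comp measurable_snd)), Measure.volume_eq_prod,
    ← Measure.prod_restrict,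
    lintegral_prod_mul hm1.aemeasurable hmd.aemeasurable, ← mul_assoc]
  have hr : ∫⁻ r in Ioo (0 : ℝ) 1, ENNReal.ofReal (r ^ 2) = ENNReal.ofReal (1 / 3) := by
    rw [← ofReal_integral_eq_lintegral_ofReal, ← integral_Ioc_eq_integral_Ioo,
      ← intervalIntegral.integral_of_le zero_le_one, integral_pow]
    · norm_num
    · exact (Continuous.integrableOn_Icc (by fun_prop)).mono_set Ioo_subset_Icc_self
    · exact Eventually.of_forall fun r => sq_nonneg r
  rw [hr]
  have : (Module.finrank ℝ E3 : ENNReal) * ENNReal.ofReal (1 / 3) = 1 := by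
    rw [show Module.finrank ℝ E3 = 3 by simp, show ((3 : ℕ) : ENNReal) = ENNReal.ofReal 3 by simp,
      ← ENNReal.ofReal_mul (by norm_num)]
    norm_num
  rw [this, one_mul]

/-! ### Curves on the sphere and their stereographic images -/

namespace SimpleClosedSphereCurve

variable (C : SimpleClosedSphereCurve)

theorem knot_lt (i : Fin C.n) : C.knot i.castSucc < C.knot i.succ :=
  C.knot_strictMono i.castSucc_lt_succ

theorem start_lt_finish : C.start < C.finish := by
  apply C.knot_strictMono
  rw [Fin.lt_def]
  simpa using C.n_pos

theorem piece_subset (i : Fin C.n) : C.piece i ⊆ Icc C.start C.finish :=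
  Icc_knot_subset C.knot_strictMono i

theorem left_mem_piece (i : Fin C.n) : C.knot i.castSucc ∈ C.piece i :=
  left_mem_Icc.2 (C.knot_lt i).le

theorem right_mem_piece (i : Fin C.n) : C.knot i.succ ∈ C.piece i :=
  right_mem_Icc.2 (C.knot_lt i).le

theorem uniqueDiffOn_piece (i : Fin C.n) : UniqueDiffOn ℝ (C.piece i) :=
  uniqueDiffOn_Icc (C.knot_lt i)

theorem continuousOn : ContinuousOn C.toFun (Icc C.start C.finish) :=
  continuousOn_Icc_of_knot C.knot_strictMono C.n_pos fun i => (C.smooth i).continuousOn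

theorem isCompact_trace : IsCompact C.trace := isCompact_Icc.image_of_continuousOn C.continuousOn

theorem norm_toFun {s : ℝ} (hs : s ∈ Icc C.start C.finish) : ‖C.toFun s‖ = 1 :=
  C.norm_eq_one s hs

theorem norm_of_mem_piece {i : Fin C.n} {s : ℝ} (hs : s ∈ C.piece i) : ‖C.toFun s‖ = 1 :=
  C.norm_eq_one s (C.piece_subset i hs)

theorem closed' : C.toFun C.start = C.toFun C.finish := C.closed

theorem ne_of_mem_Ioo {s t : ℝ} (hs : s ∈ Ioo C.start C.finish) (ht : t ∈ Icc C.start C.finish)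
    (hne : t ≠ s) : C.toFun t ≠ C.toFun s := by
  intro he
  rcases ht.2.lt_or_eq with h | h
  · exact hne (C.simple ⟨ht.1, h⟩ ⟨hs.1.le, hs.2⟩ he)
  · rw [h, ← C.closed'] at he
    exact hs.1.ne (C.simple ⟨le_rfl, C.start_lt_finish⟩ ⟨hs.1.le, hs.2⟩ he)

theorem Ioo_subset (i : Fin C.n) :
    Ioo (C.knot i.castSucc) (C.knot i.succ) ⊆ Ioo C.start C.finish := fun _ hs =>
  ⟨(C.piece_subset i (C.left_mem_piece i)).1.trans_lt hs.1,
    hs.2.trans_le (C.piece_subset i (C.right_mem_piece i)).2⟩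

theorem hasDerivWithinAt (i : Fin C.n) {s : ℝ} (hs : s ∈ C.piece i) :
    HasDerivWithinAt C.toFun (C.velocity i s) (C.piece i) s :=
  ((C.smooth i).differentiableOn (by simp) s hs).hasDerivWithinAt

theorem continuousOn_velocity (i : Fin C.n) : ContinuousOn (C.velocity i) (C.piece i) :=
  (C.smooth i).continuousOn_derivWithin (C.uniqueDiffOn_piece i) (by simp)

theorem velocity_ne_zero (i : Fin C.n) {s : ℝ} (hs : s ∈ C.piece i) : C.velocity i s ≠ 0 :=
  C.regular i s hs

theorem norm_velocity_pos (i : Fin C.n) {s : ℝ} (hs : s ∈ C.piece i) : 0 < ‖C.velocity i s‖ :=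
  norm_pos_iff.2 (C.velocity_ne_zero i hs)

theorem inner_velocity (i : Fin C.n) {s : ℝ} (hs : s ∈ C.piece i) :
    inner ℝ (C.toFun s) (C.velocity i s) = 0 := by
  have h1 := (C.hasDerivWithinAt i hs).inner ℝ (C.hasDerivWithinAt i hs)
  have h2 : HasDerivWithinAt (fun t => inner ℝ (C.toFun t) (C.toFun t)) 0 (C.piece i) s := by
    refine (hasDerivWithinAt_const s (C.piece i) (1 : ℝ)).congr (fun t ht => ?_) ?_
    · rw [real_inner_self_eq_norm_sq, C.norm_of_mem_piece ht, one_pow]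
    · rw [real_inner_self_eq_norm_sq, C.norm_of_mem_piece hs, one_pow]
  have h3 := (C.uniqueDiffOn_piece i s hs).eq_deriv _ h1 h2
  rw [real_inner_comm (C.toFun s)] at h3
  rw [real_inner_comm] at h3 ⊢
  linarith

theorem inner_direction (i : Fin C.n) {s : ℝ} (hs : s ∈ C.piece i) :
    inner ℝ (C.toFun s) (C.direction i s) = 0 := by
  rw [direction, inner_smul_right, C.inner_velocity i hs, mul_zero]

theorem norm_direction (i : Fin C.n) {s : ℝ} (hs : s ∈ C.piece i) : ‖C.direction i s‖ = 1 := by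
  rw [direction, norm_smul, norm_inv, norm_norm, inv_mul_cancel₀ (C.norm_velocity_pos i hs).ne']

variable {C} {b : OrthonormalBasis (Fin 3) ℝ E3}

theorem ne_of_notMem_trace (hq : -b 2 ∉ C.trace) {s : ℝ} (hs : s ∈ Icc C.start C.finish) :
    C.toFun s ≠ -b 2 := fun h => hq ⟨s, hs, h⟩

theorem height_pos (hq : -b 2 ∉ C.trace) {s : ℝ} (hs : s ∈ Icc C.start C.finish) :
    0 < 1 + inner ℝ (b 2) (C.toFun s) :=
  one_add_inner_pos (C.norm_toFun hs) (ne_of_notMem_trace hq hs)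

theorem height_pos_of_mem_piece (hq : -b 2 ∉ C.trace) {i : Fin C.n} {s : ℝ} (hs : s ∈ C.piece i) :
    0 < 1 + inner ℝ (b 2) (C.toFun s) := height_pos hq (C.piece_subset i hs)

theorem stereo_injOn (b : OrthonormalBasis (Fin 3) ℝ E3) :
    InjOn (stereo b) {p | ‖p‖ = 1 ∧ p ≠ -b 2} := by
  intro p hp p' hp' h
  rw [← unstereo_stereo hp.1 hp.2, h, unstereo_stereo hp'.1 hp'.2]

theorem continuousOn_stereoVelocity (hq : -b 2 ∉ C.trace) (i : Fin C.n) :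
    ContinuousOn (fun s => tcoord b (C.toFun s) (C.velocity i s) /
      ((1 + inner ℝ (b 2) (C.toFun s) : ℝ) : ℂ)) (C.piece i) := by
  have h1 : ContinuousOn C.toFun (C.piece i) := C.continuousOn.mono (C.piece_subset i)
  have h2 := C.continuousOn_velocity i
  have hin : ∀ j, ContinuousOn (fun s => ((inner ℝ (b j) (C.velocity i s) : ℝ) : ℂ))
      (C.piece i) := fun j =>
    Complex.continuous_ofReal.comp_continuousOn (continuousOn_const.inner h2)
  have hst : ContinuousOn (fun s => stereo b (C.toFun s)) (C.piece i) := fun s hs =>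
    (continuousAt_stereo (height_pos_of_mem_piece hq hs)).comp_continuousWithinAt (h1 s hs)
  refine ContinuousOn.div ?_ ?_ fun s hs => ?_
  · unfold tcoord
    exact ((hin 0).add ((hin 1).mul continuousOn_const)).sub (hst.mul (hin 2))
  · exact Complex.continuous_ofReal.comp_continuousOn
      (continuousOn_const.add (continuousOn_const.inner h1))
  · exact_mod_cast (height_pos_of_mem_piece hq hs).ne'

theorem tcoord_velocity_ne_zero (hq : -b 2 ∉ C.trace) (i : Fin C.n) {s : ℝ} (hs : s ∈ C.piece i) :
    tcoord b (C.toFun s) (C.velocity i s) ≠ 0 := by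
  rw [← norm_pos_iff, norm_tcoord (C.norm_of_mem_piece hs) (height_pos_of_mem_piece hq hs)
    (C.inner_velocity i hs)]
  exact C.norm_velocity_pos i hs

/-- The stereographic image of a curve on the sphere. -/
noncomputable def planeCurve (C : SimpleClosedSphereCurve) (b : OrthonormalBasis (Fin 3) ℝ E3)
    (hq : -b 2 ∉ C.trace) : PlaneCurve where
  n := C.n
  n_pos := C.n_pos
  knot := C.knot
  knot_strictMono := C.knot_strictMono
  toFun := fun s => stereo b (C.toFun s)
  vel := fun i => IccExtend (C.knot_lt i).le ((Icc (C.knot i.castSucc) (C.knot i.succ)).domRestrict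
    fun s => tcoord b (C.toFun s) (C.velocity i s) / ((1 + inner ℝ (b 2) (C.toFun s) : ℝ) : ℂ))
  vel_continuous := fun i =>
    (continuousOn_iff_continuous_domRestrict.1 (continuousOn_stereoVelocity hq i)).Icc_extend'
  vel_ne_zero := by
    intro i s
    have hs := (projIcc (C.knot i.castSucc) (C.knot i.succ) (C.knot_lt i).le s).2
    refine div_ne_zero (tcoord_velocity_ne_zero hq i hs) ?_
    exact_mod_cast (height_pos_of_mem_piece hq (i := i) hs).ne'
  hasDeriv := by
    intro i s hs
    rw [IccExtend_of_mem _ _ hs]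
    exact hasDerivWithinAt_stereo (height_pos_of_mem_piece hq hs) (C.hasDerivWithinAt i hs) rfl
  closed := by rw [C.closed]
  simple := by
    intro s hs t ht hst
    have hs' : s ∈ Icc C.start C.finish := ⟨hs.1, hs.2.le⟩
    have ht' : t ∈ Icc C.start C.finish := ⟨ht.1, ht.2.le⟩
    exact C.simple hs ht (stereo_injOn b ⟨C.norm_toFun hs', ne_of_notMem_trace hq hs'⟩
      ⟨C.norm_toFun ht', ne_of_notMem_trace hq ht'⟩ hst)

theorem planeCurve_vel (hq : -b 2 ∉ C.trace) (i : Fin C.n) {s : ℝ} (hs : s ∈ C.piece i) :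
    (C.planeCurve b hq).vel i s =
      tcoord b (C.toFun s) (C.velocity i s) / ((1 + inner ℝ (b 2) (C.toFun s) : ℝ) : ℂ) := by
  exact IccExtend_of_mem (C.knot_lt i).le ((Icc (C.knot i.castSucc) (C.knot i.succ)).domRestrict
    fun s => tcoord b (C.toFun s) (C.velocity i s) / ((1 + inner ℝ (b 2) (C.toFun s) : ℝ) : ℂ)) hs

theorem stereo_mem_trace_iff (hq : -b 2 ∉ C.trace) {x : E3} (hx : ‖x‖ = 1) (hxq : x ≠ -b 2) :
    stereo b x ∈ (C.planeCurve b hq).trace ↔ x ∈ C.trace := by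
  constructor
  · rintro ⟨t, ht, h⟩
    have ht' : t ∈ Icc C.start C.finish := ht
    exact ⟨t, ht, stereo_injOn b ⟨C.norm_toFun ht', ne_of_notMem_trace hq ht'⟩ ⟨hx, hxq⟩ h⟩
  · rintro ⟨t, ht, rfl⟩
    exact ⟨t, ht, rfl⟩

/-! ### Winding numbers on the sphere -/

open Classical in
/-- The winding number of the stereographic image of the curve about the image of `x`. At the centre
of projection it is given the value `0`, which makes it locally constant there, too. -/
noncomputable def sphereWind (C : SimpleClosedSphereCurve) (b : OrthonormalBasis (Fin 3) ℝ E3)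
    (hq : -b 2 ∉ C.trace) (x : E3) : ℝ :=
  if x = -b 2 then 0 else (C.planeCurve b hq).wind (stereo b x)

theorem exists_int_sphereWind (hq : -b 2 ∉ C.trace) {x : E3} (hx : ‖x‖ = 1) (hxC : x ∉ C.trace) :
    ∃ k : ℤ, C.sphereWind b hq x = k := by
  rw [sphereWind]
  split_ifs with h
  · exact ⟨0, by simp⟩
  · exact PlaneCurve.exists_int_wind _ (by rwa [stereo_mem_trace_iff hq hx h])

theorem continuousWithinAt_sphereWind (hq : -b 2 ∉ C.trace) {x : E3} (hx : ‖x‖ = 1)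
    (hxC : x ∉ C.trace) :
    ContinuousWithinAt (C.sphereWind b hq) (Metric.sphere 0 1) x := by
  have key : ∀ᶠ y in 𝓝[Metric.sphere 0 1] x, C.sphereWind b hq y = C.sphereWind b hq x := by
    by_cases h : x = -b 2
    · obtain ⟨R, hR⟩ := (C.planeCurve b hq).exists_wind_eq_zero
      have h0 : 1 + inner ℝ (b 2) x = 0 := by
        rw [h, inner_neg_right, inner_basis]
        simp
      have hc : ContinuousAt (fun y : E3 => (1 + inner ℝ (b 2) y) * (1 + R ^ 2)) x := by fun_prop
      have h2 : ∀ᶠ y in 𝓝 x, (1 + inner ℝ (b 2) y) * (1 + R ^ 2) < 2 :=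
        hc.eventually (gt_mem_nhds (by simp only [h0]; norm_num))
      filter_upwards [mem_nhdsWithin_of_mem_nhds h2, self_mem_nhdsWithin] with y hy hyS
      have hyn : ‖y‖ = 1 := by simpa using hyS
      have hx0 : C.sphereWind b hq x = 0 := by rw [sphereWind, if_pos h]
      rw [hx0, sphereWind]
      split_ifs with h3
      · rfl
      · refine (hR _ ?_).2
        have h4 := one_add_inner_pos hyn h3
        have h5 := one_add_norm_sq_stereo hyn h4
        rw [eq_div_iff h4.ne'] at h5
        have h6 : R ^ 2 < ‖stereo b y‖ ^ 2 := by
          by_contra hcon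
          have := mul_le_mul_of_nonneg_right (not_lt.1 hcon) h4.le
          nlinarith
        exact lt_of_pow_lt_pow_left₀ 2 (norm_nonneg _) h6
    · have h1 : stereo b x ∉ (C.planeCurve b hq).trace := by rwa [stereo_mem_trace_iff hq hx h]
      have h2 := (continuousAt_stereo (one_add_inner_pos hx h)).eventually
        ((C.planeCurve b hq).eventually_wind_eq h1)
      filter_upwards [mem_nhdsWithin_of_mem_nhds h2,
        mem_nhdsWithin_of_mem_nhds (isOpen_ne.mem_nhds h)] with y hy hyne
      rw [sphereWind, sphereWind, if_neg h, if_neg hyne, hy]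
  exact (continuousWithinAt_const (b := C.sphereWind b hq x)).congr_of_eventuallyEq key rfl

/-- The winding number is constant on connected sets off the curve. -/
theorem sphereWind_eq_of_isPreconnected (hq : -b 2 ∉ C.trace) {S : Set E3} (hS : IsPreconnected S)
    (hSC : S ⊆ Metric.sphere (0 : E3) 1 \ C.trace) {x y : E3} (hx : x ∈ S) (hy : y ∈ S) :
    C.sphereWind b hq x = C.sphereWind b hq y := by
  have hn : ∀ z ∈ S, ‖z‖ = 1 := fun z hz => by simpa using (hSC hz).1
  have h1 := hS.eq_of_exp_mul_I_eq (h := fun z => 2 * π * C.sphereWind b hq z) (u := 1)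
    (continuousOn_const.mul fun z hz => (continuousWithinAt_sphereWind hq (hn z hz)
      (hSC hz).2).mono fun w hw => (hSC hw).1) (fun z hz => by
      obtain ⟨k, hk⟩ := exists_int_sphereWind hq (hn z hz) (hSC hz).2
      rw [hk, Complex.exp_eq_one_iff]
      exact ⟨k, by push_cast; ring⟩) hx hy
  exact mul_left_cancel₀ (by positivity) h1

end SimpleClosedSphereCurve

/-! ### Great circles -/

/-- The point of the unit sphere reached from `p` after travelling the distance `ε` in the
direction `u`. -/
noncomputable def greatArc (p u : E3) (ε : ℝ) : E3 := Real.cos ε • p + Real.sin ε • u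

section greatArc

variable {p u : E3}

theorem inner_greatArc (hp : ‖p‖ = 1) (hu : ‖u‖ = 1) (hpu : inner ℝ p u = 0) (ε δ : ℝ) :
    inner ℝ (greatArc p u ε) (greatArc p u δ) = Real.cos (ε - δ) := by
  simp only [greatArc, inner_add_left, inner_add_right, inner_smul_left, inner_smul_right,
    real_inner_self_eq_norm_sq, hp, hu, real_inner_comm p u, hpu, Real.cos_sub, conj_trivial]
  ring

theorem norm_greatArc (hp : ‖p‖ = 1) (hu : ‖u‖ = 1) (hpu : inner ℝ p u = 0) (ε : ℝ) :
    ‖greatArc p u ε‖ = 1 := by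
  have h := inner_greatArc hp hu hpu ε ε
  rw [sub_self, Real.cos_zero, real_inner_self_eq_norm_sq] at h
  exact (pow_eq_one_iff_of_nonneg (norm_nonneg _) two_ne_zero).1 h

theorem greatArc_zero : greatArc p u 0 = p := by simp [greatArc]

theorem continuous_greatArc : Continuous (greatArc p u) := by
  unfold greatArc
  fun_prop

theorem hasDerivAt_greatArc_zero : HasDerivAt (greatArc p u) u 0 := by
  have h := ((Real.hasDerivAt_cos 0).smul_const p).add ((Real.hasDerivAt_sin 0).smul_const u)
  simp only [Real.sin_zero, neg_zero, zero_smul, Real.cos_zero, one_smul, zero_add] at h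
  exact h

variable {b : OrthonormalBasis (Fin 3) ℝ E3}

theorem tendsto_slope_stereo_greatArc (h : 0 < 1 + inner ℝ (b 2) p) :
    Tendsto (fun ε : ℝ => (stereo b (greatArc p u ε) - stereo b p) / (ε : ℂ)) (𝓝[>] 0)
      (𝓝 (tcoord b p u / ((1 + inner ℝ (b 2) p : ℝ) : ℂ))) := by
  have h1 := hasDerivWithinAt_stereo (S := Ioi 0) h (hasDerivAt_greatArc_zero (p := p)
    (u := u)).hasDerivWithinAt greatArc_zero
  rw [hasDerivWithinAt_iff_tendsto_slope' (by simp)] at h1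
  refine h1.congr fun ε => ?_
  rw [slope_def_module, greatArc_zero, sub_zero, Complex.real_smul, Complex.ofReal_inv,
    div_eq_inv_mul]

end greatArc

theorem Complex.arg_sub_arg_neg_of_im_pos {z : ℂ} (hz : 0 < z.im) : arg z - arg (-z) = π := by
  rw [Complex.arg_neg_eq_arg_sub_pi_of_im_pos hz]
  ring

theorem Complex.arg_sub_arg_neg_of_im_neg {z : ℂ} (hz : z.im < 0) : arg z - arg (-z) = -π := by
  rw [Complex.arg_neg_eq_arg_add_pi_of_im_neg hz]
  ring

namespace SimpleClosedSphereCurve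

variable (C : SimpleClosedSphereCurve)

/-- The unit normal vector of the curve, pointing to its left. -/
noncomputable def leftNormal (i : Fin C.n) (s : ℝ) : E3 := cross (C.toFun s) (C.direction i s)

variable {C}

theorem inner_leftNormal (i : Fin C.n) (s : ℝ) : inner ℝ (C.toFun s) (C.leftNormal i s) = 0 :=
  inner_cross_self_left _ _

theorem inner_direction_leftNormal (i : Fin C.n) (s : ℝ) :
    inner ℝ (C.direction i s) (C.leftNormal i s) = 0 :=
  inner_cross_self_right _ _

theorem norm_leftNormal {i : Fin C.n} {s : ℝ} (hs : s ∈ C.piece i) : ‖C.leftNormal i s‖ = 1 := by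
  have h := inner_cross_cross (C.toFun s) (C.direction i s) (C.toFun s) (C.direction i s)
  rw [C.inner_direction i hs, real_inner_self_eq_norm_sq, real_inner_self_eq_norm_sq,
    real_inner_self_eq_norm_sq, C.norm_of_mem_piece hs, C.norm_direction i hs] at h
  rw [zero_mul, sub_zero, one_pow, one_mul] at h
  exact (pow_eq_one_iff_of_nonneg (norm_nonneg _) two_ne_zero).1 h

theorem hasDerivAt (i : Fin C.n) {s : ℝ} (hs : s ∈ Ioo (C.knot i.castSucc) (C.knot i.succ)) :
    HasDerivAt C.toFun (C.velocity i s) s :=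
  (C.hasDerivWithinAt i (Ioo_subset_Icc_self hs)).hasDerivAt (Icc_mem_nhds hs.1 hs.2)

/-- Points slightly to the right of an interior point of a smooth piece are off the curve: the
normal great circle meets the adjacent part of the curve only in its foot, and the rest of the curve is
compact. -/
theorem eventually_right_notMem_trace (i : Fin C.n) {s : ℝ}
    (hs : s ∈ Ioo (C.knot i.castSucc) (C.knot i.succ)) :
    ∀ᶠ ε : ℝ in 𝓝[>] 0, greatArc (C.toFun s) (-C.leftNormal i s) ε ∉ C.trace := by
  have hs' : s ∈ C.piece i := Ioo_subset_Icc_self hs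
  have hd : HasDerivAt (fun t => inner ℝ (C.toFun t) (C.direction i s))
      (inner ℝ (C.velocity i s) (C.direction i s)) s := by
    simpa using (C.hasDerivAt i hs).inner ℝ (hasDerivAt_const s (C.direction i s))
  have hne : inner ℝ (C.velocity i s) (C.direction i s) ≠ 0 := by
    rw [direction, inner_smul_right, real_inner_self_eq_norm_sq]
    have := C.norm_velocity_pos i hs'
    positivity
  have h1 : ∀ᶠ t in 𝓝 s, t ≠ s → inner ℝ (C.toFun t) (C.direction i s) ≠ 0 :=
    eventually_nhdsWithin_iff.1 (hd.eventually_ne (c := 0) hne)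
  obtain ⟨δ, hδ, hball⟩ := Metric.eventually_nhds_iff_ball.1 h1
  have hK : IsCompact (C.toFun '' (Icc C.start C.finish \ Metric.ball s δ)) :=
    (isCompact_Icc.diff Metric.isOpen_ball).image_of_continuousOn
      (C.continuousOn.mono sdiff_subset)
  have hsK : C.toFun s ∉ C.toFun '' (Icc C.start C.finish \ Metric.ball s δ) := by
    rintro ⟨t, ⟨ht, htb⟩, he⟩
    refine C.ne_of_mem_Ioo (C.Ioo_subset i hs) ht ?_ he
    rintro rfl
    exact htb (Metric.mem_ball_self hδ)
  have hto : Tendsto (greatArc (C.toFun s) (-C.leftNormal i s)) (𝓝[>] 0) (𝓝 (C.toFun s)) := by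
    have h : Tendsto (greatArc (C.toFun s) (-C.leftNormal i s)) (𝓝 0)
        (𝓝 (greatArc (C.toFun s) (-C.leftNormal i s) 0)) := continuous_greatArc.tendsto 0
    rw [greatArc_zero] at h
    exact h.mono_left nhdsWithin_le_nhds
  filter_upwards [hto.eventually (hK.isClosed.isOpen_compl.mem_nhds hsK),
    Ioo_mem_nhdsGT Real.pi_pos] with ε hε hεp
  rintro ⟨t, ht, he⟩
  by_cases hts : t = s
  · have h2 : inner ℝ (C.leftNormal i s) (C.toFun t) =
        inner ℝ (C.leftNormal i s) (greatArc (C.toFun s) (-C.leftNormal i s) ε) := by rw [he]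
    rw [hts, greatArc, inner_add_right, inner_smul_right, inner_smul_right,
      real_inner_comm (C.toFun s), inner_leftNormal, inner_neg_right, real_inner_self_eq_norm_sq,
      norm_leftNormal hs'] at h2
    have := Real.sin_pos_of_pos_of_lt_pi hεp.1 hεp.2
    linarith
  · by_cases htb : t ∈ Metric.ball s δ
    · apply hball t htb hts
      rw [he, greatArc, inner_add_left, inner_smul_left, inner_smul_left, C.inner_direction i hs',
        inner_neg_left, real_inner_comm, inner_direction_leftNormal]
      simp
    · exact hε ⟨t, ⟨ht, htb⟩, he⟩

variable {b : OrthonormalBasis (Fin 3) ℝ E3}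

/-- Transfer of statements about planar winding numbers along the stereographic image of a great
arc to the sphere. -/
theorem eventually_greatArc (hq : -b 2 ∉ C.trace) {s : ℝ} (hs : s ∈ Icc C.start C.finish) {u : E3}
    (hu : ‖u‖ = 1) (hpu : inner ℝ (C.toFun s) u = 0) {P : ℝ → ℝ → Prop}
    (h : ∀ᶠ ε in 𝓝[>] (0 : ℝ),
      stereo b (C.toFun s) +
          ε * ((stereo b (greatArc (C.toFun s) u ε) - stereo b (C.toFun s)) / (ε : ℂ)) ∉
            (C.planeCurve b hq).trace ∧
        P ε ((C.planeCurve b hq).wind (stereo b (C.toFun s) +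
          ε * ((stereo b (greatArc (C.toFun s) u ε) - stereo b (C.toFun s)) / (ε : ℂ))))) :
    ∀ᶠ ε in 𝓝[>] (0 : ℝ), greatArc (C.toFun s) u ε ∉ C.trace ∧
      P ε (C.sphereWind b hq (greatArc (C.toFun s) u ε)) := by
  have h1 : ∀ᶠ ε in 𝓝[>] (0 : ℝ), greatArc (C.toFun s) u ε ≠ -b 2 := by
    have h2 : Tendsto (greatArc (C.toFun s) u) (𝓝 0) (𝓝 (greatArc (C.toFun s) u 0)) :=
      continuous_greatArc.tendsto 0
    rw [greatArc_zero] at h2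
    exact (h2.mono_left nhdsWithin_le_nhds).eventually_ne (ne_of_notMem_trace hq hs)
  filter_upwards [h, h1, self_mem_nhdsWithin] with ε hε hne hpos
  have hε0 : (ε : ℂ) ≠ 0 := by exact_mod_cast (ne_of_gt hpos)
  rw [mul_div_cancel₀ _ hε0, add_sub_cancel,
    stereo_mem_trace_iff hq (norm_greatArc (C.norm_toFun hs) hu hpu ε) hne] at hε
  rwa [sphereWind, if_neg hne]

/-- Passing from the right to the left of the curve increases the winding number by one. -/
theorem eventually_sphereWind_normal (hb : cross (b 0) (b 1) = b 2) (hq : -b 2 ∉ C.trace) {κ : ℝ}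
    (hκ : ∀ i, ∀ s ∈ Ioo (C.knot i.castSucc) (C.knot i.succ), ∀ (E : ℝ → ℂ) (E₀ : ℂ),
      Tendsto E (𝓝[>] 0) (𝓝 E₀) → E₀ / (C.planeCurve b hq).vel i s ∈ Complex.slitPlane →
      -E₀ / (C.planeCurve b hq).vel i s ∈ Complex.slitPlane →
      ∀ᶠ ε in 𝓝[>] (0 : ℝ), stereo b (C.toFun s) + ε * E ε ∉ (C.planeCurve b hq).trace ∧
        2 * π * (C.planeCurve b hq).wind (stereo b (C.toFun s) + ε * E ε) =
          κ + Complex.arg (E ε / (C.planeCurve b hq).vel i s) -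
            Complex.arg (-E ε / (C.planeCurve b hq).vel i s))
    (i : Fin C.n) {s : ℝ} (hs : s ∈ Ioo (C.knot i.castSucc) (C.knot i.succ)) :
    (∀ᶠ ε in 𝓝[>] (0 : ℝ), greatArc (C.toFun s) (C.leftNormal i s) ε ∉ C.trace ∧
      2 * π * C.sphereWind b hq (greatArc (C.toFun s) (C.leftNormal i s) ε) = κ + π) ∧
    (∀ᶠ ε in 𝓝[>] (0 : ℝ), greatArc (C.toFun s) (-C.leftNormal i s) ε ∉ C.trace ∧
      2 * π * C.sphereWind b hq (greatArc (C.toFun s) (-C.leftNormal i s) ε) = κ - π) := by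
  have hs' : s ∈ C.piece i := Ioo_subset_Icc_self hs
  have hI := C.piece_subset i hs'
  have hpos := height_pos hq hI
  have hv := C.norm_velocity_pos i hs'
  have hN : tcoord b (C.toFun s) (C.leftNormal i s) / ((1 + inner ℝ (b 2) (C.toFun s) : ℝ) : ℂ) /
      (C.planeCurve b hq).vel i s = Complex.I * ((‖C.velocity i s‖⁻¹ : ℝ) : ℂ) := by
    have h1 := tcoord_velocity_ne_zero hq i hs'
    have h2 : ((1 + inner ℝ (b 2) (C.toFun s) : ℝ) : ℂ) ≠ 0 := by exact_mod_cast hpos.ne'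
    rw [planeCurve_vel hq i hs', leftNormal, tcoord_cross hb (C.norm_toFun hI) hpos
      (C.inner_direction i hs'), direction, tcoord_smul]
    field_simp
  have hre : (Complex.I * ((‖C.velocity i s‖⁻¹ : ℝ) : ℂ)).im = ‖C.velocity i s‖⁻¹ := by simp
  have hinv : 0 < ‖C.velocity i s‖⁻¹ := inv_pos.2 hv
  constructor
  · have hE := tendsto_slope_stereo_greatArc (u := C.leftNormal i s) hpos
    have h1 := hκ i s hs _ _ hE (by rw [hN]; right; rw [hre]; exact hinv.ne')
      (by rw [neg_div, hN]; right; rw [Complex.neg_im, hre]; exact (neg_neg_of_pos hinv).ne)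
    refine eventually_greatArc hq hI (norm_leftNormal hs') (inner_leftNormal i s)
      (P := fun _ W => 2 * π * W = κ + π) ?_
    have h2 : ∀ᶠ ε : ℝ in 𝓝[>] 0, 0 < ((stereo b (greatArc (C.toFun s) (C.leftNormal i s) ε) -
        stereo b (C.toFun s)) / (ε : ℂ) / (C.planeCurve b hq).vel i s).im := by
      have h3 := (Complex.continuous_im.tendsto _).comp
        (hE.div_const ((C.planeCurve b hq).vel i s))
      rw [hN, hre] at h3
      exact h3.eventually (lt_mem_nhds hinv)
    filter_upwards [h1, h2] with ε h3 h4
    refine ⟨h3.1, ?_⟩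
    have h5 := Complex.arg_sub_arg_neg_of_im_pos h4
    rw [h3.2, neg_div]
    linarith
  · have hE := tendsto_slope_stereo_greatArc (u := -C.leftNormal i s) hpos
    have hN' : tcoord b (C.toFun s) (-C.leftNormal i s) /
        ((1 + inner ℝ (b 2) (C.toFun s) : ℝ) : ℂ) /
        (C.planeCurve b hq).vel i s = -(Complex.I * ((‖C.velocity i s‖⁻¹ : ℝ) : ℂ)) := by
      rw [tcoord_neg, neg_div, neg_div, hN]
    have h1 := hκ i s hs _ _ hE
      (by rw [hN']; right; rw [Complex.neg_im, hre]; exact (neg_neg_of_pos hinv).ne)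
      (by rw [neg_div, hN']; right; rw [neg_neg, hre]; exact hinv.ne')
    refine eventually_greatArc hq hI (by rw [norm_neg, norm_leftNormal hs'])
      (by rw [inner_neg_right, inner_leftNormal, neg_zero])
      (P := fun _ W => 2 * π * W = κ - π) ?_
    have h2 : ∀ᶠ ε : ℝ in 𝓝[>] 0, ((stereo b (greatArc (C.toFun s) (-C.leftNormal i s) ε) -
        stereo b (C.toFun s)) / (ε : ℂ) / (C.planeCurve b hq).vel i s).im < 0 := by
      have h3 := (Complex.continuous_im.tendsto _).comp
        (hE.div_const ((C.planeCurve b hq).vel i s))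
      rw [hN', Complex.neg_im, hre] at h3
      exact h3.eventually (gt_mem_nhds (neg_neg_of_pos hinv))
    filter_upwards [h1, h2] with ε h3 h4
    refine ⟨h3.1, ?_⟩
    have h5 := Complex.arg_sub_arg_neg_of_im_neg h4
    rw [h3.2, neg_div]
    linarith

/-! ### Approaching the curve from its complement -/

/-- The points of a great arc that ends in `x` and is off the curve, except possibly at its initial
point, belong to the component of `x`. -/
theorem mem_connectedComponentIn_of_greatArc {x p u : E3} {θ : ℝ} (hp : ‖p‖ = 1) (hu : ‖u‖ = 1)
    (hpu : inner ℝ p u = 0) (hx : x = greatArc p u θ)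
    (h : ∀ ε ∈ Ioc 0 θ, greatArc p u ε ∉ C.trace) {ε : ℝ} (hε : ε ∈ Ioc 0 θ) :
    greatArc p u ε ∈ connectedComponentIn (Metric.sphere (0 : E3) 1 \ C.trace) x := by
  have h1 : IsPreconnected (greatArc p u '' Ioc 0 θ) :=
    isPreconnected_Ioc.image _ continuous_greatArc.continuousOn
  refine h1.subset_connectedComponentIn (x := x) ⟨θ, ⟨hε.1.trans_le hε.2, le_rfl⟩, hx.symm⟩ ?_
    ⟨ε, hε, rfl⟩
  rintro _ ⟨δ, hδ, rfl⟩
  exact ⟨by simpa using norm_greatArc hp hu hpu δ, h δ hδ⟩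

/-- If the point of the curve nearest to `x` is an interior point of a smooth piece, the shortest
arc from it to `x` is perpendicular to the curve, and it meets the curve only at its foot. -/
theorem exists_normal_of_nearest {x : E3} (hx : ‖x‖ = 1) (hxC : x ∉ C.trace) {i : Fin C.n} {s : ℝ}
    (hs : s ∈ Ioo (C.knot i.castSucc) (C.knot i.succ))
    (hmax : ∀ y ∈ C.trace, inner ℝ x y ≤ inner ℝ x (C.toFun s)) :
    ∃ u, (u = C.leftNormal i s ∨ u = -C.leftNormal i s) ∧
      ∀ᶠ ε in 𝓝[>] (0 : ℝ), greatArc (C.toFun s) u ε ∈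
        connectedComponentIn (Metric.sphere (0 : E3) 1 \ C.trace) x := by
  have hs' : s ∈ C.piece i := Ioo_subset_Icc_self hs
  have hI := C.piece_subset i hs'
  have hcs := C.norm_toFun hI
  have hd : inner ℝ x (C.velocity i s) = 0 := by
    have h1 : HasDerivAt (fun t => inner ℝ x (C.toFun t)) (inner ℝ x (C.velocity i s)) s := by
      simpa using (hasDerivAt_const s x).inner ℝ (C.hasDerivAt i hs)
    refine IsLocalMax.hasDerivAt_eq_zero (f := fun t => inner ℝ x (C.toFun t)) ?_ h1
    filter_upwards [Icc_mem_nhds hs.1 hs.2] with t ht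
    exact hmax _ ⟨t, C.piece_subset i ht, rfl⟩
  have hd' : inner ℝ x (C.direction i s) = 0 := by rw [direction, inner_smul_right, hd, mul_zero]
  set N := C.leftNormal i s with hNdef
  have hN : ‖N‖ = 1 := norm_leftNormal hs'
  have hcN : inner ℝ (C.toFun s) N = 0 := inner_leftNormal i s
  set A := inner ℝ x (C.toFun s) with hA
  set B := inner ℝ x N with hB
  -- The three vectors `c`, `d`, `N` form an orthonormal frame.
  have hxe : x = A • C.toFun s + B • N := by
    have h1 := E3.cross_cross x (C.toFun s) (C.direction i s)
    rw [hd', zero_smul, zero_sub] at h1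
    have h2 := congrArg (fun v => cross v N) h1
    have h3 : cross N (cross x N) = x - B • N := by
      rw [E3.cross_cross, real_inner_self_eq_norm_sq, hN, real_inner_comm]
      simp [hB]
    have h4 : cross x N = -(A • C.direction i s) := h1
    have h5 : cross N (C.direction i s) = -C.toFun s := by
      rw [cross_anticomm_E3, hNdef, leftNormal, E3.cross_cross, real_inner_self_eq_norm_sq,
        C.norm_direction i hs', real_inner_comm, C.inner_direction i hs']
      simp
    rw [h4, ← neg_smul, cross_smul_right, h5] at h3
    rw [smul_neg, neg_smul, neg_neg] at h3
    rw [h3]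
    abel
  have hAB : A ^ 2 + B ^ 2 = 1 := by
    have h1 : inner ℝ x x = A ^ 2 + B ^ 2 := by
      nth_rewrite 2 [hxe]
      rw [inner_add_right, inner_smul_right, inner_smul_right]
      ring
    rw [← h1, real_inner_self_eq_norm_sq, hx, one_pow]
  have hA1 : A < 1 := by
    refine lt_of_le_of_ne (by nlinarith) fun h => hxC ?_
    have : B = 0 := by nlinarith
    rw [hxe, h, this, one_smul, zero_smul, add_zero]
    exact ⟨s, hI, rfl⟩
  have hAm : -1 ≤ A := by nlinarith
  have hθ : 0 < Real.arccos A := Real.arccos_pos.2 hA1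
  have key : ∀ u : E3, ‖u‖ = 1 → inner ℝ (C.toFun s) u = 0 →
      x = greatArc (C.toFun s) u (Real.arccos A) → ∀ᶠ ε in 𝓝[>] (0 : ℝ),
      greatArc (C.toFun s) u ε ∈ connectedComponentIn (Metric.sphere (0 : E3) 1 \ C.trace) x := by
    intro u hu hcu hxu
    filter_upwards [Ioc_mem_nhdsGT hθ] with ε hε
    refine mem_connectedComponentIn_of_greatArc hcs hu hcu hxu (fun δ hδ hmem => ?_) hε
    have h1 := hmax _ hmem
    have h2 : inner ℝ x (greatArc (C.toFun s) u δ) = Real.cos (Real.arccos A - δ) := by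
      conv_lhs => rw [hxu]
      exact inner_greatArc hcs hu hcu _ _
    rw [h2] at h1
    have h3 : Real.cos (Real.arccos A) < Real.cos (Real.arccos A - δ) :=
      Real.cos_lt_cos_of_nonneg_of_le_pi (by linarith [hδ.2]) (Real.arccos_le_pi A)
        (by linarith [hδ.1])
    rw [Real.cos_arccos hAm hA1.le] at h3
    exact absurd h1 (not_le.2 h3)
  have hsin : Real.sin (Real.arccos A) = |B| := by
    rw [Real.sin_arccos, ← Real.sqrt_sq_eq_abs]
    congr 1
    linarith
  rcases le_total 0 B with hB0 | hB0
  · refine ⟨N, Or.inl rfl, key N hN hcN ?_⟩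
    rw [greatArc, hsin, Real.cos_arccos hAm hA1.le, abs_of_nonneg hB0, ← hxe]
  · refine ⟨-N, Or.inr rfl, key (-N) (by rw [norm_neg, hN]) (by rw [inner_neg_right, hcN, neg_zero])
      ?_⟩
    rw [greatArc, hsin, Real.cos_arccos hAm hA1.le, abs_of_nonpos hB0, smul_neg, neg_smul, neg_neg,
      ← hxe]

end SimpleClosedSphereCurve

namespace SimpleClosedSphereCurve

variable {C : SimpleClosedSphereCurve}

/-- Any two points of the sphere that are not vertices of the curve can be joined by a path avoiding
the vertices: the projection from a vertex turns this into a statement about the plane with finitely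
many points removed. -/
theorem exists_path_avoiding_vertices {x y : E3} (hx : ‖x‖ = 1) (hy : ‖y‖ = 1)
    (hxV : ∀ j, x ≠ C.toFun (C.knot j)) (hyV : ∀ j, y ≠ C.toFun (C.knot j)) :
    ∃ g : ℝ → E3, Continuous g ∧ g 0 = x ∧ g 1 = y ∧ ∀ t ∈ Icc (0 : ℝ) 1, ‖g t‖ = 1 ∧
      ∀ j, g t ≠ C.toFun (C.knot j) := by
  have h0 : ‖C.toFun (C.knot 0)‖ = 1 :=
    C.norm_toFun (left_mem_Icc.2 C.start_lt_finish.le)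
  obtain ⟨b, hb2, -⟩ := exists_orthonormalBasis_cross (n := -C.toFun (C.knot 0))
    (by rw [norm_neg, h0])
  have hpole : -b 2 = C.toFun (C.knot 0) := by rw [hb2, neg_neg]
  set S : Set ℂ := stereo b '' (range (fun j => C.toFun (C.knot j)) \ {-b 2}) with hS
  have hfin : S.Countable := (((finite_range _).subset sdiff_subset).image _).countable
  have hnot : ∀ z : E3, ‖z‖ = 1 → (∀ j, z ≠ C.toFun (C.knot j)) → stereo b z ∈ Sᶜ := by
    rintro z hz hzV ⟨p, ⟨⟨j, rfl⟩, hp⟩, he⟩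
    have hj : C.knot j ∈ Icc C.start C.finish :=
      ⟨C.knot_strictMono.monotone (Fin.zero_le _), C.knot_strictMono.monotone (Fin.le_last _)⟩
    exact hzV j (stereo_injOn b ⟨C.norm_toFun hj, hp⟩ ⟨hz, hpole ▸ hzV 0⟩ he).symm
  have hJ := (hfin.isPathConnected_compl_of_one_lt_rank (by
    rw [Complex.rank_real_complex]; exact Nat.one_lt_ofNat)).joinedIn _ (hnot x hx hxV) _
      (hnot y hy hyV)
  obtain ⟨γ, hγ⟩ := hJ
  refine ⟨fun t => unstereo b (γ.extend t), continuous_unstereo.comp γ.continuous_extend, ?_, ?_,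
    fun t ht => ⟨norm_unstereo _, fun j he => ?_⟩⟩
  · simp only [Path.extend_zero]
    exact unstereo_stereo hx (hpole ▸ hxV 0)
  · simp only [Path.extend_one]
    exact unstereo_stereo hy (hpole ▸ hyV 0)
  · have h1 := hγ ⟨t, ht⟩
    rw [← Path.extend_apply γ ht] at h1
    apply h1
    refine ⟨C.toFun (C.knot j), ⟨⟨j, rfl⟩, ?_⟩, ?_⟩
    · rw [← he]
      exact unstereo_ne _
    · rw [← he, stereo_unstereo]

/-- Every point off the curve can be moved, without meeting the curve, to a point whose nearest
point on the curve is not a vertex. -/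
theorem exists_nearest_not_vertex {x : E3} (hx : ‖x‖ = 1) (hxC : x ∉ C.trace) :
    ∃ y ∈ connectedComponentIn (Metric.sphere (0 : E3) 1 \ C.trace) x, ∃ i : Fin C.n,
      ∃ s ∈ Ioo (C.knot i.castSucc) (C.knot i.succ),
        ∀ z ∈ C.trace, inner ℝ y z ≤ inner ℝ y (C.toFun s) := by
  have hknot : ∀ j, C.knot j ∈ Icc C.start C.finish := fun j =>
    ⟨C.knot_strictMono.monotone (Fin.zero_le _), C.knot_strictMono.monotone (Fin.le_last _)⟩
  -- An interior point of the first piece serves as the end point of the path.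
  set i₀ : Fin C.n := ⟨0, C.n_pos⟩
  obtain ⟨m, hm⟩ := exists_between (C.knot_lt i₀)
  have hm' : m ∈ Ioo C.start C.finish := C.Ioo_subset i₀ hm
  have hmV : ∀ j, C.toFun m ≠ C.toFun (C.knot j) := by
    refine fun j he => C.ne_of_mem_Ioo hm' (hknot j) ?_ he.symm
    intro h
    have h1 := hm.1
    have h2 := hm.2
    rw [← h] at h1 h2
    have h3 := C.knot_strictMono.lt_iff_lt.1 h1
    have h4 := C.knot_strictMono.lt_iff_lt.1 h2
    rw [Fin.lt_def] at h3 h4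
    simp only [Fin.val_castSucc, Fin.val_succ] at h3 h4
    omega
  obtain ⟨g, hg, hg0, hg1, hgS⟩ := exists_path_avoiding_vertices (C := C) hx
    (C.norm_toFun (Ioo_subset_Icc_self hm')) (fun j h => hxC ⟨_, hknot j, h.symm⟩) hmV
  have hK : IsCompact (Icc (0 : ℝ) 1 ∩ g ⁻¹' C.trace) :=
    isCompact_Icc.inter_right (C.isCompact_trace.isClosed.preimage hg)
  obtain ⟨T, ⟨hT, hTC⟩, hTmin⟩ := hK.exists_isLeast
    ⟨1, right_mem_Icc.2 zero_le_one, by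
      rw [mem_preimage, hg1]; exact ⟨m, Ioo_subset_Icc_self hm', rfl⟩⟩
  have hT0 : 0 < T := by
    refine lt_of_le_of_ne hT.1 ?_
    rintro rfl
    rw [mem_preimage, hg0] at hTC
    exact hxC hTC
  have hV : (range fun j => C.toFun (C.knot j))ᶜ ∈ 𝓝 (g T) :=
    (finite_range _).isClosed.isOpen_compl.mem_nhds fun ⟨j, hj⟩ => (hgS T hT).2 j hj.symm
  obtain ⟨r, hr, hrV⟩ := Metric.mem_nhds_iff.1 hV
  have hclose : ∀ᶠ t in 𝓝[<] T, dist (g t) (g T) < r / 2 :=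
    (hg.tendsto T).mono_left nhdsWithin_le_nhds (Metric.ball_mem_nhds _ (half_pos hr))
  obtain ⟨t, ht1, ht2⟩ := (hclose.and (Ioo_mem_nhdsLT hT0)).exists
  have hsub : ∀ t' ∈ Icc 0 t, g t' ∈ Metric.sphere (0 : E3) 1 \ C.trace := fun t' ht' => by
    have h01 : t' ∈ Icc (0 : ℝ) 1 := ⟨ht'.1, ht'.2.trans (ht2.2.le.trans hT.2)⟩
    refine ⟨by simpa using (hgS t' h01).1, fun hC => ?_⟩
    exact absurd (hTmin ⟨h01, hC⟩) (not_le.2 (ht'.2.trans_lt ht2.2))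
  have htI : t ∈ Icc (0 : ℝ) t := ⟨ht2.1.le, le_rfl⟩
  have hy1 : ‖g t‖ = 1 := by simpa using (hsub t htI).1
  refine ⟨g t, ?_, ?_⟩
  · refine (isPreconnected_Icc.image g hg.continuousOn).subset_connectedComponentIn
      (x := x) ⟨0, left_mem_Icc.2 ht2.1.le, hg0⟩ ?_ ⟨t, htI, rfl⟩
    rintro _ ⟨t', ht', rfl⟩
    exact hsub t' ht'
  · obtain ⟨_, ⟨s, hs, rfl⟩, hmax⟩ := C.isCompact_trace.exists_isMaxOn ⟨_, hTC⟩
      (f := fun z => inner ℝ (g t) z) (by fun_prop)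
    have hmax' : ∀ z ∈ C.trace, inner ℝ (g t) z ≤ inner ℝ (g t) (C.toFun s) := hmax
    have hsV : ∀ j, C.toFun s ≠ C.toFun (C.knot j) := by
      have h1 := hmax' _ hTC
      have h2 := norm_sub_sq_real (g t) (C.toFun s)
      have h3 := norm_sub_sq_real (g t) (g T)
      rw [hy1, C.norm_toFun hs] at h2
      rw [hy1, (hgS T hT).1] at h3
      have h4 : ‖g t - C.toFun s‖ ≤ ‖g t - g T‖ :=
        (sq_le_sq₀ (norm_nonneg _) (norm_nonneg _)).1 (by linarith)
      rw [← dist_eq_norm, ← dist_eq_norm] at h4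
      have h5 : dist (C.toFun s) (g T) < r := by
        have := dist_triangle_left (C.toFun s) (g T) (g t)
        linarith
      intro j hj
      exact hrV (Metric.mem_ball.2 h5) ⟨j, hj.symm⟩
    obtain ⟨i, hi⟩ := exists_mem_Icc_knot C.knot C.knot_strictMono C.n_pos hs
    refine ⟨i, s, ⟨lt_of_le_of_ne hi.1 ?_, lt_of_le_of_ne hi.2 ?_⟩, hmax'⟩
    · rintro rfl
      exact hsV _ rfl
    · rintro rfl
      exact hsV _ rfl

/-- Every point off the curve is connected, off the curve, to all points immediately to the left or
to all points immediately to the right of some interior point of a smooth piece. -/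
theorem exists_eventually_mem_connectedComponentIn {x : E3} (hx : ‖x‖ = 1) (hxC : x ∉ C.trace) :
    ∃ i : Fin C.n, ∃ s ∈ Ioo (C.knot i.castSucc) (C.knot i.succ), ∃ u,
      (u = C.leftNormal i s ∨ u = -C.leftNormal i s) ∧
      ∀ᶠ ε in 𝓝[>] (0 : ℝ), greatArc (C.toFun s) u ε ∈
        connectedComponentIn (Metric.sphere (0 : E3) 1 \ C.trace) x := by
  obtain ⟨y, hy, i, s, hs, hmax⟩ := exists_nearest_not_vertex hx hxC
  have hyC := connectedComponentIn_subset _ _ hy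
  obtain ⟨u, hu, h⟩ := exists_normal_of_nearest (by simpa using hyC.1) hyC.2 hs hmax
  refine ⟨i, s, hs, u, hu, ?_⟩
  rwa [connectedComponentIn_eq hy]

/-! ### The enclosed region and the winding number -/

theorem enclosedRegion_subset : C.enclosedRegion ⊆ Metric.sphere (0 : E3) 1 \ C.trace := by
  rintro x ⟨i, s, -, h⟩
  obtain ⟨ε, hε⟩ := h.exists
  exact connectedComponentIn_nonempty_iff.1 ⟨_, hε⟩

/-- If the sphere is projected from a point just to the right of the curve, then the rotation of the
plane curve is `2π`, and the enclosed region is the set of points with winding number one, all other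
points having winding number zero. -/
theorem exists_adapted_basis (C : SimpleClosedSphereCurve) :
    ∃ (b : OrthonormalBasis (Fin 3) ℝ E3) (hq : -b 2 ∉ C.trace) (ψ : Fin C.n → ℝ → ℝ)
      (J : Fin C.n → ℝ), cross (b 0) (b 1) = b 2 ∧
    (∀ i, IsAngleOn (ψ i) ((C.planeCurve b hq).vel i) (C.piece i)) ∧
    (∑ i, (ψ i (C.knot i.succ) - ψ i (C.knot i.castSucc)) + ∑ i, J i = 2 * π) ∧
    (∀ i (E : ℝ → ℂ) (E₀ : ℂ), Tendsto E (𝓝[>] 0) (𝓝 E₀) →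
      E₀ / (C.planeCurve b hq).vel i (C.knot i.succ) ∈ Complex.slitPlane →
      -E₀ / (C.planeCurve b hq).vel (finRotate C.n i) (C.knot (finRotate C.n i).castSucc) ∈
        Complex.slitPlane →
      ∀ᶠ ε in 𝓝[>] (0 : ℝ),
        stereo b (C.toFun (C.knot i.succ)) + ε * E ε ∉ (C.planeCurve b hq).trace ∧
        2 * π * (C.planeCurve b hq).wind (stereo b (C.toFun (C.knot i.succ)) + ε * E ε) =
          π - J i + Complex.arg (E ε / (C.planeCurve b hq).vel i (C.knot i.succ)) -
            Complex.arg (-E ε / (C.planeCurve b hq).vel (finRotate C.n i)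
              (C.knot (finRotate C.n i).castSucc))) ∧
    ∀ x, ‖x‖ = 1 → x ∉ C.trace →
      (C.sphereWind b hq x = 1 ∧ x ∈ C.enclosedRegion) ∨
      (C.sphereWind b hq x = 0 ∧ x ∉ C.enclosedRegion) := by
  set i₀ : Fin C.n := ⟨0, C.n_pos⟩
  obtain ⟨s₀, hs₀⟩ := exists_between (C.knot_lt i₀)
  have hs₀' : s₀ ∈ C.piece i₀ := Ioo_subset_Icc_self hs₀
  obtain ⟨δ, hδ, hδC⟩ := mem_nhdsGT_iff_exists_Ioc_subset.1 (C.eventually_right_notMem_trace i₀ hs₀)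
  have hδ0 : 0 < δ := hδ
  have hu : ‖-C.leftNormal i₀ s₀‖ = 1 := by rw [norm_neg, norm_leftNormal hs₀']
  have hpu : inner ℝ (C.toFun s₀) (-C.leftNormal i₀ s₀) = 0 := by
    rw [inner_neg_right, inner_leftNormal, neg_zero]
  have hp := C.norm_of_mem_piece hs₀'
  set q := greatArc (C.toFun s₀) (-C.leftNormal i₀ s₀) δ with hqdef
  have hqn : ‖q‖ = 1 := norm_greatArc hp hu hpu δ
  obtain ⟨b, hb2, hb⟩ := exists_orthonormalBasis_cross (n := -q) (by rw [norm_neg, hqn])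
  have hbq : -b 2 = q := by rw [hb2, neg_neg]
  have hq : -b 2 ∉ C.trace := by rw [hbq]; exact hδC ⟨hδ0, le_rfl⟩
  obtain ⟨κ, ψ, J, hψ, hsum, hsmooth, hcorner⟩ := (C.planeCurve b hq).exists_rotation_data
  have hnormal := fun i s hs =>
    eventually_sphereWind_normal hb hq (κ := κ) hsmooth i (s := s) hs
  have hκ : κ = π := by
    obtain ⟨ε, ⟨-, hε⟩, hεδ⟩ := ((hnormal i₀ s₀ hs₀).2.and (Ioc_mem_nhdsGT hδ0)).exists
    have h1 := mem_connectedComponentIn_of_greatArc hp hu hpu hqdef (fun ε hε => hδC hε) hεδ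
    have hqS : q ∈ Metric.sphere (0 : E3) 1 \ C.trace := ⟨by simpa using hqn, hbq ▸ hq⟩
    have h2 := sphereWind_eq_of_isPreconnected hq isPreconnected_connectedComponentIn
      (connectedComponentIn_subset _ _) h1 (mem_connectedComponentIn hqS)
    have h3 : C.sphereWind b hq q = 0 := by rw [sphereWind, if_pos hbq.symm]
    rw [h2, h3] at hε
    linarith
  subst hκ
  refine ⟨b, hq, ψ, J, hb, hψ, hsum, hcorner, fun x hx hxC => ?_⟩
  have hxS : x ∈ Metric.sphere (0 : E3) 1 \ C.trace := ⟨by simpa using hx, hxC⟩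
  have hconst : ∀ y ∈ connectedComponentIn (Metric.sphere (0 : E3) 1 \ C.trace) x,
      C.sphereWind b hq y = C.sphereWind b hq x := fun y hy =>
    sphereWind_eq_of_isPreconnected hq isPreconnected_connectedComponentIn
      (connectedComponentIn_subset _ _) hy (mem_connectedComponentIn hxS)
  have hone : x ∈ C.enclosedRegion → C.sphereWind b hq x = 1 := by
    rintro ⟨i, s, hs, h⟩
    obtain ⟨ε, hε, hε'⟩ := (h.and (hnormal i s hs).1).exists
    have h1 := hε'.2
    rw [show C.sphereWind b hq (greatArc (C.toFun s) (C.leftNormal i s) ε) =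
      C.sphereWind b hq x from hconst _ hε] at h1
    have := Real.pi_pos
    nlinarith
  obtain ⟨i, s, hs, u, hu, h⟩ := exists_eventually_mem_connectedComponentIn hx hxC
  rcases hu with rfl | rfl
  · have hmem : x ∈ C.enclosedRegion := ⟨i, s, hs, h⟩
    exact Or.inl ⟨hone hmem, hmem⟩
  · obtain ⟨ε, hε, hε'⟩ := (h.and (hnormal i s hs).2).exists
    have h1 := hε'.2
    rw [hconst _ hε, sub_self] at h1
    have h2 : C.sphereWind b hq x = 0 := by
      have := Real.pi_pos
      nlinarith
    refine Or.inr ⟨h2, fun hmem => ?_⟩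
    rw [hone hmem] at h2
    exact one_ne_zero h2

end SimpleClosedSphereCurve

/-! ### Turning angles -/

theorem Complex.arg_real_mul_exp {r : ℝ} (hr : 0 < r) {θ : ℝ} (hθ : θ ∈ Ioc (-π) π) :
    arg (r * exp (θ * I)) = θ := by
  rw [exp_mul_I, arg_mul_cos_add_sin_mul_I hr hθ]

theorem Complex.real_mul_exp_mem_slitPlane {r : ℝ} (hr : 0 < r) {θ : ℝ} (hθ : θ ∈ Ioo (-π) π) :
    (r * exp (θ * I) : ℂ) ∈ slitPlane := by
  rw [mem_slitPlane_iff_arg, arg_real_mul_exp hr (Ioo_subset_Ioc_self hθ)]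
  exact ⟨hθ.2.ne, mul_ne_zero (by exact_mod_cast hr.ne') (exp_ne_zero _)⟩

/-- Let a corner with incoming direction `d₁` and outgoing direction `d₂` be given. If the numbers
`w` attached to the directions `E₀` on either side of the corner all are `0` or `1`, then `J` is the
angle from `d₁` to `d₂`. -/
theorem eq_arg_of_corner {d₁ d₂ : ℂ} (h₁ : d₁ ≠ 0) (h₂ : d₂ ≠ 0) (hπ : Complex.arg (d₂ / d₁) ≠ π)
    {J : ℝ} (h : ∀ E₀ : ℂ, E₀ / d₁ ∈ Complex.slitPlane → -E₀ / d₂ ∈ Complex.slitPlane →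
      ∃ w : ℝ, (w = 0 ∨ w = 1) ∧
        2 * π * w = π - J + Complex.arg (E₀ / d₁) - Complex.arg (-E₀ / d₂)) :
    J = Complex.arg (d₂ / d₁) := by
  set τ := Complex.arg (d₂ / d₁) with hτ
  set ρ := ‖d₂ / d₁‖ with hρ
  have hρ0 : 0 < ρ := norm_pos_iff.2 (div_ne_zero h₂ h₁)
  have hτ1 : -π < τ := Complex.neg_pi_lt_arg _
  have hτ2 : τ < π := lt_of_le_of_ne (Complex.arg_le_pi _) hπ
  have hd : d₂ = d₁ * (ρ * Complex.exp (τ * Complex.I)) := by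
    rw [hρ, hτ, Complex.norm_mul_exp_arg_mul_I, mul_div_cancel₀ _ h₁]
  have hpos := Real.pi_pos
  have hρc : (ρ : ℂ) ≠ 0 := by exact_mod_cast hρ0.ne'
  -- The direction `d₁ * exp (β * I)` with `β` beyond `τ` or before `τ`; `σ` is the sign of `τ - β`,
  -- chosen such that `β - τ + σ * π`, the angle from `d₂` to the reversed direction, is a principal
  -- value.
  have key : ∀ β σ : ℝ, β ∈ Ioo (-π) π → (σ = 1 ∨ σ = -1) → β - τ + σ * π ∈ Ioo (-π) π →
      ∃ w : ℝ, (w = 0 ∨ w = 1) ∧ 2 * π * w = π - J + β - (β - τ + σ * π) := by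
    intro β σ hβ hσ hβτ
    have e1 : d₁ * Complex.exp (β * Complex.I) / d₁ =
        ((1 : ℝ) : ℂ) * Complex.exp (β * Complex.I) := by
      rw [mul_div_cancel_left₀ _ h₁, Complex.ofReal_one, one_mul]
    have hneg : Complex.exp (σ * π * Complex.I) = -1 := by
      rcases hσ with rfl | rfl
      · simp
      · rw [Complex.ofReal_neg, Complex.ofReal_one, neg_one_mul, neg_mul, Complex.exp_neg,
          Complex.exp_pi_mul_I]
        norm_num
    have e2 : -(d₁ * Complex.exp (β * Complex.I)) / d₂ =
        ((ρ⁻¹ : ℝ) : ℂ) * Complex.exp ((β - τ + σ * π : ℝ) * Complex.I) := by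
      have : ((β - τ + σ * π : ℝ) : ℂ) * Complex.I =
          β * Complex.I - τ * Complex.I + σ * π * Complex.I := by
        push_cast
        ring
      rw [this, Complex.exp_add, Complex.exp_sub, hneg, hd]
      have := Complex.exp_ne_zero (τ * Complex.I)
      push_cast
      field_simp
    obtain ⟨w, hw, hw'⟩ := h (d₁ * Complex.exp (β * Complex.I))
      (by rw [e1]; exact Complex.real_mul_exp_mem_slitPlane one_pos hβ)
      (by rw [e2]; exact Complex.real_mul_exp_mem_slitPlane (inv_pos.2 hρ0) hβτ)
    rw [e1, e2, Complex.arg_real_mul_exp one_pos (Ioo_subset_Ioc_self hβ),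
      Complex.arg_real_mul_exp (inv_pos.2 hρ0) (Ioo_subset_Ioc_self hβτ)] at hw'
    exact ⟨w, hw, hw'⟩
  obtain ⟨w₁, hw₁, h1⟩ := key ((τ + π) / 2) (-1) ⟨by linarith, by linarith⟩ (Or.inr rfl)
    ⟨by linarith, by linarith⟩
  obtain ⟨w₂, hw₂, h2⟩ := key ((τ - π) / 2) 1 ⟨by linarith, by linarith⟩ (Or.inl rfl)
    ⟨by linarith, by linarith⟩
  rcases hw₁ with rfl | rfl <;> rcases hw₂ with rfl | rfl <;> linarith

namespace SimpleClosedSphereCurve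

variable {C : SimpleClosedSphereCurve}

theorem toFun_castSucc_finRotate (i : Fin C.n) :
    C.toFun (C.knot (finRotate C.n i).castSucc) = C.toFun (C.knot i.succ) := by
  rcases castSucc_finRotate i with h | ⟨h1, h2⟩
  · rw [h]
  · rw [h1, h2, C.closed]

variable {b : OrthonormalBasis (Fin 3) ℝ E3}

/-- The velocity of the plane curve is a positive multiple of the coordinate of the direction of the
curve. -/
theorem exists_pos_planeCurve_vel (hq : -b 2 ∉ C.trace) (i : Fin C.n) {s : ℝ}
    (hs : s ∈ C.piece i) : ∃ r : ℝ, 0 < r ∧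
      (C.planeCurve b hq).vel i s = r * tcoord b (C.toFun s) (C.direction i s) := by
  have hv := C.norm_velocity_pos i hs
  have hh := height_pos_of_mem_piece hq hs
  refine ⟨‖C.velocity i s‖ / (1 + inner ℝ (b 2) (C.toFun s)), div_pos hv hh, ?_⟩
  rw [planeCurve_vel hq i hs, direction, tcoord_smul]
  have h1 : (‖C.velocity i s‖ : ℂ) ≠ 0 := by exact_mod_cast hv.ne'
  have h2 : ((1 + inner ℝ (b 2) (C.toFun s) : ℝ) : ℂ) ≠ 0 := by exact_mod_cast hh.ne'
  rw [Complex.ofReal_div, Complex.ofReal_inv]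
  field_simp

/-- The jump `J` of the angle of the tangent at a vertex is the turning angle. -/
theorem turningAngle_eq (hb : cross (b 0) (b 1) = b 2) (hq : -b 2 ∉ C.trace) {J : ℝ} (i : Fin C.n)
    (hcorner : ∀ (E : ℝ → ℂ) (E₀ : ℂ), Tendsto E (𝓝[>] 0) (𝓝 E₀) →
      E₀ / (C.planeCurve b hq).vel i (C.knot i.succ) ∈ Complex.slitPlane →
      -E₀ / (C.planeCurve b hq).vel (finRotate C.n i) (C.knot (finRotate C.n i).castSucc) ∈
        Complex.slitPlane →
      ∀ᶠ ε in 𝓝[>] (0 : ℝ),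
        stereo b (C.toFun (C.knot i.succ)) + ε * E ε ∉ (C.planeCurve b hq).trace ∧
        2 * π * (C.planeCurve b hq).wind (stereo b (C.toFun (C.knot i.succ)) + ε * E ε) =
          π - J + Complex.arg (E ε / (C.planeCurve b hq).vel i (C.knot i.succ)) -
            Complex.arg (-E ε / (C.planeCurve b hq).vel (finRotate C.n i)
              (C.knot (finRotate C.n i).castSucc)))
    (hregion : ∀ x, ‖x‖ = 1 → x ∉ C.trace →
      (C.sphereWind b hq x = 1 ∧ x ∈ C.enclosedRegion) ∨
      (C.sphereWind b hq x = 0 ∧ x ∉ C.enclosedRegion)) :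
    C.turningAngle i = J := by
  set j := finRotate C.n i with hj
  have hpi := C.right_mem_piece i
  have hpj := C.left_mem_piece j
  have hcj : C.toFun (C.knot j.castSucc) = C.toFun (C.knot i.succ) := toFun_castSucc_finRotate i
  have hI := C.piece_subset i hpi
  have hp1 := C.norm_toFun hI
  have hpos := height_pos hq hI
  obtain ⟨r₁, hr₁, hv₁⟩ := exists_pos_planeCurve_vel hq i hpi
  obtain ⟨r₂, hr₂, hv₂⟩ := exists_pos_planeCurve_vel hq j hpj
  rw [hcj] at hv₂
  rw [hv₁, hv₂] at hcorner
  have hB : inner ℝ (C.toFun (C.knot i.succ)) (C.directionBefore i) = 0 := C.inner_direction i hpi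
  have hA : inner ℝ (C.toFun (C.knot i.succ)) (C.directionAfter i) = 0 := by
    rw [← hcj]
    exact C.inner_direction j hpj
  have hBn : ‖C.directionBefore i‖ = 1 := C.norm_direction i hpi
  have hAn : ‖C.directionAfter i‖ = 1 := C.norm_direction j hpj
  change ∀ (E : ℝ → ℂ) (E₀ : ℂ), Tendsto E (𝓝[>] 0) (𝓝 E₀) →
    E₀ / (r₁ * tcoord b (C.toFun (C.knot i.succ)) (C.directionBefore i)) ∈ Complex.slitPlane →
    -E₀ / (r₂ * tcoord b (C.toFun (C.knot i.succ)) (C.directionAfter i)) ∈ Complex.slitPlane →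
      ∀ᶠ ε in 𝓝[>] (0 : ℝ),
        stereo b (C.toFun (C.knot i.succ)) + ε * E ε ∉ (C.planeCurve b hq).trace ∧
        2 * π * (C.planeCurve b hq).wind (stereo b (C.toFun (C.knot i.succ)) + ε * E ε) =
          π - J + Complex.arg (E ε / (r₁ * tcoord b (C.toFun (C.knot i.succ))
            (C.directionBefore i))) - Complex.arg (-E ε / (r₂ * tcoord b (C.toFun (C.knot i.succ))
              (C.directionAfter i))) at hcorner
  have hconj := conj_tcoord_mul hb hp1 hpos hB hA
  have htBn := norm_tcoord hp1 hpos hB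
  have htAn := norm_tcoord hp1 hpos hA
  rw [hBn] at htBn
  rw [hAn] at htAn
  set B := tcoord b (C.toFun (C.knot i.succ)) (C.directionBefore i) with hBdef
  set A := tcoord b (C.toFun (C.knot i.succ)) (C.directionAfter i) with hAdef
  have hB0 : B ≠ 0 := norm_ne_zero_iff.1 (by rw [htBn]; exact one_ne_zero)
  have hA0 : A ≠ 0 := norm_ne_zero_iff.1 (by rw [htAn]; exact one_ne_zero)
  have hr₁c : (r₁ : ℂ) ≠ 0 := by exact_mod_cast hr₁.ne'
  have hr₂c : (r₂ : ℂ) ≠ 0 := by exact_mod_cast hr₂.ne'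
  have hcusp : C.directionAfter i = -C.directionBefore i ↔ A = -B := by
    rw [hAdef, hBdef, ← tcoord_neg]
    exact ⟨fun h => by rw [h], fun h => eq_of_tcoord_eq hp1 hpos hA
      (by rw [inner_neg_right, hB, neg_zero]) h⟩
  -- At a cusp, consider the points ahead of the arriving curve.
  have hahead : A = -B → ∀ᶠ ε in 𝓝[>] (0 : ℝ),
      greatArc (C.toFun (C.knot i.succ)) (C.directionBefore i) ε ∉ C.trace ∧
      2 * π * C.sphereWind b hq (greatArc (C.toFun (C.knot i.succ)) (C.directionBefore i) ε) =
        π - J := by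
    intro hAB
    have hE := tendsto_slope_stereo_greatArc (u := C.directionBefore i) hpos
    rw [← hBdef] at hE
    have hhc : ((1 + inner ℝ (b 2) (C.toFun (C.knot i.succ)) : ℝ) : ℂ) ≠ 0 := by
      exact_mod_cast hpos.ne'
    have e1 : ∀ r : ℝ, 0 < r → B / ((1 + inner ℝ (b 2) (C.toFun (C.knot i.succ)) : ℝ) : ℂ) /
        (r * B) ∈ Complex.slitPlane := by
      intro r hr
      have hrc : (r : ℂ) ≠ 0 := by exact_mod_cast hr.ne'
      have : B / ((1 + inner ℝ (b 2) (C.toFun (C.knot i.succ)) : ℝ) : ℂ) / (r * B) =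
          (((1 + inner ℝ (b 2) (C.toFun (C.knot i.succ))) * r)⁻¹ : ℝ) := by
        push_cast at hhc ⊢
        field_simp
      rw [this, Complex.ofReal_mem_slitPlane]
      positivity
    have h := hcorner _ _ hE (e1 r₁ hr₁)
      (by rw [hAB, mul_neg, neg_div_neg_eq]; exact e1 r₂ hr₂)
    have harg : ∀ (z : ℂ) (r : ℝ), 0 < r → Complex.arg (z / (r * B)) = Complex.arg (z / B) := by
      intro z r hr
      rw [div_mul_eq_div_div_swap, div_eq_mul_inv, ← Complex.ofReal_inv,
        Complex.arg_mul_real (inv_pos.2 hr)]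
    refine eventually_greatArc hq hI hBn hB (P := fun _ W => 2 * π * W = π - J) ?_
    filter_upwards [h] with ε hε
    refine ⟨hε.1, ?_⟩
    rw [hε.2, hAB, mul_neg, neg_div_neg_eq, harg _ r₁ hr₁, harg _ r₂ hr₂]
    ring
  have hval : ∀ ε, greatArc (C.toFun (C.knot i.succ)) (C.directionBefore i) ε ∉ C.trace →
      _ := fun ε hε => hregion _ (norm_greatArc hp1 hBn hB ε) hε
  rw [turningAngle]
  split_ifs with h1 h2
  · obtain ⟨ε, ⟨hε, hε'⟩, hmem⟩ := ((hahead (hcusp.1 h1)).and h2).exists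
    rcases hval ε hε with ⟨hw, -⟩ | ⟨-, hnot⟩
    · rw [hw] at hε'
      linarith
    · exact absurd hmem hnot
  · obtain ⟨ε, hnot, hε, hε'⟩ :=
      ((not_eventually.1 h2).and_eventually (hahead (hcusp.1 h1))).exists
    rcases hval ε hε with ⟨-, hmem⟩ | ⟨hw, -⟩
    · exact absurd hmem hnot
    · rw [hw] at hε'
      linarith
  · rw [hcusp] at h1
    have hdiv : r₂ * A / (r₁ * B) = ((r₂ / r₁ : ℝ) : ℂ) * ((starRingEnd ℂ) B * A) := by
      have : (starRingEnd ℂ) B = B⁻¹ := by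
        rw [Complex.inv_def, Complex.normSq_eq_norm_sq, htBn]
        simp
      rw [this]
      push_cast
      field_simp
    have harg : Complex.arg (r₂ * A / (r₁ * B)) = Complex.arg
        ⟨inner ℝ (C.directionBefore i) (C.directionAfter i),
          inner ℝ (cross (C.toFun (C.knot i.succ)) (C.directionBefore i))
            (C.directionAfter i)⟩ := by
      rw [hdiv, Complex.arg_real_mul _ (div_pos hr₂ hr₁), hconj]
    rw [← harg]
    refine (eq_arg_of_corner (mul_ne_zero hr₁c hB0) (mul_ne_zero hr₂c hA0) (fun h => h1 ?_)
      fun E₀ hE₁ hE₂ => ?_).symm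
    · rw [hdiv, Complex.arg_real_mul _ (div_pos hr₂ hr₁)] at h
      have h3 := Complex.norm_mul_exp_arg_mul_I ((starRingEnd ℂ) B * A)
      rw [h, Complex.exp_pi_mul_I, norm_mul, Complex.norm_conj, htBn, htAn] at h3
      have h4 : B * (starRingEnd ℂ) B = 1 := by
        rw [Complex.mul_conj, Complex.normSq_eq_norm_sq, htBn]
        simp
      calc A = B * (starRingEnd ℂ) B * A := by rw [h4, one_mul]
        _ = B * ((starRingEnd ℂ) B * A) := by ring
        _ = -B := by rw [← h3]; simp
    · obtain ⟨ε, hε, hε'⟩ := (hcorner (fun _ => E₀) E₀ tendsto_const_nhds hE₁ hE₂).exists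
      refine ⟨_, ?_, hε'⟩
      set z := stereo b (C.toFun (C.knot i.succ)) + ε * E₀
      have h3 : unstereo b z ∉ C.trace := by
        rw [← stereo_mem_trace_iff hq (norm_unstereo z) (unstereo_ne z), stereo_unstereo]
        exact hε
      have h4 := hregion _ (norm_unstereo z) h3
      rw [sphereWind, if_neg (unstereo_ne z), stereo_unstereo] at h4
      exact h4.symm.imp And.left And.left

end SimpleClosedSphereCurve

/-! ### Parallel transport in stereographic coordinates -/

theorem tcoord_self {b : OrthonormalBasis (Fin 3) ℝ E3} {p : E3} (h : 0 < 1 + inner ℝ (b 2) p) :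
    tcoord b p p = stereo b p := by
  have h0 : ((1 + inner ℝ (b 2) p : ℝ) : ℂ) ≠ 0 := by exact_mod_cast h.ne'
  have h1 : stereo b p * ((1 + inner ℝ (b 2) p : ℝ) : ℂ) =
      ((inner ℝ (b 0) p : ℝ) : ℂ) + ((inner ℝ (b 1) p : ℝ) : ℂ) * Complex.I := by
    rw [stereo, div_mul_cancel₀ _ h0]
  rw [tcoord, ← h1]
  push_cast
  ring

/-- The angular velocity of parallel vectors along a plane curve, with respect to the metric of the
sphere in stereographic coordinates. -/
noncomputable def PlaneCurve.transport (Γ : PlaneCurve) (i : Fin Γ.n) (t : ℝ) : ℝ :=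
  2 * ((starRingEnd ℂ) (Γ.toFun t) * Γ.vel i t).im / (1 + ‖Γ.toFun t‖ ^ 2)

theorem PlaneCurve.continuousOn_transport (Γ : PlaneCurve) (i : Fin Γ.n) :
    ContinuousOn (Γ.transport i) (Γ.piece i) := by
  have h1 : ContinuousOn Γ.toFun (Γ.piece i) := fun t ht => (Γ.hasDeriv i t ht).continuousWithinAt
  unfold PlaneCurve.transport
  refine ContinuousOn.div (continuousOn_const.mul (Complex.continuous_im.comp_continuousOn
    ((Complex.continuous_conj.comp_continuousOn h1).mul (Γ.vel_continuous i).continuousOn)))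
    (continuousOn_const.add (h1.norm.pow 2)) fun t _ => by positivity

/-- A function that is continuous on the pieces of a subdivided interval has a common continuous
antiderivative. -/
theorem exists_antiderivative_of_knot {n : ℕ} {k : Fin (n + 1) → ℝ} (hk : StrictMono k)
    {f : Fin n → ℝ → ℝ} (hf : ∀ i, ContinuousOn (f i) (Icc (k i.castSucc) (k i.succ))) :
    ∃ Φ : ℝ → ℝ, ∀ i, ∀ t ∈ Icc (k i.castSucc) (k i.succ),
      HasDerivWithinAt Φ (f i t) (Icc (k i.castSucc) (k i.succ)) t := by
  have hlt : ∀ i : Fin n, k i.castSucc ≤ k i.succ := fun i => (hk i.castSucc_lt_succ).le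
  set g : Fin n → ℝ → ℝ := fun i => IccExtend (hlt i)
    ((Icc (k i.castSucc) (k i.succ)).domRestrict (f i)) with hg
  have hgc : ∀ i, Continuous (g i) := fun i =>
    (continuousOn_iff_continuous_domRestrict.1 (hf i)).Icc_extend'
  have hgf : ∀ i, ∀ t ∈ Icc (k i.castSucc) (k i.succ), g i t = f i t := fun i t ht =>
    IccExtend_of_mem (hlt i) ((Icc (k i.castSucc) (k i.succ)).domRestrict (f i)) ht
  -- Each piece contributes an antiderivative that is constant on the other pieces.
  set F : Fin n → ℝ → ℝ := fun i t =>
    ∫ u in (k i.castSucc)..(projIcc (k i.castSucc) (k i.succ) (hlt i) t : ℝ), g i u with hF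
  refine ⟨fun t => ∑ i, F i t, fun i t ht => ?_⟩
  have h : ∀ j, HasDerivWithinAt (F j) (if j = i then f i t else 0)
      (Icc (k i.castSucc) (k i.succ)) t := by
    intro j
    split_ifs with hji
    · subst hji
      rw [← hgf j t ht]
      refine ((intervalIntegral.integral_hasDerivAt_right
        ((hgc j).intervalIntegrable (k j.castSucc) t)
        (hgc j).stronglyMeasurable.stronglyMeasurableAtFilter
        (hgc j).continuousAt).hasDerivWithinAt (s := Icc (k j.castSucc) (k j.succ))).congr_of_mem
        (fun u hu => ?_) ht
      simp only [hF, projIcc_of_mem _ hu]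
    · have hconst : ∃ r, ∀ u ∈ Icc (k i.castSucc) (k i.succ), F j u = r := by
        rcases lt_or_gt_of_ne hji with hlt' | hgt
        · refine ⟨F j (k j.succ), fun u hu => ?_⟩
          have h1 : k j.succ ≤ u := (hk.monotone (by
            rw [Fin.le_def]; simpa [Nat.succ_le_iff] using hlt')).trans hu.1
          simp only [hF, projIcc_of_right_le _ h1, projIcc_right]
        · refine ⟨F j (k j.castSucc), fun u hu => ?_⟩
          have h1 : u ≤ k j.castSucc := hu.2.trans (hk.monotone (by
            rw [Fin.le_def]; simpa [Nat.succ_le_iff] using hgt))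
          simp only [hF, projIcc_of_le_left _ h1, projIcc_left]
      obtain ⟨r, hr⟩ := hconst
      exact (hasDerivWithinAt_const t _ r).congr_of_mem hr ht
  have hsum := HasDerivWithinAt.fun_sum (u := Finset.univ) fun j _ => h j
  simpa using hsum

/-- A function on the knots that agrees at the two ends of each piece is constant. -/
theorem apply_eq_apply_zero_of_castSucc_eq_succ {α : Type*} {n : ℕ} {f : Fin (n + 1) → α}
    (h : ∀ i : Fin n, f i.castSucc = f i.succ) (i : Fin (n + 1)) : f i = f 0 := by
  induction i using Fin.induction with
  | zero => rfl
  | succ i ih => rw [← h i, ih]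

namespace SimpleClosedSphereCurve

variable {C : SimpleClosedSphereCurve} {b : OrthonormalBasis (Fin 3) ℝ E3}

/-- The derivative of the coordinate `η` of a tangent vector field along the curve is the coordinate
of its covariant derivative, plus `I * transport * η` from the rotation of the frame. -/
theorem hasDerivWithinAt_tcoord (hq : -b 2 ∉ C.trace) (i : Fin C.n) {s : ℝ} (hs : s ∈ C.piece i)
    {w : ℝ → E3} {w' : E3} (hw : HasDerivWithinAt w w' (C.piece i) s)
    (htan : ∀ t ∈ C.piece i, inner ℝ (C.toFun t) (w t) = 0) :
    HasDerivWithinAt (fun t => tcoord b (C.toFun t) (w t))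
      (tcoord b (C.toFun s) (tangentialPart (C.toFun s) w') +
        Complex.I * (C.planeCurve b hq).transport i s * tcoord b (C.toFun s) (w s))
      (C.piece i) s := by
  have hp := C.norm_of_mem_piece hs
  have hh := height_pos_of_mem_piece hq hs
  have hi : ∀ j, HasDerivWithinAt (fun t => ((inner ℝ (b j) (w t) : ℝ) : ℂ))
      ((inner ℝ (b j) w' : ℝ) : ℂ) (C.piece i) s := fun j => by
    have := (innerSL ℝ (b j)).hasFDerivAt.comp_hasDerivWithinAt s hw
    exact HasDerivWithinAt.ofReal_comp this
  have hZ : HasDerivWithinAt (fun t => stereo b (C.toFun t)) ((C.planeCurve b hq).vel i s)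
      (C.piece i) s := (C.planeCurve b hq).hasDeriv i s hs
  have hμ : inner ℝ (C.toFun s) w' = -inner ℝ (C.velocity i s) (w s) := by
    have h1 := (C.hasDerivWithinAt i hs).inner ℝ hw
    have h2 : HasDerivWithinAt (fun t => inner ℝ (C.toFun t) (w t)) 0 (C.piece i) s :=
      (hasDerivWithinAt_const s _ (0 : ℝ)).congr_of_mem htan hs
    have h3 := (C.uniqueDiffOn_piece i s hs).eq_deriv _ h1 h2
    linarith
  have h1 := ((hi 0).add ((hi 1).mul_const Complex.I)).sub (hZ.mul (hi 2))
  have h1' : HasDerivWithinAt (fun t => tcoord b (C.toFun t) (w t)) _ (C.piece i) s := h1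
  convert! h1' using 1
  have hvel : tcoord b (C.toFun s) (C.velocity i s) =
      ((1 + inner ℝ (b 2) (C.toFun s) : ℝ) : ℂ) * (C.planeCurve b hq).vel i s := by
    rw [planeCurve_vel hq i hs, mul_div_cancel₀]
    exact_mod_cast hh.ne'
  have hμ' := re_conj_tcoord_mul hp hh (C.inner_velocity i hs) (htan s hs)
  rw [hvel] at hμ'
  have hw3 := inner_two_eq hp hh (htan s hs)
  have hω : (C.planeCurve b hq).transport i s = (1 + inner ℝ (b 2) (C.toFun s)) *
      ((starRingEnd ℂ) (stereo b (C.toFun s)) * (C.planeCurve b hq).vel i s).im := by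
    change 2 * ((starRingEnd ℂ) (stereo b (C.toFun s)) * (C.planeCurve b hq).vel i s).im /
      (1 + ‖stereo b (C.toFun s)‖ ^ 2) = _
    rw [one_add_norm_sq_stereo hp hh]
    field_simp
  have htc : tcoord b (C.toFun s) (tangentialPart (C.toFun s) w') = ((inner ℝ (b 0) w' : ℝ) : ℂ) +
      ((inner ℝ (b 1) w' : ℝ) : ℂ) * Complex.I -
        stereo b (C.toFun s) * ((inner ℝ (b 2) w' : ℝ) : ℂ) -
      ((inner ℝ (C.toFun s) w' : ℝ) : ℂ) * stereo b (C.toFun s) := by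
    rw [tangentialPart, tcoord_sub, tcoord_smul, tcoord_self hh, tcoord]
  rw [htc, hμ, ← hμ', hw3, hω]
  generalize tcoord b (C.toFun s) (w s) = η
  generalize stereo b (C.toFun s) = Z
  generalize (C.planeCurve b hq).vel i s = v
  generalize 1 + inner ℝ (b 2) (C.toFun s) = l
  apply Complex.ext <;>
  simp only [Complex.add_re, Complex.sub_re, Complex.mul_re, Complex.add_im, Complex.sub_im,
    Complex.mul_im, Complex.ofReal_re, Complex.ofReal_im, Complex.I_re, Complex.I_im,
    Complex.conj_re, Complex.conj_im] <;> ring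

theorem hasDerivWithinAt_exp_neg_mul_I {Φ : ℝ → ℝ} {Φ' t : ℝ} {S : Set ℝ}
    (h : HasDerivWithinAt Φ Φ' S t) :
    HasDerivWithinAt (fun t => Complex.exp (-(Φ t * Complex.I)))
      (Complex.exp (-(Φ t * Complex.I)) * -(Φ' * Complex.I)) S t :=
  ((HasDerivWithinAt.ofReal_comp h).mul_const Complex.I).fun_neg.cexp

/-- Parallel vectors turn with the angular velocity `transport`. -/
theorem IsParallel.tcoord_eq {w : ℝ → E3} (hw : C.IsParallel w) (hq : -b 2 ∉ C.trace)
    {Φ : ℝ → ℝ} (hΦ : ∀ i, ∀ t ∈ C.piece i,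
      HasDerivWithinAt Φ ((C.planeCurve b hq).transport i t) (C.piece i) t) {s : ℝ}
    (hs : s ∈ Icc C.start C.finish) : tcoord b (C.toFun s) (w s) =
      Complex.exp ((Φ s - Φ C.start : ℝ) * Complex.I) * tcoord b (C.toFun C.start) (w C.start) := by
  set F : ℝ → ℂ := fun t => Complex.exp (-(Φ t * Complex.I)) * tcoord b (C.toFun t) (w t) with hF
  have hconst : ∀ i, ∀ t ∈ C.piece i, F t = F (C.knot i.castSucc) := by
    intro i
    have hd : ∀ t ∈ C.piece i, HasDerivWithinAt F 0 (C.piece i) t := by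
      intro t ht
      have h1 := hasDerivWithinAt_tcoord hq i ht
        (hw.differentiableOn i t ht).hasDerivWithinAt fun t ht => hw.tangent t (C.piece_subset i ht)
      rw [hw.parallel i t ht] at h1
      have h2 := (hasDerivWithinAt_exp_neg_mul_I (hΦ i t ht)).mul h1
      convert! h2 using 1
      simp only [tcoord, inner_zero_right]
      push_cast
      ring
    exact constant_of_derivWithin_zero (fun t ht => (hd t ht).differentiableWithinAt)
      fun t ht => (hd t (Ico_subset_Icc_self ht)).derivWithin
        (C.uniqueDiffOn_piece i t (Ico_subset_Icc_self ht))
  have hall : F s = F C.start := by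
    obtain ⟨i, hi⟩ := exists_mem_Icc_knot C.knot C.knot_strictMono C.n_pos hs
    rw [hconst i s hi]
    exact apply_eq_apply_zero_of_castSucc_eq_succ (f := fun j => F (C.knot j))
      (fun j => (hconst j _ (C.right_mem_piece j)).symm) i.castSucc
  simp only [hF, Complex.exp_neg] at hall
  have h1 := Complex.exp_ne_zero (Φ s * Complex.I)
  have h2 := Complex.exp_ne_zero (Φ C.start * Complex.I)
  rw [Complex.ofReal_sub, sub_mul, Complex.exp_sub]
  field_simp at hall ⊢
  exact hall

/-- Rotating a tangent vector with the angular velocity `transport` yields a parallel field. -/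
theorem isParallel_tvec (hq : -b 2 ∉ C.trace) {Φ : ℝ → ℝ} (hΦ : ∀ i, ∀ t ∈ C.piece i,
      HasDerivWithinAt Φ ((C.planeCurve b hq).transport i t) (C.piece i) t) :
    C.IsParallel fun t => tvec b (C.toFun t) (Complex.exp (Φ t * Complex.I)) := by
  have htan : ∀ t ∈ Icc C.start C.finish,
      inner ℝ (C.toFun t) (tvec b (C.toFun t) (Complex.exp (Φ t * Complex.I))) = 0 :=
    fun t ht => inner_tvec (C.norm_toFun ht) (height_pos hq ht) _
  have hexp : ∀ i, ∀ t ∈ C.piece i, HasDerivWithinAt (fun t => Complex.exp (Φ t * Complex.I))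
      (Complex.exp (Φ t * Complex.I) * ((C.planeCurve b hq).transport i t * Complex.I))
      (C.piece i) t := fun i t ht =>
    ((HasDerivWithinAt.ofReal_comp (hΦ i t ht)).mul_const Complex.I).cexp
  have hdiff : ∀ i : Fin C.n, DifferentiableOn ℝ
      (fun t => tvec b (C.toFun t) (Complex.exp (Φ t * Complex.I))) (C.piece i) := by
    intro i t ht
    have h1 : DifferentiableWithinAt ℝ C.toFun (C.piece i) t :=
      (C.hasDerivWithinAt i ht).differentiableWithinAt
    have h2 : DifferentiableWithinAt ℝ (fun t => stereo b (C.toFun t)) (C.piece i) t :=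
      ((C.planeCurve b hq).hasDeriv i t ht).differentiableWithinAt
    have hre : ∀ {f : ℝ → ℂ}, DifferentiableWithinAt ℝ f (C.piece i) t →
        DifferentiableWithinAt ℝ (fun t => (f t).re) (C.piece i) t := fun hf =>
      Complex.reCLM.differentiableAt.comp_differentiableWithinAt t hf
    have him : ∀ {f : ℝ → ℂ}, DifferentiableWithinAt ℝ f (C.piece i) t →
        DifferentiableWithinAt ℝ (fun t => (f t).im) (C.piece i) t := fun hf =>
      Complex.imCLM.differentiableAt.comp_differentiableWithinAt t hf
    have h3 := (hexp i t ht).differentiableWithinAt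
    unfold tvec
    exact ((hre h3).smul ((differentiableWithinAt_const _).sub
      ((hre h2).smul (h1.add_const _)))).add ((him h3).smul ((differentiableWithinAt_const _).sub
      ((him h2).smul (h1.add_const _))))
  refine ⟨htan, hdiff, fun i t ht => ?_⟩
  have hI := C.piece_subset i ht
  have htc : ∀ t ∈ C.piece i, tcoord b (C.toFun t)
      (tvec b (C.toFun t) (Complex.exp (Φ t * Complex.I))) = Complex.exp (Φ t * Complex.I) :=
    fun t ht => tcoord_tvec (C.norm_of_mem_piece ht) (height_pos_of_mem_piece hq ht) _
  have h1 := hasDerivWithinAt_tcoord hq i ht (hdiff i t ht).hasDerivWithinAt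
    fun t ht => htan t (C.piece_subset i ht)
  have h2 := (C.uniqueDiffOn_piece i t ht).eq_deriv _ h1 ((hexp i t ht).congr_of_mem htc ht)
  rw [htc t ht] at h2
  refine eq_of_tcoord_eq (b := b) (C.norm_toFun hI) (height_pos hq hI) ?_ (inner_zero_right _) ?_
  · rw [tangentialPart, inner_sub_right, inner_smul_right, real_inner_self_eq_norm_sq,
      C.norm_toFun hI]
    ring
  · have h0 : tcoord b (C.toFun t) 0 = 0 := by simp [tcoord]
    rw [h0]
    linear_combination h2

/-! ### The area of the enclosed region -/

/-- The area of the enclosed region is the total angle by which parallel vectors turn in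
stereographic coordinates. -/
theorem enclosedArea_eq (hq : -b 2 ∉ C.trace)
    (hregion : ∀ x, ‖x‖ = 1 → x ∉ C.trace →
      (C.sphereWind b hq x = 1 ∧ x ∈ C.enclosedRegion) ∨
      (C.sphereWind b hq x = 0 ∧ x ∉ C.enclosedRegion)) {Φ : ℝ → ℝ}
    (hΦ : ∀ i, ∀ t ∈ C.piece i,
      HasDerivWithinAt Φ ((C.planeCurve b hq).transport i t) (C.piece i) t) :
    C.enclosedArea = Φ C.finish - Φ C.start := by
  set Γ := C.planeCurve b hq with hΓ
  set A : Set ℂ := {z | z ∉ Γ.trace ∧ Γ.wind z = 1} with hA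
  have hAopen : IsOpen A := by
    rw [isOpen_iff_mem_nhds]
    rintro z ⟨hz, hz1⟩
    filter_upwards [Γ.eventually_wind_eq hz, Γ.isClosed_trace.isOpen_compl.mem_nhds hz]
      with y hy hy'
    exact ⟨hy', hy.trans hz1⟩
  have hplane : ∀ z, z ∉ Γ.trace → (Γ.wind z = 1 ∧ unstereo b z ∈ C.enclosedRegion) ∨
      (Γ.wind z = 0 ∧ unstereo b z ∉ C.enclosedRegion) := by
    intro z hz
    have h3 : unstereo b z ∉ C.trace := by
      rw [← stereo_mem_trace_iff hq (norm_unstereo z) (unstereo_ne z), stereo_unstereo]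
      exact hz
    have h4 := hregion _ (norm_unstereo z) h3
    rwa [sphereWind, if_neg (unstereo_ne z), stereo_unstereo] at h4
  have hset : {x : Metric.sphere (0 : E3) 1 | (x : E3) ∈ C.enclosedRegion} =
      {x : Metric.sphere (0 : E3) 1 | (x : E3) ≠ -b 2 ∧ stereo b x ∈ A} := by
    ext x
    have hx : ‖(x : E3)‖ = 1 := by simp
    simp only [mem_ofPred_eq]
    constructor
    · intro hxR
      have hxC := (enclosedRegion_subset hxR).2
      rcases hregion x hx hxC with ⟨h1, -⟩ | ⟨-, h2⟩
      · have hne : (x : E3) ≠ -b 2 := by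
          intro h
          rw [sphereWind, if_pos h] at h1
          exact zero_ne_one h1
        rw [sphereWind, if_neg hne] at h1
        exact ⟨hne, by rwa [stereo_mem_trace_iff hq hx hne], h1⟩
      · exact absurd hxR h2
    · rintro ⟨hne, h1, h2⟩
      rcases hplane _ h1 with ⟨-, h3⟩ | ⟨h3, -⟩
      · rwa [unstereo_stereo hx hne] at h3
      · rw [h3] at h2
        exact absurd h2 zero_ne_one
  have hint : ∫ z in A, sphereDensity z = ∫ z, sphereDensity z * Γ.wind z := by
    rw [← integral_indicator hAopen.measurableSet]
    refine integral_congr_ae ?_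
    have h0 : ∀ᵐ z : ℂ, z ∉ Γ.trace := measure_eq_zero_iff_ae_notMem.1 Γ.volume_trace
    filter_upwards [h0] with z hz
    rcases hplane z hz with ⟨h1, -⟩ | ⟨h1, -⟩
    · rw [indicator_of_mem (show z ∈ A from ⟨hz, h1⟩), h1, mul_one]
    · rw [indicator_of_notMem (fun h : z ∈ A => by rw [h.2] at h1; exact one_ne_zero h1), h1,
        mul_zero]
  rw [enclosedArea, hset, Measure.real, toSphere_stereo_preimage b hAopen.measurableSet,
    ← integral_eq_lintegral_of_nonneg_ae (Eventually.of_forall sphereDensity_nonneg)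
      continuous_sphereDensity.aestronglyMeasurable, hint, Γ.integral_density_mul_wind]
  have hpiece : ∀ i : Fin C.n, ∫ t in (C.knot i.castSucc)..(C.knot i.succ), Γ.transport i t =
      Φ (C.knot i.succ) - Φ (C.knot i.castSucc) := by
    intro i
    refine intervalIntegral.integral_eq_sub_of_hasDerivAt_of_le (C.knot_lt i).le
      (fun t ht => (hΦ i t ht).continuousWithinAt) (fun t ht =>
      (hΦ i t (Ioo_subset_Icc_self ht)).hasDerivAt (Icc_mem_nhds ht.1 ht.2)) ?_
    refine ContinuousOn.intervalIntegrable ?_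
    rw [uIcc_of_le (C.knot_lt i).le]
    exact Γ.continuousOn_transport i
  exact (Finset.sum_congr rfl fun i _ => hpiece i).trans
    (Fin.sum_succ_sub_castSucc fun j => Φ (C.knot j))

end SimpleClosedSphereCurve

/-! ### The deficit angle -/

namespace SimpleClosedSphereCurve

variable (C : SimpleClosedSphereCurve)

theorem norm_rotateAbout_direction (i : Fin C.n) {s : ℝ} (hs : s ∈ C.piece i) (θ : ℝ) :
    ‖rotateAbout (C.toFun s) θ (C.direction i s)‖ = 1 := by
  obtain ⟨b, hb2, hb⟩ := exists_orthonormalBasis_cross (C.norm_of_mem_piece hs)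
  have hp := C.norm_of_mem_piece hs
  have hh : 0 < 1 + inner ℝ (b 2) (C.toFun s) := by
    rw [hb2, real_inner_self_eq_norm_sq, hp]
    norm_num
  have hd := C.inner_direction i hs
  rw [← norm_tcoord hp hh (inner_rotateAbout hd θ), tcoord_rotateAbout hb hp hh hd, norm_mul,
    Complex.norm_exp_ofReal_mul_I, norm_tcoord hp hh hd, C.norm_direction i hs, one_mul]

/-- The deficit angle is the area of the enclosed region, and parallel vectors return rotated by
this angle. -/
theorem hasDeficitAngle_iff_and_rotateAbout :
    (∀ Ω : ℝ, C.HasDeficitAngle Ω ↔ Ω = C.enclosedArea) ∧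
    (∀ w : ℝ → E3, C.IsParallel w →
      w C.finish = rotateAbout (C.toFun C.start) C.enclosedArea (w C.start)) := by
  obtain ⟨b, hq, ψ, J, hb, hψ, hsum, hcorner, hregion⟩ := exists_adapted_basis C
  have hturn : ∀ i, C.turningAngle i = J i := fun i =>
    turningAngle_eq hb hq i (hcorner i) hregion
  obtain ⟨Φ, hΦ⟩ := exists_antiderivative_of_knot C.knot_strictMono
    (C.planeCurve b hq).continuousOn_transport
  have hΦ' : ∀ i, ∀ t ∈ C.piece i,
      HasDerivWithinAt Φ ((C.planeCurve b hq).transport i t) (C.piece i) t := hΦ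
  have harea := enclosedArea_eq hq hregion hΦ'
  have hstart : C.start ∈ Icc C.start C.finish := left_mem_Icc.2 C.start_lt_finish.le
  have hfinish : C.finish ∈ Icc C.start C.finish := right_mem_Icc.2 C.start_lt_finish.le
  -- the relative angle is the difference of two angles in the stereographic chart
  have hrot : ∀ α : Fin C.n → ℝ → ℝ,
      (∀ i, α i (C.knot i.succ) + ψ i (C.knot i.succ) -
        (α i (C.knot i.castSucc) + ψ i (C.knot i.castSucc)) =
          Φ (C.knot i.succ) - Φ (C.knot i.castSucc)) →
      2 * π + C.relativeRotation α = C.enclosedArea := by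
    intro α hα
    have h1 : ∑ i : Fin C.n, (Φ (C.knot i.succ) - Φ (C.knot i.castSucc)) =
        C.enclosedArea := by
      rw [harea]
      exact Fin.sum_succ_sub_castSucc fun j => Φ (C.knot j)
    have h2 : ∑ i : Fin C.n, (Φ (C.knot i.succ) - Φ (C.knot i.castSucc)) =
        ∑ i : Fin C.n, (α i (C.knot i.succ) - α i (C.knot i.castSucc)) +
          ∑ i : Fin C.n, (ψ i (C.knot i.succ) - ψ i (C.knot i.castSucc)) := by
      rw [← Finset.sum_add_distrib]
      refine Finset.sum_congr rfl fun i _ => ?_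
      rw [← hα i]
      ring
    rw [relativeRotation, Finset.sum_congr rfl fun i _ => hturn i]
    linarith
  -- the coordinate of the direction of the curve
  have hdir : ∀ i, ∀ t ∈ C.piece i, tcoord b (C.toFun t) (C.direction i t) =
      Complex.exp (ψ i t * Complex.I) := by
    intro i t ht
    obtain ⟨r, hr, hv⟩ := exists_pos_planeCurve_vel hq i ht
    have h1 := norm_tcoord (C.norm_of_mem_piece ht) (height_pos_of_mem_piece hq ht)
      (C.inner_direction i ht)
    rw [C.norm_direction i ht] at h1
    rw [(hψ i).exp_eq ht, hv, norm_mul, h1, Complex.norm_real, Real.norm_of_nonneg hr.le, mul_one,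
      mul_div_cancel_left₀]
    exact_mod_cast hr.ne'
  refine ⟨fun Ω => ⟨?_, ?_⟩, fun w hw => ?_⟩
  · rintro ⟨w, α, hw, hnorm, hα, rfl⟩
    refine hrot α fun i => ?_
    have hw0 : tcoord b (C.toFun C.start) (w C.start) ≠ 0 := by
      rw [← norm_pos_iff, norm_tcoord (C.norm_toFun hstart) (height_pos hq hstart)
        (hw.tangent _ hstart), hnorm _ hstart]
      exact one_pos
    have hformula := fun t (ht : t ∈ C.piece i) => hw.tcoord_eq hq hΦ' (C.piece_subset i ht)
    have hrel : ∀ t ∈ C.piece i, tcoord b (C.toFun t) (w t) =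
        Complex.exp ((α i t + ψ i t : ℝ) * Complex.I) := by
      intro t ht
      rw [(hα i).2 t ht, tcoord_rotateAbout hb (C.norm_of_mem_piece ht)
        (height_pos_of_mem_piece hq ht) (C.inner_direction i ht), hdir i t ht, ← Complex.exp_add]
      push_cast
      ring_nf
    have hcont : ContinuousOn (fun t => α i t + ψ i t - Φ t) (C.piece i) :=
      ((hα i).1.add (hψ i).continuousOn).sub fun t ht => (hΦ' i t ht).continuousWithinAt
    have h1 := isPreconnected_Icc.eq_of_exp_mul_I_eq hcont
      (u := Complex.exp (-(Φ C.start * Complex.I)) *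
        tcoord b (C.toFun C.start) (w C.start)) (fun t ht => by
        have h2 := (hrel t ht).symm.trans (hformula t ht)
        rw [Complex.ofReal_sub, sub_mul, Complex.exp_sub, h2, Complex.ofReal_sub, sub_mul,
          Complex.exp_sub, Complex.exp_neg]
        have h3 := Complex.exp_ne_zero (Φ t * Complex.I)
        field_simp) (C.right_mem_piece i) (C.left_mem_piece i)
    linarith
  · rintro rfl
    refine ⟨fun t => tvec b (C.toFun t) (Complex.exp (Φ t * Complex.I)), fun i t => Φ t - ψ i t,
      isParallel_tvec hq hΦ', fun t ht => ?_, fun i => ⟨?_, fun t ht => ?_⟩, ?_⟩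
    · rw [← norm_tcoord (C.norm_toFun ht) (height_pos hq ht)
        (inner_tvec (C.norm_toFun ht) (height_pos hq ht) _),
        tcoord_tvec (C.norm_toFun ht) (height_pos hq ht), Complex.norm_exp_ofReal_mul_I]
    · exact ContinuousOn.sub (fun t ht => (hΦ' i t ht).continuousWithinAt) (hψ i).continuousOn
    · have hp := C.norm_of_mem_piece ht
      have hh := height_pos_of_mem_piece hq ht
      refine eq_of_tcoord_eq hp hh (inner_tvec hp hh _)
        (inner_rotateAbout (C.inner_direction i ht) _) ?_
      rw [tcoord_tvec hp hh, tcoord_rotateAbout hb hp hh (C.inner_direction i ht), hdir i t ht,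
        ← Complex.exp_add]
      push_cast
      ring_nf
    · exact (hrot _ fun i => by ring).symm
  · have hp := C.norm_toFun hstart
    have hh := height_pos hq hstart
    have ht1 := hw.tangent _ hstart
    have ht2 : inner ℝ (C.toFun C.start) (w C.finish) = 0 := by
      rw [C.closed']
      exact hw.tangent _ hfinish
    refine eq_of_tcoord_eq hp hh ht2 (inner_rotateAbout ht1 _) ?_
    rw [tcoord_rotateAbout hb hp hh ht1, harea, ← hw.tcoord_eq hq hΦ' hfinish, C.closed']

end SimpleClosedSphereCurve

/-! ### Circles of latitude -/

/-- The unit tangent vector of the circles of latitude, pointing east. -/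
noncomputable def east (t : ℝ) : E3 :=
  !₂[-Real.sin (2 * π * t), Real.cos (2 * π * t), 0]

theorem norm_east (t : ℝ) : ‖east t‖ = 1 := by
  rw [EuclideanSpace.norm_eq, Real.sqrt_eq_one]
  simp [Fin.sum_univ_three, east]

/-- The tangent vector pointing north is the position vector at the latitude `φ + π / 2`. -/
theorem cross_latitudePath_east (φ t : ℝ) :
    cross (latitudePath φ t) (east t) = latitudePath (φ + π / 2) t := by
  have h := Real.sin_sq_add_cos_sq (2 * π * t)
  apply E3.ext
  · simp [cross_apply_zero, latitudePath, east, Real.cos_add_pi_div_two]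
    ring
  · simp [cross_apply_one, latitudePath, east, Real.cos_add_pi_div_two]
    ring
  · simp [cross_apply_two, latitudePath, east, Real.sin_add_pi_div_two]
    linear_combination Real.cos φ * h

theorem hasDerivAt_east (φ t : ℝ) : HasDerivAt east
    (-(2 * π) • (Real.cos φ • latitudePath φ t - Real.sin φ • latitudePath (φ + π / 2) t)) t := by
  rw [← hasDerivWithinAt_univ, hasDerivWithinAt_iff_hasFDerivWithinAt,
    hasFDerivWithinAt_euclidean]
  have h : HasDerivAt (fun t : ℝ => 2 * π * t) (2 * π) t := by
    simpa using (hasDerivAt_id t).const_mul (2 * π)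
  have h1 := Real.sin_sq_add_cos_sq φ
  intro i
  rw [hasFDerivWithinAt_univ, hasFDerivAt_iff_hasDerivAt]
  fin_cases i
  · convert! h.sin.neg using 1
    simp [latitudePath, Real.cos_add_pi_div_two]
    linear_combination (2 * π * Real.cos (2 * π * t)) * h1
  · convert! h.cos using 1
    simp [latitudePath, Real.cos_add_pi_div_two]
    linear_combination (2 * π * Real.sin (2 * π * t)) * h1
  · convert! hasDerivAt_const t (0 : ℝ) using 1
    simp [latitudePath, Real.sin_add_pi_div_two]
    ring

section Latitude

variable (φ : ℝ) (hφ : φ ∈ Ioo (-(π / 2)) (π / 2))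

theorem latitudeCircle_velocity (i : Fin (latitudeCircle φ hφ).n) {t : ℝ}
    (ht : t ∈ (latitudeCircle φ hφ).piece i) :
    (latitudeCircle φ hφ).velocity i t = (2 * π * Real.cos φ) • east t := by
  have h1 := (latitudeCircle φ hφ).hasDerivWithinAt i ht
  have h2 := (latitudePath_hasDerivAt φ t).hasDerivWithinAt
    (s := (latitudeCircle φ hφ).piece i)
  rw [((latitudeCircle φ hφ).uniqueDiffOn_piece i t ht).eq_deriv _ h1 h2]
  apply E3.ext <;> simp [east]
  all_goals ring

theorem latitudeCircle_direction (i : Fin (latitudeCircle φ hφ).n) {t : ℝ}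
    (ht : t ∈ (latitudeCircle φ hφ).piece i) :
    (latitudeCircle φ hφ).direction i t = east t := by
  have h : 0 < 2 * π * Real.cos φ :=
    mul_pos Real.two_pi_pos (Real.cos_pos_of_mem_Ioo hφ)
  rw [SimpleClosedSphereCurve.direction, latitudeCircle_velocity φ hφ i ht, norm_smul, norm_east,
    mul_one, Real.norm_of_nonneg h.le, smul_smul, inv_mul_cancel₀ h.ne', one_smul]

theorem latitudeCircle_knot_castSucc (i : Fin (latitudeCircle φ hφ).n) :
    (latitudeCircle φ hφ).knot i.castSucc = 0 := by
  have h : i.castSucc = 0 := congrArg Fin.castSucc (Subsingleton.elim (α := Fin 1) i 0)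
  rw [h]
  exact Nat.cast_zero

theorem latitudeCircle_knot_succ (i : Fin (latitudeCircle φ hφ).n) :
    (latitudeCircle φ hφ).knot i.succ = 1 := by
  have h : i.succ = 1 := congrArg Fin.succ (Subsingleton.elim (α := Fin 1) i 0)
  rw [h]
  exact Nat.cast_one

theorem latitudeCircle_turningAngle (i : Fin (latitudeCircle φ hφ).n) :
    (latitudeCircle φ hφ).turningAngle i = 0 := by
  have hrot : finRotate (latitudeCircle φ hφ).n i = i := Subsingleton.elim (α := Fin 1) _ _
  have h1 : (latitudeCircle φ hφ).directionBefore i = east 0 := by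
    rw [SimpleClosedSphereCurve.directionBefore, latitudeCircle_direction φ hφ i
      ((latitudeCircle φ hφ).right_mem_piece i), latitudeCircle_knot_succ]
    simp [east]
  have h2 : (latitudeCircle φ hφ).directionAfter i = east 0 := by
    rw [SimpleClosedSphereCurve.directionAfter, hrot, latitudeCircle_direction φ hφ i
      ((latitudeCircle φ hφ).left_mem_piece i), latitudeCircle_knot_castSucc]
  have h3 : inner ℝ (east 0) (east 0) = 1 := by
    rw [real_inner_self_eq_norm_sq, norm_east, one_pow]
  rw [SimpleClosedSphereCurve.turningAngle, h1, h2, if_neg, h3, real_inner_comm,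
    inner_cross_self_right]
  · exact Complex.arg_one
  · intro h
    have h4 : inner ℝ (east 0) (east 0) = inner ℝ (east 0) (-east 0) := congrArg _ h
    rw [inner_neg_right, h3] at h4
    norm_num at h4

/-- The parallel field that starts in the direction of a circle of latitude turns relative to the
circle with the angular velocity `-2π sin φ`. -/
theorem latitudeCircle_hasDeficitAngle :
    (latitudeCircle φ hφ).HasDeficitAngle (2 * π * (1 - Real.sin φ)) := by
  set C := latitudeCircle φ hφ with hC
  set θ : ℝ → ℝ := fun t => -(2 * π * Real.sin φ * t) with hθ
  have hθd : ∀ t, HasDerivAt θ (-(2 * π * Real.sin φ)) t := fun t => by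
    simpa using ((hasDerivAt_id t).const_mul (2 * π * Real.sin φ)).fun_neg
  have hc : ∀ t, C.toFun t = latitudePath φ t := fun t => rfl
  have hI : Icc C.start C.finish = C.piece ⟨0, C.n_pos⟩ := rfl
  have hdir : ∀ i, ∀ t ∈ C.piece i, C.direction i t = east t := fun i t ht =>
    latitudeCircle_direction φ hφ i ht
  have hw' : ∀ t, HasDerivAt (fun t => rotateAbout (latitudePath φ t) (θ t) (east t))
      (-(2 * π * Real.cos φ * Real.cos (θ t)) • latitudePath φ t) t := by
    intro t
    have h1 : HasDerivAt (latitudePath (φ + π / 2)) (-(2 * π * Real.sin φ) • east t) t := by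
      convert! latitudePath_hasDerivAt (φ + π / 2) t using 1
      apply E3.ext <;> simp [east, Real.cos_add_pi_div_two]
      all_goals ring
    have h2 := ((hθd t).cos.smul (hasDerivAt_east φ t)).add ((hθd t).sin.smul h1)
    have h3 : (fun t => rotateAbout (latitudePath φ t) (θ t) (east t)) =
        fun t => Real.cos (θ t) • east t + Real.sin (θ t) • latitudePath (φ + π / 2) t :=
      funext fun t => by rw [rotateAbout, cross_latitudePath_east]
    rw [h3]
    convert! h2 using 1
    module
  refine ⟨fun t => rotateAbout (latitudePath φ t) (θ t) (east t), fun _ => θ,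
    ⟨fun t ht => ?_, fun i t _ => (hw' t).differentiableAt.differentiableWithinAt,
      fun i t ht => ?_⟩, fun t ht => ?_, fun i => ⟨?_, fun t ht => ?_⟩, ?_⟩
  · rw [hI] at ht
    rw [← hdir _ t ht]
    exact inner_rotateAbout (C.inner_direction _ ht) _
  · rw [(hw' t).hasDerivWithinAt.derivWithin (C.uniqueDiffOn_piece i t ht), tangentialPart, hc,
      inner_smul_right, real_inner_self_eq_norm_sq, ← hc, C.norm_of_mem_piece ht]
    simp
  · rw [hI] at ht
    simp only [← hdir _ t ht]
    exact C.norm_rotateAbout_direction _ ht _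
  · exact fun t _ => (hθd t).continuousAt.continuousWithinAt
  · rw [hdir i t ht, hc]
  · have h1 : ∀ i, C.turningAngle i = 0 := latitudeCircle_turningAngle φ hφ
    have h2 : ∀ i : Fin C.n, θ (C.knot i.succ) - θ (C.knot i.castSucc) =
        -(2 * π * Real.sin φ) := fun i => by
      rw [latitudeCircle_knot_castSucc, latitudeCircle_knot_succ]
      simp [hθ]
    have h3 : C.n = 1 := rfl
    simp only [SimpleClosedSphereCurve.relativeRotation, h1, h2, Finset.sum_const, Finset.card_univ,
      Fintype.card_fin, h3]
    simp
    ring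

end Latitude

theorem mainTheorem5 :
    (∀ C : SimpleClosedSphereCurve,
      (∀ Ω : ℝ, C.HasDeficitAngle Ω ↔ Ω = C.enclosedArea) ∧
      (∀ w : ℝ → E3, C.IsParallel w →
        w C.finish = rotateAbout (C.toFun C.start) C.enclosedArea (w C.start))) ∧
    (∀ (φ : ℝ) (hφ : φ ∈ Ioo (-(π / 2)) (π / 2)),
      (∀ Ω : ℝ, (latitudeCircle φ hφ).HasDeficitAngle Ω ↔ Ω = 2 * π * (1 - Real.sin φ)) ∧
      (latitudeCircle φ hφ).enclosedArea = 2 * π * (1 - Real.sin φ)) := by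
  refine ⟨fun C => C.hasDeficitAngle_iff_and_rotateAbout, fun φ hφ => ?_⟩
  have h1 := (latitudeCircle φ hφ).hasDeficitAngle_iff_and_rotateAbout.1
  have h2 := (h1 _).1 (latitudeCircle_hasDeficitAngle φ hφ)
  refine ⟨fun Ω => ?_, h2.symm⟩
  rw [h1, h2]
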